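/- **Setting.** Let $n\ge 3$ and $k\ge 1$. A pairwise graphical model on $[k]^n$ is given by matrices $W_{ij}\in\mathbb R^{k\times k}$ ($i\ne j\in[n]$) with $W_{ij}=W_{ji}^{T}$ whose rows and columns all sum to zero, and vectors $\theta_i\in\mathbb R^k$; its distribution is $$\Pr[Z=z]\propto\exp\Big(\sum_{i<j}W_{ij}(z_i,z_j)+\sum_i\theta_i(z_i)\Big),\qquad z\in[k]^n .$$ Its width is $\max_{i,a}\big(\sum_{j\ne i}\max_b|W_{ij}(a,b)|+|\theta_i(a)|\big)$. Write $\|w\|_{2,q}$ for the $\ell_q$ norm of the vector of Euclidean row norms of $w\in\mathbb R^{n\times k}$, and $\sigma(t)=1/(1+e^{-t})$. **Mirror descent.** Given a finite family $S$ of samples $(x^s,y^s)\in\{0,1\}^{n\times k}\times\{-1,1\}$, a radius $R\ge 0$ and a number $T$ of iterations, put $\hat x^s=Rx^s$, $\hat y^s=(y^s+1)/2$, $p=1+1/\ln n$, $\Phi(w)=\frac{e\ln n}{p}\|w\|_{2,p}^p$ and $\gamma=\frac1{2R}\sqrt{e\ln n/T}$. Let every entry of $w^1$ be $1/(n\sqrt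 k)$ and, for $t=1,\dots,T$, $$g^t=\frac1{|S|}\sum_{s\in S}\big(\sigma(\langle w^t,\hat x^s\rangle)-\hat y^s\big)\hat x^s,\qquad w^{t+1}\in\operatorname*{arg\,min}_{\|u\|_{2,1}\le1}\ \Phi(u)-\langle\nabla\Phi(w^t)-\gamma g^t,u\rangle .$$ The output is $\bar w=R\cdot\frac1T\sum_{t=1}^Tw^t$. (Divisions by zero, for $S=\emptyset$ or $R=0$, have the value $0$.) **Learning algorithm.** The input is a list of samples $z^1,\dots,z^N\in[k]^n$, a bound $\lambda$ on the width, a threshold parameter $\eta$ and the number $T$. For every $i\in[n]$ and $\alpha\ne\beta\in[k]$, apply mirror descent with $R=2\lambda\sqrt k$ to the samples with $z^m_i\in\{\alpha,\beta\}$, where $x^m$ is the one-hot encoding of the other variables together with a row for the constant first symbol, and $y^m=1$ if $z^m_i=\alpha$, $y^m=-1$ otherwise. In the output matrix, subtract from every row $j\neq i$ its mean (adding the sum of these means to every entry of the constant row); call the result $U^{\alpha,\beta}$, and put $U^{\alpha,\alpha}=0$. Then $\hat W_{ij}(\alpha,b)=\frac1k\sum_\beta U^{\alpha,\beta}(j,b)$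 for $j\ne i$, and $\hat G$ has the edges $i<j$ with $\max_{a,b}|\hat W_{ij}(a,b)|\ge\eta/2$. **Implementation.** Steps are counted on real numbers: each arithmetic operation, square root, exponential, logarithm or comparison, and each pass through a loop or write to an array cell, costs one step. The algorithm is implemented as an explicit program of this kind. In an update step, with $\xi=\nabla\Phi(w^t)-\gamma g^t$, it sets row $j$ of $w^{t+1}$ to the multiple of $\xi_j$ of Euclidean norm $\big((\|\xi_j\|_2-\nu)_+/(e\ln n)\big)^{\ln n}$, where $\nu=0$ if these norms then sum to at most $1$, and otherwise $\nu$ is the upper end after $|S|$ bisection steps, started from $[0,\max_j\|\xi_j\|_2]$, for the equation saying that the norms sum to $1$. Regressions without samples are skipped. **Theorem.** There are absolute constants $C>0$ and $K$ such that the following holds for all $n\ge3$, $k\ge1$, every pairwise graphical model on $[k]^n$ of width at most $\lambda$, all $\rho\in(0,1)$, $\epsilon\in(0,1]$, $\eta\in\mathbb R$, and all integers $T,N\ge1$. 1. Let $$T\ \ge\ C\,\frac{\lambda^2k^3e^{12\lambda}\ln n}{\epsilon^4}\qquad\text{and}\qquad N\ \ge\ C\,\frac{\lambda^2k^4e^{14\lambda}\ln(nk/\rho)}{\epsilon^4},$$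 and let $z^1,\dots,z^N$ be i.i.d. samples of the model. Then, with probability at least $1-\rho$, the learning algorithm with exact update steps has an output and every output satisfies $$|W_{ij}(a,b)-\hat W_{ij}(a,b)|\le\epsilon\qquad\text{for all } i\ne j\in[n],\ a,b\in[k].$$ Likewise, with probability at least $1-\rho$, the output of the program satisfies this bound. 2. For every list of $N$ samples, the program takes at most $K\cdot T\,N\,n^2k^2$ steps in total, and it carries out the learning algorithm, where in a regression on $m$ samples each update step finds a feasible point whose objective is within $16(\ln n)^2\,2^{-m}$ of the minimum. -/

import Mathlib

open MeasureTheory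

noncomputable section

namespace PairwiseMRF

/-! ## Pairwise graphical models -/

/-- Parameters of a pairwise graphical model on `n` variables over the alphabet `Fin k`:
weight matrices `W i j` for `i ≠ j` with `W i j = (W j i)ᵀ` and with centered rows and columns, and
external fields `θ i`. The entries `W i i` carry no meaning and are never used. -/
structure Model (n k : ℕ) where
  W : Fin n → Fin n → Fin k → Fin k → ℝ
  θ : Fin n → Fin k → ℝ
  symm : ∀ i j, i ≠ j → ∀ a b, W i j a b = W j i b a
  row_centered : ∀ i j, i ≠ j → ∀ a, ∑ b, W i j a b = 0
  col_centered : ∀ i j, i ≠ j → ∀ b, ∑ a, W i j a b = 0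

/-- The width `max_{i,a} (∑_{j ≠ i} max_b |W i j a b| + |θ i a|)`. -/
def Model.width {n k : ℕ} (M : Model n k) : ℝ :=
  ⨆ i, ⨆ a, ((∑ j ∈ Finset.univ.erase i, ⨆ b, |M.W i j a b|) + |M.θ i a|)

/-- The unnormalized probability of a configuration. -/
def Model.weight {n k : ℕ} (M : Model n k) (z : Fin n → Fin k) : ℝ :=
  Real.exp ((∑ i, ∑ j ∈ Finset.univ.filter (fun j => i < j), M.W i j (z i) (z j))
    + ∑ i, M.θ i (z i))

/-- The distribution of the model on `Fin n → Fin k`. -/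
def Model.law {n k : ℕ} (M : Model n k) : Measure (Fin n → Fin k) :=
  ∑ z, ENNReal.ofReal (M.weight z / ∑ z', M.weight z') • Measure.dirac z

/-- The joint law of `N` i.i.d. samples. -/
def Model.samples {n k : ℕ} (M : Model n k) (N : ℕ) : Measure (Fin N → Fin n → Fin k) :=
  Measure.pi fun _ => M.law

/-- Entrywise `ε`-accuracy of an estimate of the weight matrices. -/
def Model.Close {n k : ℕ} (M : Model n k) (ε : ℝ)
    (What : Fin n → Fin n → Fin k → Fin k → ℝ) : Prop :=
  ∀ i j, i ≠ j → ∀ a b, |M.W i j a b - What i j a b| ≤ ε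

/-! ## Matrix norms and the mirror map -/

/-- Real `n × k` matrices. -/
abbrev Mat (n k : ℕ) := Fin n → Fin k → ℝ

/-- The Euclidean norm of row `j`. -/
def rowNorm {n k : ℕ} (w : Mat n k) (j : Fin n) : ℝ := √(∑ b, w j b ^ 2)

/-- The group norm `‖w‖_{2,q}`. -/
def groupNorm {n k : ℕ} (q : ℝ) (w : Mat n k) : ℝ := (∑ j, rowNorm w j ^ q) ^ (1 / q)

/-- The dot product of two matrices. -/
def dot {n k : ℕ} (u w : Mat n k) : ℝ := ∑ j, ∑ b, u j b * w j b

/-- The mirror map `Φ(w) = (e ln n / p) ‖w‖_{2,p}^p` with `p = 1 + 1 / ln n`. -/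
def mirrorMap {n k : ℕ} (w : Mat n k) : ℝ :=
  Real.exp 1 * Real.log n / (1 + 1 / Real.log n)
    * groupNorm (1 + 1 / Real.log n) w ^ (1 + 1 / Real.log n)

/-! ## Mirror descent for `ℓ_{2,1}`-constrained logistic regression -/

/-- The step size for radius `R` and `T` iterations. -/
def stepSize (n : ℕ) (R : ℝ) (T : ℕ) : ℝ :=
  1 / (2 * R) * √(Real.exp 1 * Real.log n / T)

/-- The gradient `(1/|S|) ∑_{s ∈ S} (σ(⟨w, x̂ˢ⟩) - ŷˢ) x̂ˢ`, where `x̂ˢ = R xˢ` and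
`ŷˢ = (yˢ + 1) / 2`. -/
def lossGrad {n k : ℕ} {ι : Type} (S : Finset ι) (x : ι → Mat n k) (y : ι → ℝ) (R : ℝ)
    (w : Mat n k) : Mat n k :=
  (1 / (S.card : ℝ)) • ∑ s ∈ S, (Real.sigmoid (dot w (R • x s)) - (y s + 1) / 2) • (R • x s)

/-- The objective `Φ(u) - ⟨∇Φ(w) - γ g, u⟩` of the update step, as a function of `u`;
the product `⟨∇Φ(w), u⟩` is the differential of `Φ` at `w` applied to `u`. -/
def stepObjective {n k : ℕ} (γ : ℝ) (g w u : Mat n k) : ℝ :=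
  mirrorMap u - (fderiv ℝ (mirrorMap : Mat n k → ℝ) w u - γ * dot g u)

/-- `w'` minimizes the update objective over `‖u‖_{2,1} ≤ 1` up to an additive error `τ`.
For `τ = 0` it is an exact minimizer. -/
def IsStep {n k : ℕ} (τ γ : ℝ) (g w w' : Mat n k) : Prop :=
  groupNorm 1 w' ≤ 1 ∧
    ∀ u : Mat n k, groupNorm 1 u ≤ 1 → stepObjective γ g w w' ≤ stepObjective γ g w u + τ

/-- `wbar` is an output of `T` iterations of mirror descent on the samples `(x s, y s)`, `s ∈ S`,
with constraint `‖w‖_{2,1} ≤ R`, each update being solved up to the additive error `τ`.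
The iterates are numbered from `0`. -/
def IsMirrorDescentOutput {n k : ℕ} {ι : Type} (S : Finset ι) (x : ι → Mat n k) (y : ι → ℝ)
    (R : ℝ) (T : ℕ) (τ : ℝ) (wbar : Mat n k) : Prop :=
  ∃ w : ℕ → Mat n k,
    (w 0 = fun _ _ => 1 / ((n : ℝ) * √(k : ℝ))) ∧
    (∀ t < T, IsStep τ (stepSize n R T) (lossGrad S x y R (w t)) (w t) (w (t + 1))) ∧
    wbar = R • ((1 / (T : ℝ)) • ∑ t ∈ Finset.range T, w t)

/-! ## The learning algorithm -/

/-- The samples in which variable `i` takes one of the values `α`, `β`. -/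
def restricted {n k N : ℕ} (z : Fin N → Fin n → Fin k) (i : Fin n) (α β : Fin k) :
    Finset (Fin N) :=
  Finset.univ.filter fun m => z m i = α ∨ z m i = β

/-- The one-hot encoding of a configuration with variable `i` replaced by the constant first symbol.
The constant feature thus sits in row `i`, and the other variables keep their row numbers. -/
def feature {n k : ℕ} (i : Fin n) (z : Fin n → Fin k) : Mat n k := fun j b =>
  if j = i then (if (b : ℕ) = 0 then 1 else 0) else (if z j = b then 1 else 0)

/-- The label: `1` if variable `i` takes the value `α`, and `-1` otherwise. -/
def label {n k : ℕ} (i : Fin n) (α : Fin k) (z : Fin n → Fin k) : ℝ :=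
  if z i = α then 1 else -1

/-- Centering of all rows but the constant-feature row `i`, which absorbs the means. -/
def center {n k : ℕ} (i : Fin n) (w : Mat n k) : Mat n k := fun j b =>
  if j = i then w i b + (1 / (k : ℝ)) * ∑ l ∈ Finset.univ.erase i, ∑ a, w l a
  else w j b - (1 / (k : ℝ)) * ∑ a, w j a

/-- `What` and `G` are an output of the learning algorithm on the samples `z`, with width bound `lam`,
edge threshold parameter `η`, and all logistic regressions solved by `T` iterations of mirror descent.
The updates of a regression on `m` samples are solved up to the additive error `τ m`. -/
def IsOutput {n k N : ℕ} (lam η : ℝ) (T : ℕ) (τ : ℕ → ℝ) (z : Fin N → Fin n → Fin k)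
    (What : Fin n → Fin n → Fin k → Fin k → ℝ) (G : Fin n → Fin n → Bool) : Prop :=
  (∃ w : Fin n → Fin k → Fin k → Mat n k,
    (∀ i α β, α ≠ β →
      IsMirrorDescentOutput (restricted z i α β) (fun m => feature i (z m))
        (fun m => label i α (z m)) (2 * lam * √(k : ℝ)) T (τ (restricted z i α β).card)
        (w i α β)) ∧
    ∀ i j, j ≠ i → ∀ α b,
      What i j α b
        = (1 / (k : ℝ)) * ∑ β ∈ Finset.univ.erase α, center i (w i α β) j b) ∧
  ∀ i j, G i j = true ↔ i < j ∧ ∃ a b, η / 2 ≤ |What i j a b|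

/-! ## Step counting

Programs are written in a monad that counts elementary steps. One step is charged for each arithmetic
operation, square root, exponential, logarithm or comparison of real numbers, for each comparison of
indices or symbols, and for each pass through a loop. Reading an entry of a stored array is part of
the operation that uses it. -/

/-- A value together with the number of steps spent on computing it. -/
structure Timed (α : Type) where
  val : α
  steps : ℕ

instance : Monad Timed where
  pure a := ⟨a, 0⟩
  bind m f := ⟨(f m.val).val, m.steps + (f m.val).steps⟩

/-- One elementary operation with result `a`. -/
def op {α : Type} (a : α) : Timed α := ⟨a, 1⟩

/-- The loop over a list `l` with body `f` and state in `α`. -/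
def loop {ι α : Type} : List ι → (ι → α → Timed α) → α → Timed α
  | [], _, a => pure a
  | i :: l, f, a => do
    let i' ← op i
    let a' ← f i' a
    loop l f a'

/-- The sum of the numbers `f i` over a list. -/
def sumLoop {ι : Type} (l : List ι) (f : ι → Timed ℝ) : Timed ℝ :=
  loop l (fun i s => do
    let v ← f i
    op (s + v)) 0

/-- The elements of a list that pass a test. -/
def select {ι : Type} : List ι → (ι → Timed Bool) → Timed (List ι)
  | [], _ => pure []
  | i :: l, p => do
    let c ← p i
    let r ← select l p
    op (if c then i :: r else r)

/-- Fill an array of length `m`, one cell after the other: the cost is that of all the cells, plus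
one step for each cell. -/
def tabulate {m : ℕ} {α : Type} (f : Fin m → Timed α) : Timed (Fin m → α) :=
  ⟨fun i => (f i).val, ∑ i, ((f i).steps + 1)⟩

/-- Fill a two-dimensional array. -/
def tabulate₂ {m l : ℕ} {α : Type} (f : Fin m → Fin l → Timed α) : Timed (Fin m → Fin l → α) :=
  tabulate fun j => tabulate fun b => f j b

/-! ## The program -/

/-- `x ^ q` for `x > 0`, and `0` for `x ≤ 0`. -/
def powProg (x q : ℝ) : Timed ℝ := do
  let pos ← op (decide (0 < x))
  if pos then do
    let l ← op (Real.log x)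
    let m ← op (q * l)
    op (Real.exp m)
  else pure 0

/-- The Euclidean norms of the rows. -/
def rowNormsProg {n k : ℕ} (w : Mat n k) : Timed (Fin n → ℝ) :=
  tabulate fun j => do
    let s ← sumLoop (List.finRange k) fun b => op (w j b * w j b)
    op (√s)

/-- `∑_j ((s_j - ν)₊ / c) ^ q`. -/
def totalProg {n : ℕ} (s : Fin n → ℝ) (c q ν : ℝ) : Timed ℝ :=
  sumLoop (List.finRange n) fun j => do
    let d ← op (s j - ν)
    let r ← op (d / c)
    powProg r q

/-- An approximation `ν` from above to the least `ν ≥ 0` with `∑_j ((s_j - ν)₊ / c) ^ q ≤ 1`,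
which is `0` if possible, and is found otherwise by as many bisection steps as `S` has elements. -/
def thresholdProg {n : ℕ} {ι : Type} (S : List ι) (s : Fin n → ℝ) (c q : ℝ) : Timed ℝ := do
  let r₀ ← totalProg s c q 0
  let small ← op (decide (r₀ ≤ 1))
  if small then pure 0
  else do
    let top ← loop (List.finRange n) (fun j m => op (max m (s j))) 0
    let I ← loop S (fun _ (I : ℝ × ℝ) => do
      let a ← op (I.1 + I.2)
      let mid ← op (a / 2)
      let r ← totalProg s c q mid
      let ok ← op (decide (r ≤ 1))
      pure (if ok then (I.1, mid) else (mid, I.2))) (0, top)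
    pure I.2

/-- The update step: with `ξ = ∇Φ(w) - γ g` and the threshold `ν` for the row norms of `ξ`, the new
row `j` points in the direction of row `j` of `ξ` and has norm `((‖ξ_j‖ - ν)₊ / (e ln n)) ^ (ln n)`. -/
def stepProg {n k : ℕ} {ι : Type} (S : List ι) (γ : ℝ) (g w : Mat n k) : Timed (Mat n k) := do
  let q ← op (Real.log n)
  let e ← op (Real.exp 1)
  let c ← op (e * q)
  let q' ← op (1 / q)
  let ex ← op (q' - 1)
  let r ← rowNormsProg w
  let h ← tabulate fun j => do
    let v ← powProg (r j) ex
    op (c * v)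
  let ξ ← tabulate₂ fun j b => do
    let u ← op (h j * w j b)
    let v ← op (γ * g j b)
    op (u - v)
  let s ← rowNormsProg ξ
  let ν ← thresholdProg S s c q
  let f ← tabulate fun j => do
    let d ← op (s j - ν)
    let d' ← op (d / c)
    let v ← powProg d' q
    op (v / s j)
  tabulate₂ fun j b => op (f j * ξ j b)

/-- The entry `(j, b)` of the rescaled feature matrix. -/
def featureProg {n k : ℕ} (i : Fin n) (z : Fin n → Fin k) (R : ℝ) (j : Fin n) (b : Fin k) :
    Timed ℝ := do
  let const ← op (decide (j = i))
  if const then do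
    let first ← op (decide ((b : ℕ) = 0))
    op (R * if first then 1 else 0)
  else do
    let hit ← op (decide (z j = b))
    op (R * if hit then 1 else 0)

/-- The gradient of the empirical loss over the samples listed in `S`. -/
def gradProg {n k N : ℕ} (S : List (Fin N)) (z : Fin N → Fin n → Fin k) (i : Fin n) (α : Fin k)
    (R : ℝ) (w : Mat n k) : Timed (Mat n k) := do
  let g₀ ← tabulate₂ fun _ _ => op 0
  let size ← sumLoop S fun _ => op 1
  let g ← loop S (fun m (g : Mat n k) => do
    let v ← sumLoop (List.finRange n) fun j => sumLoop (List.finRange k) fun b => do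
      let x ← featureProg i (z m) R j b
      op (w j b * x)
    let v₁ ← op (-v)
    let v₂ ← op (Real.exp v₁)
    let v₃ ← op (1 + v₂)
    let p ← op (1 / v₃)
    let pos ← op (decide (z m i = α))
    let y₁ ← op ((if pos then 1 else -1) + 1)
    let y₂ ← op (y₁ / 2)
    let coef ← op (p - y₂)
    tabulate₂ fun j b => do
      let x ← featureProg i (z m) R j b
      let v ← op (coef * x)
      op (g j b + v)) g₀
  tabulate₂ fun j b => op (g j b / size)

/-- Mirror descent on the samples listed in `S`. -/
def descentProg {n k N : ℕ} (S : List (Fin N)) (z : Fin N → Fin n → Fin k) (i : Fin n) (α : Fin k)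
    (R : ℝ) (T : ℕ) : Timed (Mat n k) := do
  let q ← op (Real.log n)
  let e ← op (Real.exp 1)
  let c ← op (e * q)
  let c₁ ← op (c / T)
  let c₂ ← op (√c₁)
  let R₂ ← op (2 * R)
  let γ₁ ← op (1 / R₂)
  let γ ← op (γ₁ * c₂)
  let rk ← op (√(k : ℝ))
  let nrk ← op ((n : ℝ) * rk)
  let w₀ ← tabulate₂ fun _ _ => op (1 / nrk)
  let sum₀ ← tabulate₂ fun _ _ => op 0
  let st ← loop (List.range T) (fun _ (st : Mat n k × Mat n k) => do
    let sum ← tabulate₂ fun j b => op (st.2 j b + st.1 j b)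
    let g ← gradProg S z i α R st.1
    let w ← stepProg S γ g st.1
    pure (w, sum)) (w₀, sum₀)
  tabulate₂ fun j b => do
    let v ← op (st.2 j b / T)
    op (R * v)

/-- Centering. -/
def centerProg {n k : ℕ} (i : Fin n) (w : Mat n k) : Timed (Mat n k) := do
  let mean ← tabulate fun j => do
    let s ← sumLoop (List.finRange k) fun a => op (w j a)
    op (s / k)
  let total ← sumLoop (List.finRange n) fun j => do
    let same ← op (decide (j = i))
    pure (if same then 0 else mean j)
  tabulate₂ fun j b => do
    let same ← op (decide (j = i))
    op (if same then w j b + total else w j b - mean j)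

/-- The whole learning algorithm. A regression without samples contributes nothing and is skipped. -/
def learnProg {n k N : ℕ} (lam η : ℝ) (T : ℕ) (z : Fin N → Fin n → Fin k) :
    Timed ((Fin n → Fin n → Fin k → Fin k → ℝ) × (Fin n → Fin n → Bool)) := do
  let rk ← op (√(k : ℝ))
  let lam₂ ← op (2 * lam)
  let R ← op (lam₂ * rk)
  let What ← tabulate fun i => do
    let A ← tabulate fun α => do
      let acc₀ ← tabulate₂ fun _ _ => op 0
      let acc ← loop (List.finRange k) (fun β (acc : Mat n k) => do
        let same ← op (decide (α = β))
        if same then pure acc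
        else do
          let S ← select (List.finRange N) fun m => do
            let isα ← op (decide (z m i = α))
            let isβ ← op (decide (z m i = β))
            op (isα || isβ)
          let none ← op S.isEmpty
          if none then pure acc
          else do
            let w ← descentProg S z i α R T
            let U ← centerProg i w
            tabulate₂ fun j b => op (acc j b + U j b)) acc₀
      tabulate₂ fun j b => op (acc j b / k)
    tabulate fun j => tabulate₂ fun α b => op (A α j b)
  let half ← op (η / 2)
  let G ← tabulate₂ fun i j => do
    let lt ← op (decide (i < j))
    if lt then
      loop (List.finRange k) (fun a (found : Bool) =>
        loop (List.finRange k) (fun b (found : Bool) => do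
          let v ← op |What i j a b|
          let big ← op (decide (half ≤ v))
          op (found || big)) found) false
    else pure false
  pure (What, G)

end PairwiseMRF

end

/-! Given z_i ∈ {α, β} and the other variables, z_i equals α with probability σ(⟨w*, x⟩), where row
j of w* (`trueWeight`) is W_ij(α,·) − W_ij(β,·) and ‖w*‖_{2,1} ≤ R = 2λ√k. Thus every pair of
symbols gives a logistic regression over a ball, and since the columns of W_ij sum to zero,
averaging over β turns accurate estimates of all w* into one of W_ij(α,·). Write q ≥ e^{-2λ}/k for
the probability of z_i ∈ {α, β}.

Optimization. On the unit ball Φ is strongly convex for ‖·‖_{2,1} (`bregman_ge`) and the initial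
divergence is O(ln n), so the empirical loss comes within O(R√(ln n/T)) of that of w*
(`totalLoss_descent_le`). In dual coordinates the program's update is soft thresholding of the row
norms. A threshold ν found by bisection satisfies the optimality conditions up to an error ν(1 −
‖w'‖_{2,1}) (`softStep_isApproxStep`), which is exponentially small in the number of bisections
(`one_sub_softTotal_le`). Each threshold also lowers the largest row norm of the gradient of Φ by ν,
so that the sum of all thresholds is controlled and the contribution of the errors does not grow
with T (`descentProg_spec`).

Statistics. For a fixed v, the mean of exp(½(loss(w*) − loss(v))) is a Hellinger affinity, at most 1
− ½ of the mean squared prediction difference (`pairMean_exp_le`). Chernoff's method then gives a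
bound of order 1/N, without bounded losses. It is made uniform by a union bound over averages of κ
atoms, a family whose logarithmic size is O(κ ln(nk)). Maurey's argument approximates the
data-dependent output by such an average, at once in the empirical loss and in the model's quadratic
mean (`exists_atomAverage_le`, `IsTypical.predictionGap_le`). The resulting gap is of order q(opt +
R²/κ) + κ ln(nk/ρ)/N.

Identification. Since |⟨w*, x⟩| ≤ 2λ, prediction differences control min(1, |⟨w* − w, x⟩|) up to a
factor e^{2λ}; since every symbol has conditional probability at least e^{-2λ}/k, changing one
variable isolates the differences within a row of w* − w (`min_one_abs_sub_sq_le`). Hence a gap of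
qε²/(8k e^{6λ+6}) suffices, and with τ of this order without the factor q, the choice κ ≈ R²/τ
yields the two sample bounds. If 5λ√k ≤ ε, every output is accurate for trivial reasons; excluding
this case is what makes the regressions large enough for the bisections.

Running time. A regression with m ≥ 1 samples costs O(T n k m), and each sample enters at most 2k of
the k² ordered pairs of symbols of a variable (`sum_card_restricted_le`). -/

namespace PairwiseMRF

/-! ## Row norms -/

section Norms

variable {n k : ℕ}

theorem rowNorm_eq_norm (w : Mat n k) (j : Fin n) : rowNorm w j = ‖WithLp.toLp 2 (w j)‖ := by
  simp [rowNorm, EuclideanSpace.norm_eq]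

theorem rowNorm_nonneg (w : Mat n k) (j : Fin n) : 0 ≤ rowNorm w j := Real.sqrt_nonneg _

theorem rowNorm_sq (w : Mat n k) (j : Fin n) : rowNorm w j ^ 2 = ∑ b, w j b ^ 2 :=
  Real.sq_sqrt (Finset.sum_nonneg fun _ _ => sq_nonneg _)

theorem rowNorm_add_le (u w : Mat n k) (j : Fin n) :
    rowNorm (u + w) j ≤ rowNorm u j + rowNorm w j := by
  simp only [rowNorm_eq_norm]
  exact norm_add_le (WithLp.toLp 2 (u j)) (WithLp.toLp 2 (w j))

theorem rowNorm_smul (r : ℝ) (w : Mat n k) (j : Fin n) :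
    rowNorm (r • w) j = |r| * rowNorm w j := by
  simp only [rowNorm_eq_norm]
  exact norm_smul r (WithLp.toLp 2 (w j))

theorem rowNorm_zero (j : Fin n) : rowNorm (0 : Mat n k) j = 0 := by
  simp [rowNorm]

theorem rowNorm_sub_le (u w : Mat n k) (j : Fin n) :
    rowNorm (u - w) j ≤ rowNorm u j + rowNorm w j := by
  simp only [rowNorm_eq_norm]
  exact norm_sub_le (WithLp.toLp 2 (u j)) (WithLp.toLp 2 (w j))

theorem rowNorm_sum_le {ι : Type*} (s : Finset ι) (u : ι → Mat n k) (j : Fin n) :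
    rowNorm (∑ l ∈ s, u l) j ≤ ∑ l ∈ s, rowNorm (u l) j := by
  classical
  induction s using Finset.induction_on with
  | empty => simp [rowNorm_zero]
  | insert a s ha ih =>
    rw [Finset.sum_insert ha, Finset.sum_insert ha]
    exact (rowNorm_add_le _ _ _).trans (by linarith)

theorem eq_zero_of_rowNorm_eq_zero {w : Mat n k} {j : Fin n} (h : rowNorm w j = 0) (b : Fin k) :
    w j b = 0 := by
  have h1 := rowNorm_sq w j
  rw [h, zero_pow two_ne_zero] at h1
  have := (Finset.sum_eq_zero_iff_of_nonneg fun b _ => sq_nonneg (w j b)).1 h1.symm b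
    (Finset.mem_univ b)
  exact pow_eq_zero_iff two_ne_zero |>.1 this

theorem abs_le_rowNorm (w : Mat n k) (j : Fin n) (b : Fin k) : |w j b| ≤ rowNorm w j := by
  apply Real.abs_le_sqrt
  exact Finset.single_le_sum (f := fun b => w j b ^ 2) (fun _ _ => sq_nonneg _) (Finset.mem_univ b)

theorem abs_rowDot_le (u w : Mat n k) (j : Fin n) :
    |∑ b, u j b * w j b| ≤ rowNorm u j * rowNorm w j := by
  rw [rowNorm, rowNorm, ← Real.sqrt_mul (Finset.sum_nonneg fun _ _ => sq_nonneg _)]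
  exact Real.abs_le_sqrt (Finset.sum_mul_sq_le_sq_mul_sq _ _ _)

theorem rowDot_le (u w : Mat n k) (j : Fin n) :
    ∑ b, u j b * w j b ≤ rowNorm u j * rowNorm w j :=
  (le_abs_self _).trans (abs_rowDot_le u w j)

theorem groupNorm_one (w : Mat n k) : groupNorm 1 w = ∑ j, rowNorm w j := by
  simp [groupNorm]

theorem rowNorm_le_groupNorm_one (w : Mat n k) (j : Fin n) : rowNorm w j ≤ groupNorm 1 w := by
  rw [groupNorm_one]
  exact Finset.single_le_sum (fun j _ => rowNorm_nonneg w j) (Finset.mem_univ j)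

theorem groupNorm_one_add_le (u w : Mat n k) :
    groupNorm 1 (u + w) ≤ groupNorm 1 u + groupNorm 1 w := by
  simp only [groupNorm_one, ← Finset.sum_add_distrib]
  exact Finset.sum_le_sum fun j _ => rowNorm_add_le u w j

theorem groupNorm_one_smul (r : ℝ) (w : Mat n k) : groupNorm 1 (r • w) = |r| * groupNorm 1 w := by
  simp only [groupNorm_one, rowNorm_smul, Finset.mul_sum]

theorem groupNorm_one_sum_le {ι : Type*} (s : Finset ι) (u : ι → Mat n k) :
    groupNorm 1 (∑ l ∈ s, u l) ≤ ∑ l ∈ s, groupNorm 1 (u l) := by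
  simp only [groupNorm_one]
  rw [Finset.sum_comm]
  exact Finset.sum_le_sum fun j _ => rowNorm_sum_le s u j

/-! ## The dot product -/

theorem dot_comm (u w : Mat n k) : dot u w = dot w u := by
  simp only [dot, mul_comm]

theorem dot_add_right (u v w : Mat n k) : dot u (v + w) = dot u v + dot u w := by
  simp only [dot, Pi.add_apply, mul_add, Finset.sum_add_distrib]

theorem dot_sub_right (u v w : Mat n k) : dot u (v - w) = dot u v - dot u w := by
  simp only [dot, Pi.sub_apply, mul_sub, Finset.sum_sub_distrib]

theorem dot_smul_right (r : ℝ) (u w : Mat n k) : dot u (r • w) = r * dot u w := by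
  simp only [dot, Pi.smul_apply, smul_eq_mul, Finset.mul_sum]
  exact Finset.sum_congr rfl fun j _ => Finset.sum_congr rfl fun b _ => by ring

theorem dot_sum_right {ι : Type*} (s : Finset ι) (u : Mat n k) (v : ι → Mat n k) :
    dot u (∑ l ∈ s, v l) = ∑ l ∈ s, dot u (v l) := by
  classical
  induction s using Finset.induction_on with
  | empty => simp [dot]
  | insert a s ha ih => rw [Finset.sum_insert ha, Finset.sum_insert ha, dot_add_right, ih]

theorem dot_add_left (u v w : Mat n k) : dot (u + v) w = dot u w + dot v w := by
  rw [dot_comm, dot_add_right, dot_comm w u, dot_comm w v]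

theorem dot_sub_left (u v w : Mat n k) : dot (u - v) w = dot u w - dot v w := by
  rw [dot_comm, dot_sub_right, dot_comm w u, dot_comm w v]

theorem dot_smul_left (r : ℝ) (u w : Mat n k) : dot (r • u) w = r * dot u w := by
  rw [dot_comm, dot_smul_right, dot_comm]

theorem dot_sum_left {ι : Type*} (s : Finset ι) (v : ι → Mat n k) (u : Mat n k) :
    dot (∑ l ∈ s, v l) u = ∑ l ∈ s, dot (v l) u := by
  rw [dot_comm, dot_sum_right]
  exact Finset.sum_congr rfl fun l _ => dot_comm _ _

/-- Duality of the norms `‖·‖_{2,1}` and `‖·‖_{2,∞}`. -/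
theorem abs_dot_le {B : ℝ} {g : Mat n k} (hg : ∀ j, rowNorm g j ≤ B) (w : Mat n k) :
    |dot g w| ≤ B * groupNorm 1 w := by
  rw [groupNorm_one, Finset.mul_sum]
  refine (Finset.abs_sum_le_sum_abs _ _).trans (Finset.sum_le_sum fun j _ => ?_)
  exact (abs_rowDot_le g w j).trans (mul_le_mul_of_nonneg_right (hg j) (rowNorm_nonneg w j))

theorem dot_le {B : ℝ} {g : Mat n k} (hg : ∀ j, rowNorm g j ≤ B) (w : Mat n k) :
    dot g w ≤ B * groupNorm 1 w :=
  (le_abs_self _).trans (abs_dot_le hg w)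

end Norms

/-! ## The mirror map -/

section MirrorMap

/-- The constant `e ln n`. -/
noncomputable def mirrorScale (n : ℕ) : ℝ := Real.exp 1 * Real.log n

theorem one_lt_log {n : ℕ} (hn : 3 ≤ n) : 1 < Real.log n := by
  rw [Real.lt_log_iff_exp_lt (by positivity)]
  have : (3 : ℝ) ≤ n := by exact_mod_cast hn
  linarith [Real.exp_one_lt_d9]

/-- The exponent p = 1 + 1/ln n is chosen for this identity: powers of the dimension become a
constant, and only the factor ln n in Φ remains. -/
theorem rpow_inv_log {n : ℕ} (hn : 3 ≤ n) : (n : ℝ) ^ (1 / Real.log n) = Real.exp 1 := by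
  have := one_lt_log hn
  rw [Real.rpow_def_of_pos (by positivity), mul_one_div_cancel (by positivity)]

/-- Tangent line inequality for the concave power `x ^ a`, `0 ≤ a ≤ 1`. -/
theorem rpow_le_tangent {a x y : ℝ} (ha : 0 ≤ a) (ha1 : a ≤ 1) (hx : 0 ≤ x) (hy : 0 < y) :
    x ^ a ≤ y ^ a + a * y ^ (a - 1) * (x - y) := by
  have h := rpow_one_add_le_one_add_mul_self (s := x / y - 1) (p := a)
    (by have := div_nonneg hx hy.le; linarith) ha ha1
  rw [add_sub_cancel, Real.div_rpow hx hy.le, div_le_iff₀ (by positivity)] at h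
  refine h.trans (le_of_eq ?_)
  rw [Real.rpow_sub_one hy.ne']
  field_simp

/-- Strong convexity of `x ^ (1 + a) / (1 + a)` on `[0, M]`. -/
theorem rpow_bregman {a r s M : ℝ} (ha : 0 < a) (ha1 : a ≤ 1) (hr : 0 ≤ r) (hs : 0 ≤ s)
    (hrM : r ≤ M) (hsM : s ≤ M) :
    a / 2 * M ^ (a - 1) * (s - r) ^ 2
      ≤ s ^ (1 + a) / (1 + a) - r ^ (1 + a) / (1 + a) - r ^ a * (s - r) := by
  -- The second derivative a x^(a-1) decreases in x, so on [0, M] it is at least a M^(a-1).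
  -- Subtracting the parabola with this curvature leaves a function that is convex there.
  set ψ : ℝ → ℝ := fun x => x ^ (1 + a) / (1 + a) - a / 2 * M ^ (a - 1) * x ^ 2 with hψ
  set ψ' : ℝ → ℝ := fun x => x ^ a - a * M ^ (a - 1) * x with hψ'
  have hd : ∀ x, HasDerivAt ψ (ψ' x) x := by
    intro x
    have h1 := (Real.hasDerivAt_rpow_const (x := x) (p := 1 + a) (Or.inr (by linarith))).div_const
      (1 + a)
    have h2 := ((hasDerivAt_id x).pow 2).const_mul (a / 2 * M ^ (a - 1))
    refine (h1.sub h2).congr_deriv ?_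
    simp only [hψ', id, add_sub_cancel_left]
    field_simp
    ring
  -- The tangent of the concave power at the larger point y bounds the increment below by a
  -- y^(a-1)(y - x), and y ≤ M.
  have hmono : ∀ x y, 0 ≤ x → x ≤ y → y ≤ M → ψ' x ≤ ψ' y := by
    intro x y hx hxy hyM
    rcases (hx.trans hxy).eq_or_lt with hy0 | hy0
    · have : x = y := by linarith
      rw [this]
    have h := rpow_le_tangent ha.le ha1 hx hy0
    have hp : M ^ (a - 1) ≤ y ^ (a - 1) := Real.rpow_le_rpow_of_nonpos hy0 hyM (by linarith)
    have := mul_le_mul_of_nonneg_right (mul_le_mul_of_nonneg_left hp ha.le) (sub_nonneg.2 hxy)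
    simp only [hψ']
    nlinarith
  have key : 0 ≤ ψ s - ψ r - ψ' r * (s - r) := by
    have hc : Continuous ψ := continuous_iff_continuousAt.2 fun x => (hd x).continuousAt
    rcases lt_trichotomy r s with h | h | h
    · obtain ⟨c, hc, he⟩ := exists_hasDerivAt_eq_slope ψ ψ' h hc.continuousOn fun x _ => hd x
      have := hmono r c hr hc.1.le (hc.2.le.trans hsM)
      rw [he, le_div_iff₀ (by linarith)] at this
      linarith
    · simp [h]
    · obtain ⟨c, hc, he⟩ := exists_hasDerivAt_eq_slope ψ ψ' h hc.continuousOn fun x _ => hd x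
      have := hmono c r (hs.trans hc.1.le) hc.2.le hrM
      rw [he, div_le_iff₀ (by linarith)] at this
      linarith
  simp only [hψ, hψ'] at key
  nlinarith

variable {n k : ℕ}

/-- The gradient of the mirror map. -/
noncomputable def mirrorGrad (w : Mat n k) : Mat n k := fun j b =>
  mirrorScale n * rowNorm w j ^ (1 / Real.log n - 1) * w j b

theorem mirrorMap_eq (hn : 3 ≤ n) (w : Mat n k) :
    mirrorMap w = mirrorScale n * ∑ j, rowNorm w j ^ (1 + 1 / Real.log n) / (1 + 1 / Real.log n) := by
  have hl := one_lt_log hn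
  have hp : 0 < 1 + 1 / Real.log n := by positivity
  rw [mirrorMap, groupNorm, ← Real.rpow_mul
    (Finset.sum_nonneg fun j _ => Real.rpow_nonneg (rowNorm_nonneg w j) _),
    one_div_mul_cancel hp.ne', Real.rpow_one, ← Finset.sum_div, mirrorScale]
  ring

/-- As p > 1, the p-th power of a Euclidean norm is differentiable also at zero. The negative power
of a vanishing row norm in `mirrorGrad` is harmless: it multiplies zero entries. -/
theorem hasFDerivAt_mirrorMap (hn : 3 ≤ n) (w : Mat n k) :
    ∃ D : Mat n k →L[ℝ] ℝ, HasFDerivAt (mirrorMap : Mat n k → ℝ) D w ∧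
      ∀ u, D u = dot (mirrorGrad w) u := by
  have hl := one_lt_log hn
  have hp : 0 < 1 / Real.log n := by positivity
  have hrow : ∀ j, HasFDerivAt (fun w : Mat n k => rowNorm w j ^ (1 + 1 / Real.log n))
      ((((1 + 1 / Real.log n) * ‖WithLp.toLp 2 (w j)‖ ^ (1 + 1 / Real.log n - 2)) •
        (innerSL ℝ) (WithLp.toLp 2 (w j))).comp
        (((EuclideanSpace.equiv (Fin k) ℝ).symm : (Fin k → ℝ) →L[ℝ] EuclideanSpace ℝ (Fin k)).comp
          (ContinuousLinearMap.proj (R := ℝ) (φ := fun _ : Fin n => Fin k → ℝ) j))) w := by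
    intro j
    have h := hasFDerivAt_norm_rpow (WithLp.toLp 2 (w j)) (p := 1 + 1 / Real.log n) (by linarith)
    have h2 := h.comp w (((EuclideanSpace.equiv (Fin k) ℝ).symm : (Fin k → ℝ) →L[ℝ] EuclideanSpace ℝ (Fin k)).comp
      (ContinuousLinearMap.proj (R := ℝ) (φ := fun _ : Fin n => Fin k → ℝ) j)).hasFDerivAt
    refine h2.congr_of_eventuallyEq (Filter.Eventually.of_forall fun v => ?_)
    simp [rowNorm_eq_norm]
  have hfun : (mirrorMap : Mat n k → ℝ)
      = fun w => mirrorScale n / (1 + 1 / Real.log n) * ∑ j, rowNorm w j ^ (1 + 1 / Real.log n) := by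
    funext w
    rw [mirrorMap_eq hn, ← Finset.sum_div]; ring
  refine ⟨_, hfun ▸ (HasFDerivAt.fun_sum fun j _ => hrow j).const_mul _, fun u => ?_⟩
  simp only [dot, mirrorGrad, rowNorm_eq_norm, _root_.smul_apply,
    _root_.sum_apply, ContinuousLinearMap.comp_apply, smul_eq_mul,
    ContinuousLinearMap.proj_apply, Finset.mul_sum]
  refine Finset.sum_congr rfl fun j _ => ?_
  simp only [innerSL_apply_apply, ContinuousLinearEquiv.coe_coe, PiLp.inner_apply,
    Finset.mul_sum]
  refine Finset.sum_congr rfl fun b _ => ?_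
  simp
  rw [show 1 + (Real.log n)⁻¹ - 2 = (Real.log n)⁻¹ - 1 by ring]
  field_simp

theorem fderiv_mirrorMap (hn : 3 ≤ n) (w u : Mat n k) :
    fderiv ℝ (mirrorMap : Mat n k → ℝ) w u = dot (mirrorGrad w) u := by
  obtain ⟨D, hD, h⟩ := hasFDerivAt_mirrorMap hn w
  rw [hD.fderiv, h]

theorem continuous_mirrorMap (hn : 3 ≤ n) : Continuous (mirrorMap : Mat n k → ℝ) :=
  continuous_iff_continuousAt.2 fun w => (hasFDerivAt_mirrorMap hn w).choose_spec.1.continuousAt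

/-- The Bregman divergence of the mirror map. -/
noncomputable def bregman (u w : Mat n k) : ℝ :=
  mirrorMap u - mirrorMap w - dot (mirrorGrad w) (u - w)

/-- Reduction to the radial inequality `rpow_bregman`. With r, s the two row norms and d the inner
product, passing from radii to vectors adds 2(rs - d) to the squared distance and r^(a-1)(rs - d) to
the divergence. The second gain dominates because a ≤ 1 and r ≤ M. -/
theorem row_bregman_ge {a M : ℝ} (ha : 0 < a) (ha1 : a ≤ 1) (u w : Mat n k) (j : Fin n)
    (hM : 0 < M) (hu : rowNorm u j ≤ M) (hw : rowNorm w j ≤ M) :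
    a / 2 * M ^ (a - 1) * rowNorm (u - w) j ^ 2
      ≤ rowNorm u j ^ (1 + a) / (1 + a) - rowNorm w j ^ (1 + a) / (1 + a)
        - rowNorm w j ^ (a - 1) * ∑ b, w j b * (u - w) j b := by
  have h := rpow_bregman ha ha1 (rowNorm_nonneg w j) (rowNorm_nonneg u j) hw hu
  have hd : ∑ b, w j b * (u - w) j b = ∑ b, w j b * u j b - rowNorm w j ^ 2 := by
    rw [rowNorm_sq, ← Finset.sum_sub_distrib]
    exact Finset.sum_congr rfl fun b _ => by simp only [Pi.sub_apply]; ring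
  have hs : rowNorm (u - w) j ^ 2
      = rowNorm u j ^ 2 + rowNorm w j ^ 2 - 2 * ∑ b, w j b * u j b := by
    rw [rowNorm_sq, rowNorm_sq, rowNorm_sq, Finset.mul_sum, ← Finset.sum_add_distrib,
      ← Finset.sum_sub_distrib]
    exact Finset.sum_congr rfl fun b _ => by simp only [Pi.sub_apply]; ring
  have hcs := rowDot_le w u j
  set d := ∑ b, w j b * u j b
  set r := rowNorm w j
  set s := rowNorm u j
  have hr : 0 ≤ r := rowNorm_nonneg w j
  rw [hd, hs]
  rcases hr.eq_or_lt with h0 | h0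
  · have hd0 : d = 0 := Finset.sum_eq_zero fun b _ => by
      rw [eq_zero_of_rowNorm_eq_zero h0.symm, zero_mul]
    rw [← h0, Real.zero_rpow ha.ne'] at h
    rw [hd0, ← h0]
    nlinarith
  · have hra : r ^ a = r ^ (a - 1) * r := by
      rw [Real.rpow_sub_one h0.ne']; field_simp
    have hp : M ^ (a - 1) ≤ r ^ (a - 1) := Real.rpow_le_rpow_of_nonpos h0 hw (by linarith)
    have hM0 : 0 ≤ M ^ (a - 1) := Real.rpow_nonneg hM.le _
    have h1 : a * M ^ (a - 1) ≤ r ^ (a - 1) := by nlinarith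
    have := mul_le_mul_of_nonneg_right h1 (sub_nonneg.2 hcs)
    rw [hra] at h
    nlinarith

/-- The mirror map is strongly convex with respect to `‖·‖_{2,1}` on the unit ball. -/
theorem bregman_ge (hn : 3 ≤ n) {u w : Mat n k} (hu : groupNorm 1 u ≤ 1) (hw : groupNorm 1 w ≤ 1) :
    1 / 4 * groupNorm 1 (u - w) ^ 2 ≤ bregman u w := by
  have hl := one_lt_log hn
  set a := 1 / Real.log n with ha_def
  have ha : 0 < a := by positivity
  have ha1 : a ≤ 1 := by rw [ha_def, div_le_one (by positivity)]; exact hl.le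
  have hca : mirrorScale n * a = Real.exp 1 := by rw [mirrorScale, ha_def]; field_simp
  set M : Fin n → ℝ := fun j => max (rowNorm u j) (rowNorm w j) with hMdef
  have hM0 : ∀ j, 0 ≤ M j := fun j => le_max_of_le_left (rowNorm_nonneg u j)
  have hrowM : ∀ j, rowNorm (u - w) j ≤ 2 * M j := fun j => by
    have := rowNorm_sub_le u w j
    have h1 := le_max_left (rowNorm u j) (rowNorm w j)
    have h2 := le_max_right (rowNorm u j) (rowNorm w j)
    simp only [hMdef]; linarith
  have hD : Real.exp 1 / 2 * ∑ j, M j ^ (a - 1) * rowNorm (u - w) j ^ 2 ≤ bregman u w := by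
    have hb : bregman u w = ∑ j, mirrorScale n *
        (rowNorm u j ^ (1 + a) / (1 + a) - rowNorm w j ^ (1 + a) / (1 + a)
          - rowNorm w j ^ (a - 1) * ∑ b, w j b * (u - w) j b) := by
      rw [bregman, mirrorMap_eq hn, mirrorMap_eq hn, ← mul_sub, ← Finset.sum_sub_distrib,
        Finset.mul_sum, dot, ← Finset.sum_sub_distrib]
      refine Finset.sum_congr rfl fun j _ => ?_
      simp only [mirrorGrad, Finset.mul_sum, mul_sub, ← ha_def]
      simp only [mul_assoc]
    rw [hb, Finset.mul_sum]
    refine Finset.sum_le_sum fun j _ => ?_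
    rcases (hM0 j).eq_or_lt with h0 | h0
    · have h1 : rowNorm u j = 0 := le_antisymm (h0 ▸ le_max_left _ _) (rowNorm_nonneg u j)
      have h2 : rowNorm w j = 0 := le_antisymm (h0 ▸ le_max_right _ _) (rowNorm_nonneg w j)
      have h3 : rowNorm (u - w) j = 0 :=
        le_antisymm (by have := hrowM j; rw [← h0] at this; linarith) (rowNorm_nonneg _ j)
      have h4 : ∑ b, w j b * (u - w) j b = 0 := Finset.sum_eq_zero fun b _ => by
        rw [eq_zero_of_rowNorm_eq_zero h2, zero_mul]
      rw [h1, h2, h3, h4]; simp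
    · have := row_bregman_ge ha ha1 u w j h0 (le_max_left _ _) (le_max_right _ _)
      have hc : 0 ≤ mirrorScale n := by rw [mirrorScale]; positivity
      refine le_trans (le_of_eq ?_) (mul_le_mul_of_nonneg_left this hc)
      rw [← hca]; ring
  -- Tangent of x^(1-a) at 1/n, which is sharp for uniform row norms; n^a = e and the sum of the M_j
  -- is at most 2.
  have hsum : ∑ j, M j ^ (1 - a) ≤ 2 * Real.exp 1 := by
    have hn0 : (0 : ℝ) < n := by positivity
    have h1 : ∀ j, M j ^ (1 - a) ≤ (n : ℝ) ^ a * (a * (n : ℝ)⁻¹ + (1 - a) * M j) := by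
      intro j
      have := rpow_le_tangent (a := 1 - a) (by linarith) (by linarith) (hM0 j) (inv_pos.2 hn0)
      refine this.trans (le_of_eq ?_)
      rw [Real.inv_rpow hn0.le, Real.inv_rpow hn0.le, ← Real.rpow_neg hn0.le,
        ← Real.rpow_neg hn0.le, show -(1 - a - 1) = a by ring, show -(1 - a) = a - 1 by ring,
        Real.rpow_sub_one hn0.ne']
      field_simp
      ring
    have h2 : ∑ j, M j ≤ 2 := by
      rw [groupNorm_one] at hu hw
      calc ∑ j, M j ≤ ∑ j, (rowNorm u j + rowNorm w j) := Finset.sum_le_sum fun j _ =>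
            max_le (by linarith [rowNorm_nonneg w j]) (by linarith [rowNorm_nonneg u j])
        _ ≤ 2 := by rw [Finset.sum_add_distrib]; linarith
    calc ∑ j, M j ^ (1 - a) ≤ ∑ j, (n : ℝ) ^ a * (a * (n : ℝ)⁻¹ + (1 - a) * M j) :=
          Finset.sum_le_sum fun j _ => h1 j
      _ = Real.exp 1 * (a + (1 - a) * ∑ j, M j) := by
          rw [← Finset.mul_sum, Finset.sum_add_distrib, ← Finset.mul_sum Finset.univ M, rpow_inv_log hn]
          simp only [Finset.sum_const, Finset.card_univ, Fintype.card_fin, nsmul_eq_mul]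
          field_simp
      _ ≤ 2 * Real.exp 1 := by
          rw [mul_comm]
          refine mul_le_mul_of_nonneg_right ?_ (Real.exp_pos 1).le
          nlinarith
  -- Cauchy–Schwarz with weights M_j^(a-1). The constants combine to 1/4 because the divergence is
  -- at least e/2 times the first factor and the second factor is at most 2e.
  have hcs : groupNorm 1 (u - w) ^ 2
      ≤ (∑ j, M j ^ (a - 1) * rowNorm (u - w) j ^ 2) * ∑ j, M j ^ (1 - a) := by
    rw [groupNorm_one]
    refine Finset.sum_sq_le_sum_mul_sum_of_sq_le_mul _ (fun j _ => ?_) (fun j _ => ?_) fun j _ => ?_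
    · exact mul_nonneg (Real.rpow_nonneg (hM0 j) _) (sq_nonneg _)
    · exact Real.rpow_nonneg (hM0 j) _
    · rcases (hM0 j).eq_or_lt with h0 | h0
      · have h3 : rowNorm (u - w) j = 0 :=
          le_antisymm (by have := hrowM j; rw [← h0] at this; linarith) (rowNorm_nonneg _ j)
        rw [h3]; simp
      · rw [mul_right_comm, ← Real.rpow_add h0]; simp
  have hA : 0 ≤ ∑ j, M j ^ (a - 1) * rowNorm (u - w) j ^ 2 :=
    Finset.sum_nonneg fun j _ => mul_nonneg (Real.rpow_nonneg (hM0 j) _) (sq_nonneg _)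
  have := mul_le_mul_of_nonneg_left hsum hA
  nlinarith

theorem bregman_nonneg (hn : 3 ≤ n) {u w : Mat n k} (hu : groupNorm 1 u ≤ 1)
    (hw : groupNorm 1 w ≤ 1) : 0 ≤ bregman u w :=
  le_trans (by positivity) (bregman_ge hn hu hw)

end MirrorMap

/-! ## The logistic loss -/

section Logistic

/-- The function `log (1 + e ^ t)`. -/
noncomputable def softplus (t : ℝ) : ℝ := Real.log (1 + Real.exp t)

theorem hasDerivAt_softplus (t : ℝ) : HasDerivAt softplus (Real.sigmoid t) t := by
  have h : HasDerivAt (fun t => 1 + Real.exp t) (Real.exp t) t :=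
    (Real.hasDerivAt_exp t).const_add 1
  refine (h.log (by positivity)).congr_deriv ?_
  rw [Real.sigmoid_def, Real.exp_neg]
  have := Real.exp_pos t
  field_simp
  ring

/-- The mean value theorem without a case distinction on the order of a and b; the first two
conditions say that c lies between them. -/
theorem exists_slope {f f' : ℝ → ℝ} (h : ∀ x, HasDerivAt f (f' x) x) (a b : ℝ) :
    ∃ c, |c - a| ≤ |b - a| ∧ 0 ≤ (c - a) * (b - a) ∧ f b - f a = f' c * (b - a) := by
  have hc : Continuous f := continuous_iff_continuousAt.2 fun x => (h x).continuousAt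
  rcases lt_trichotomy a b with hab | hab | hab
  · obtain ⟨c, hc1, he⟩ := exists_hasDerivAt_eq_slope f f' hab hc.continuousOn fun x _ => h x
    refine ⟨c, ?_, ?_, ?_⟩
    · rw [abs_of_pos (by linarith [hc1.1]), abs_of_pos (by linarith)]; linarith [hc1.2]
    · exact mul_nonneg (by linarith [hc1.1]) (by linarith)
    · rw [he, div_mul_cancel₀ _ (by linarith)]
  · exact ⟨a, by simp, by simp, by simp [hab]⟩
  · obtain ⟨c, hc1, he⟩ := exists_hasDerivAt_eq_slope f f' hab hc.continuousOn fun x _ => h x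
    refine ⟨c, ?_, ?_, ?_⟩
    · rw [abs_of_neg (by linarith [hc1.2]), abs_of_neg (by linarith)]; linarith [hc1.1]
    · exact mul_nonneg_of_nonpos_of_nonpos (by linarith [hc1.2]) (by linarith)
    · rw [he, div_mul_eq_mul_div, eq_div_iff (by linarith)]; ring

theorem sigmoid_slope_le (t : ℝ) : Real.sigmoid t * (1 - Real.sigmoid t) ≤ 1 / 4 := by
  nlinarith [sq_nonneg (Real.sigmoid t - 1 / 2)]

theorem abs_sigmoid_sub_le (a b : ℝ) : |Real.sigmoid b - Real.sigmoid a| ≤ 1 / 4 * |b - a| := by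
  obtain ⟨c, -, -, he⟩ := exists_slope Real.hasDerivAt_sigmoid a b
  rw [he, abs_mul]
  refine mul_le_mul_of_nonneg_right ?_ (abs_nonneg _)
  rw [abs_of_nonneg (mul_nonneg (Real.sigmoid_nonneg c) (by linarith [Real.sigmoid_lt_one c]))]
  exact sigmoid_slope_le c

theorem softplus_ge_tangent (a b : ℝ) :
    softplus a + Real.sigmoid a * (b - a) ≤ softplus b := by
  obtain ⟨c, -, hs, he⟩ := exists_slope hasDerivAt_softplus a b
  rcases le_total a b with h | h
  · have : 0 ≤ (Real.sigmoid c - Real.sigmoid a) * (b - a) := by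
      rcases h.eq_or_lt with h | h
      · simp [h]
      · have hca : a ≤ c := by nlinarith
        exact mul_nonneg (sub_nonneg.2 (Real.sigmoid_le hca)) (by linarith)
    linarith
  · have : 0 ≤ (Real.sigmoid c - Real.sigmoid a) * (b - a) := by
      rcases h.eq_or_lt with h | h
      · simp [h]
      · have hca : c ≤ a := by nlinarith
        exact mul_nonneg_of_nonpos_of_nonpos (sub_nonpos.2 (Real.sigmoid_le hca)) (by linarith)
    linarith

theorem softplus_le_quadratic (a b : ℝ) :
    softplus b ≤ softplus a + Real.sigmoid a * (b - a) + 1 / 4 * (b - a) ^ 2 := by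
  obtain ⟨c, hc, -, he⟩ := exists_slope hasDerivAt_softplus a b
  have h1 := abs_sigmoid_sub_le a c
  have h2 : (Real.sigmoid c - Real.sigmoid a) * (b - a) ≤ 1 / 4 * (b - a) ^ 2 := by
    refine (le_abs_self _).trans ?_
    rw [abs_mul, ← sq_abs (b - a), sq, ← mul_assoc]
    exact mul_le_mul_of_nonneg_right (h1.trans (by linarith)) (abs_nonneg _)
  linarith

variable {n k : ℕ} {ι : Type}

/-- The total logistic loss over the samples in `S`. -/
noncomputable def totalLoss (S : Finset ι) (x : ι → Mat n k) (y : ι → ℝ) (w : Mat n k) : ℝ :=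
  ∑ s ∈ S, (softplus (dot w (x s)) - (y s + 1) / 2 * dot w (x s))

/-- Convexity of the loss. The iterates live in the unit ball while the losses are evaluated at
their multiples by R; `lossGrad` is the gradient of the mean loss as a function of the unscaled
point. An empty sample contributes zero on both sides. -/
theorem totalLoss_sub_le (S : Finset ι) (x : ι → Mat n k) (y : ι → ℝ) (R : ℝ) (w u : Mat n k) :
    totalLoss S x y (R • w) - totalLoss S x y (R • u)
      ≤ S.card * dot (lossGrad S x y R w) (w - u) := by
  rcases S.eq_empty_or_nonempty with rfl | hS
  · simp [totalLoss]
  have hc : (S.card : ℝ) ≠ 0 := by exact_mod_cast hS.card_pos.ne'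
  rw [lossGrad, dot_smul_left, ← mul_assoc, mul_one_div_cancel hc, one_mul, totalLoss, totalLoss,
    ← Finset.sum_sub_distrib, dot_sum_left]
  refine Finset.sum_le_sum fun s _ => ?_
  have h := softplus_ge_tangent (dot w (R • x s)) (dot u (R • x s))
  rw [dot_smul_left _ (R • x s), dot_comm (R • x s), dot_sub_left]
  simp only [dot_smul_left, dot_smul_right] at h ⊢
  nlinarith

/-- Jensen's inequality: in the tangents at the mean prediction the linear terms cancel, as do the
label terms. -/
theorem totalLoss_average_le (S : Finset ι) (x : ι → Mat n k) (y : ι → ℝ) {T : ℕ} (hT : 1 ≤ T)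
    (w : ℕ → Mat n k) :
    T * totalLoss S x y ((1 / (T : ℝ)) • ∑ t ∈ Finset.range T, w t)
      ≤ ∑ t ∈ Finset.range T, totalLoss S x y (w t) := by
  have hT0 : (T : ℝ) ≠ 0 := by positivity
  simp only [totalLoss]
  rw [Finset.sum_comm, Finset.mul_sum]
  refine Finset.sum_le_sum fun s _ => ?_
  set m := dot ((1 / (T : ℝ)) • ∑ t ∈ Finset.range T, w t) (x s) with hm
  have hmean : ∑ t ∈ Finset.range T, dot (w t) (x s) = T * m := by
    rw [hm, dot_smul_left, dot_sum_left]; field_simp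
  have h := Finset.sum_le_sum fun t (_ : t ∈ Finset.range T) =>
    softplus_ge_tangent m (dot (w t) (x s))
  rw [Finset.sum_add_distrib, ← Finset.mul_sum, Finset.sum_sub_distrib, hmean] at h
  simp only [Finset.sum_const, Finset.card_range, nsmul_eq_mul, sub_self, mul_zero, add_zero] at h
  rw [Finset.sum_sub_distrib, ← Finset.mul_sum, hmean]
  linarith

theorem rowNorm_lossGrad_le (S : Finset ι) {x : ι → Mat n k} {y : ι → ℝ} {R : ℝ} (hR : 0 ≤ R)
    (hx : ∀ s j, rowNorm (x s) j ≤ 1) (hy : ∀ s, |y s| ≤ 1) (w : Mat n k) (j : Fin n) :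
    rowNorm (lossGrad S x y R w) j ≤ R := by
  rcases S.eq_empty_or_nonempty with rfl | hS
  · simp only [lossGrad, Finset.sum_empty, smul_zero, rowNorm_zero]; exact hR
  have hc : (0 : ℝ) < S.card := by exact_mod_cast hS.card_pos
  rw [lossGrad, rowNorm_smul, abs_of_nonneg (by positivity), one_div_mul_eq_div, div_le_iff₀ hc]
  refine (rowNorm_sum_le _ _ _).trans ?_
  calc _ ≤ ∑ s ∈ S, R := Finset.sum_le_sum fun s _ => ?_
    _ = R * S.card := by rw [Finset.sum_const, nsmul_eq_mul, mul_comm]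
  rw [rowNorm_smul, rowNorm_smul, abs_of_nonneg hR]
  have h1 : |Real.sigmoid (dot w (R • x s)) - (y s + 1) / 2| ≤ 1 := by
    have := Real.sigmoid_nonneg (dot w (R • x s))
    have := Real.sigmoid_le_one (dot w (R • x s))
    have := abs_le.1 (hy s)
    rw [abs_le]; constructor <;> linarith
  have h2 : R * rowNorm (x s) j ≤ R := mul_le_of_le_one_right hR (hx s j)
  have h3 : 0 ≤ R * rowNorm (x s) j := mul_nonneg hR (rowNorm_nonneg _ _)
  nlinarith [abs_nonneg (Real.sigmoid (dot w (R • x s)) - (y s + 1) / 2)]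

end Logistic

/-! ## Mirror descent -/

section Descent

variable {n k : ℕ}

/-- The variational inequality for the minimizer of the update objective, up to an error `δ`. -/
def IsApproxStep (δ γ : ℝ) (g w w' : Mat n k) : Prop :=
  groupNorm 1 w' ≤ 1 ∧
    ∀ u : Mat n k, groupNorm 1 u ≤ 1 → -δ ≤ dot (mirrorGrad w' - (mirrorGrad w - γ • g)) (u - w')

theorem stepObjective_eq (hn : 3 ≤ n) (γ : ℝ) (g w u : Mat n k) :
    stepObjective γ g w u = mirrorMap u - dot (mirrorGrad w - γ • g) u := by
  rw [stepObjective, fderiv_mirrorMap hn, dot_sub_left, dot_smul_left]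

/-- Convexity of Φ turns an error in the variational inequality into the same error in the
objective. The regret bound uses the variational form, so the program is analysed in that form. -/
theorem IsApproxStep.isStep (hn : 3 ≤ n) {δ γ : ℝ} {g w w' : Mat n k}
    (h : IsApproxStep δ γ g w w') : IsStep δ γ g w w' := by
  refine ⟨h.1, fun u hu => ?_⟩
  have h1 := h.2 u hu
  have h2 := bregman_nonneg hn hu h.1
  rw [bregman] at h2
  rw [stepObjective_eq hn, stepObjective_eq hn]
  rw [dot_sub_left, dot_sub_right (mirrorGrad w - γ • g)] at h1
  linarith

theorem convex_groupNorm_one_ball (r : ℝ) : Convex ℝ {u : Mat n k | groupNorm 1 u ≤ r} := by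
  intro u hu w hw a b ha hb hab
  refine (groupNorm_one_add_le _ _).trans ?_
  rw [groupNorm_one_smul, groupNorm_one_smul, abs_of_nonneg ha, abs_of_nonneg hb]
  have h1 := mul_le_mul_of_nonneg_left hu.out ha
  have h2 := mul_le_mul_of_nonneg_left hw.out hb
  have : a * r + b * r = r := by rw [← add_mul, hab, one_mul]
  linarith

/-- First-order optimality: the ball is convex, so u - w' is a tangent direction at the minimizer,
and the derivative along it cannot be negative. -/
theorem IsStep.isApproxStep (hn : 3 ≤ n) {γ : ℝ} {g w w' : Mat n k}
    (h : IsStep 0 γ g w w') : IsApproxStep 0 γ g w w' := by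
  refine ⟨h.1, fun u hu => ?_⟩
  obtain ⟨D, hD, hDe⟩ := hasFDerivAt_mirrorMap hn w'
  set s : Set (Mat n k) := {u | groupNorm 1 u ≤ 1}
  let ξ : Mat n k →ₗ[ℝ] ℝ :=
    { toFun := dot (mirrorGrad w - γ • g)
      map_add' := dot_add_right _
      map_smul' := fun r v => dot_smul_right r _ v }
  have hξ := (LinearMap.toContinuousLinearMap ξ).hasFDerivAt (x := w')
  have hmin : IsLocalMinOn (stepObjective γ g w) s w' :=
    IsMinOn.localize fun v hv => by simpa using h.2 v hv
  have hder : HasFDerivAt (stepObjective γ g w) (D - LinearMap.toContinuousLinearMap ξ) w' := by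
    refine (hD.sub hξ).congr_of_eventuallyEq (Filter.Eventually.of_forall fun v => ?_)
    rw [stepObjective_eq hn]; rfl
  have hmem : u - w' ∈ posTangentConeAt s w' := by
    apply mem_posTangentConeAt_of_segment_subset
    rw [add_sub_cancel]
    exact (convex_groupNorm_one_ball 1).segment_subset h.1 hu
  have := hmin.hasFDerivWithinAt_nonneg hder.hasFDerivWithinAt hmem
  rw [neg_zero, dot_sub_left, ← hDe]
  exact this

theorem isCompact_groupNorm_one_ball : IsCompact {u : Mat n k | groupNorm 1 u ≤ 1} := by
  refine Metric.isCompact_of_isClosed_isBounded ?_ ?_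
  · have : Continuous fun u : Mat n k => groupNorm 1 u := by
      simp only [groupNorm_one, rowNorm]
      fun_prop
    exact isClosed_le this continuous_const
  · refine (Metric.isBounded_closedBall (x := (0 : Mat n k)) (r := 1)).subset fun u hu => ?_
    rw [mem_closedBall_zero_iff, pi_norm_le_iff_of_nonneg zero_le_one]
    intro j
    rw [pi_norm_le_iff_of_nonneg zero_le_one]
    intro b
    exact (abs_le_rowNorm u j b).trans ((rowNorm_le_groupNorm_one u j).trans hu)

theorem exists_isStep (hn : 3 ≤ n) (γ : ℝ) (g w : Mat n k) : ∃ w', IsStep 0 γ g w w' := by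
  have hc : Continuous (stepObjective γ g w) := by
    have : stepObjective γ g w = fun u => mirrorMap u - dot (mirrorGrad w - γ • g) u :=
      funext fun u => stepObjective_eq hn γ g w u
    rw [this]
    refine (continuous_mirrorMap hn).sub ?_
    change Continuous fun u => dot (mirrorGrad w - γ • g) u
    simp only [dot]
    fun_prop
  obtain ⟨w', hw', hmin⟩ := (isCompact_groupNorm_one_ball (n := n) (k := k)).exists_isMinOn
    ⟨0, by simp [groupNorm_one, rowNorm_zero]⟩ hc.continuousOn
  exact ⟨w', hw', fun u hu => by simpa using hmin hu⟩

/-- One step of mirror descent. -/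
theorem IsApproxStep.regret_le (hn : 3 ≤ n) {δ γ B : ℝ} {g w w' u : Mat n k}
    (h : IsApproxStep δ γ g w w') (hγ : 0 ≤ γ) (hg : ∀ j, rowNorm g j ≤ B)
    (hw : groupNorm 1 w ≤ 1) (hu : groupNorm 1 u ≤ 1) :
    γ * dot g (w - u) ≤ δ + (bregman u w - bregman u w') + γ ^ 2 * B ^ 2 := by
  have h1 := h.2 u hu
  have h2 := bregman_ge hn h.1 hw
  have h3 := dot_le hg (w - w')
  have h4 : groupNorm 1 (w' - w) = groupNorm 1 (w - w') := by
    rw [← neg_sub, ← neg_one_smul ℝ, groupNorm_one_smul]; simp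
  rw [h4] at h2
  have h5 := mul_le_mul_of_nonneg_left h3 hγ
  -- Three-point identity. The divergence of w' from w, at least a quarter of the squared distance
  -- x², absorbs γ B x up to γ² B².
  simp only [bregman, dot_sub_left, dot_sub_right, dot_smul_left] at h1 h2 h5 ⊢
  nlinarith [sq_nonneg (groupNorm 1 (w - w') / 2 - γ * B)]

/-- The divergences telescope, and the last one is nonnegative. The errors δ enter only through
their sum, which matters for the bisections. -/
theorem regret_le (hn : 3 ≤ n) {γ B : ℝ} {T : ℕ} {δ : ℕ → ℝ} {g w : ℕ → Mat n k} {u : Mat n k}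
    (h : ∀ t < T, IsApproxStep (δ t) γ (g t) (w t) (w (t + 1))) (hγ : 0 ≤ γ)
    (hg : ∀ t j, rowNorm (g t) j ≤ B) (hw : groupNorm 1 (w 0) ≤ 1) (hu : groupNorm 1 u ≤ 1) :
    γ * ∑ t ∈ Finset.range T, dot (g t) (w t - u)
      ≤ ∑ t ∈ Finset.range T, δ t + bregman u (w 0) + T * (γ ^ 2 * B ^ 2) := by
  have hball : ∀ t ≤ T, groupNorm 1 (w t) ≤ 1 := by
    intro t ht
    cases t with
    | zero => exact hw
    | succ t => exact (h t ht).1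
  have key : ∀ m ≤ T, γ * ∑ t ∈ Finset.range m, dot (g t) (w t - u)
      ≤ ∑ t ∈ Finset.range m, δ t + (bregman u (w 0) - bregman u (w m))
        + m * (γ ^ 2 * B ^ 2) := by
    intro m
    induction m with
    | zero => simp
    | succ m ih =>
      intro hm
      have h1 := ih (by omega)
      have h2 := (h m hm).regret_le hn hγ (hg m) (hball m (by omega)) hu
      rw [Finset.sum_range_succ, Finset.sum_range_succ, mul_add]
      push_cast
      linarith
  have := key T le_rfl
  have h0 := bregman_nonneg hn hu (hball T le_rfl)
  linarith

/-- The initial point of mirror descent. -/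
noncomputable def uniformStart (n k : ℕ) : Mat n k := fun _ _ => 1 / ((n : ℝ) * √(k : ℝ))

theorem rowNorm_uniformStart (hk : 0 < k) (j : Fin n) :
    rowNorm (uniformStart n k) j = 1 / n := by
  have hk0 : (0 : ℝ) < k := by exact_mod_cast hk
  simp only [rowNorm, uniformStart, Finset.sum_const, Finset.card_univ, Fintype.card_fin,
    nsmul_eq_mul]
  rw [div_pow, mul_pow, Real.sq_sqrt hk0.le, one_pow,
    show (k : ℝ) * (1 / ((n : ℝ) ^ 2 * k)) = (1 / (n : ℝ)) ^ 2 by field_simp,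
    Real.sqrt_sq (by positivity)]

theorem groupNorm_uniformStart (hn : 3 ≤ n) (hk : 0 < k) :
    groupNorm 1 (uniformStart n k) = 1 := by
  have : (n : ℝ) ≠ 0 := by positivity
  simp only [groupNorm_one, rowNorm_uniformStart hk, Finset.sum_const, Finset.card_univ,
    Fintype.card_fin, nsmul_eq_mul]
  field_simp

theorem mirrorScale_pos (hn : 3 ≤ n) : 0 < mirrorScale n :=
  mul_pos (Real.exp_pos 1) (by linarith [one_lt_log hn])

theorem rowNorm_mirrorGrad (hn : 3 ≤ n) (w : Mat n k) (j : Fin n) :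
    rowNorm (mirrorGrad w) j = mirrorScale n * rowNorm w j ^ (1 / Real.log n) := by
  have hl := one_lt_log hn
  have h : rowNorm (mirrorGrad w) j
      = rowNorm ((mirrorScale n * rowNorm w j ^ (1 / Real.log n - 1)) • w) j := rfl
  rw [h, rowNorm_smul, abs_of_nonneg (mul_nonneg (mirrorScale_pos hn).le
    (Real.rpow_nonneg (rowNorm_nonneg w j) _)), mul_assoc]
  congr 1
  rcases (rowNorm_nonneg w j).eq_or_lt with h0 | h0
  · rw [← h0, Real.zero_rpow (by positivity : 1 / Real.log n ≠ 0), mul_zero]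
  · rw [Real.rpow_sub_one h0.ne', div_mul_cancel₀ _ h0.ne']

/-- Besides bounding the initial divergence, this is the initial value of the potential that
controls the sum of the thresholds. -/
theorem rowNorm_mirrorGrad_uniformStart (hn : 3 ≤ n) (hk : 0 < k) (j : Fin n) :
    rowNorm (mirrorGrad (uniformStart n k)) j = Real.log n := by
  rw [rowNorm_mirrorGrad hn, rowNorm_uniformStart hk, Real.div_rpow zero_le_one (by positivity),
    rpow_inv_log hn, Real.one_rpow, mirrorScale]
  field_simp

/-- Φ lies between 0 and e ln n at the two points, and the linear term is at most ln n times the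
distance, which is at most 2; finally 2 ≤ e. -/
theorem bregman_uniformStart_le (hn : 3 ≤ n) (hk : 0 < k) {u : Mat n k} (hu : groupNorm 1 u ≤ 1) :
    bregman u (uniformStart n k) ≤ 2 * mirrorScale n := by
  have hl := one_lt_log hn
  have hc := mirrorScale_pos hn
  have h1 : mirrorMap u ≤ mirrorScale n := by
    rw [mirrorMap_eq hn]
    refine mul_le_of_le_one_right hc.le (le_trans (Finset.sum_le_sum fun j _ => ?_)
      (groupNorm_one u ▸ hu))
    have hp : 1 ≤ 1 + 1 / Real.log n := by
      have : 0 < 1 / Real.log n := by positivity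
      linarith
    have h0 := rowNorm_nonneg u j
    have hle : rowNorm u j ^ (1 + 1 / Real.log n) ≤ rowNorm u j := by
      have := Real.rpow_le_rpow_of_exponent_ge_of_imp h0
        ((rowNorm_le_groupNorm_one u j).trans hu) hp (fun _ h => by linarith)
      rwa [Real.rpow_one] at this
    exact (div_le_self (Real.rpow_nonneg h0 _) hp).trans hle
  have h2 : 0 ≤ mirrorMap (uniformStart n k) := by
    rw [mirrorMap_eq hn]
    refine mul_nonneg hc.le (Finset.sum_nonneg fun j _ => ?_)
    exact div_nonneg (Real.rpow_nonneg (rowNorm_nonneg _ j) _) (by positivity)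
  have h3 := abs_dot_le (fun j => (rowNorm_mirrorGrad_uniformStart hn hk j).le)
    (u - uniformStart n k)
  have h4 : groupNorm 1 (u - uniformStart n k) ≤ 2 := by
    have := groupNorm_one_add_le u ((-1 : ℝ) • uniformStart n k)
    rw [groupNorm_one_smul, groupNorm_uniformStart hn hk, neg_one_smul, ← sub_eq_add_neg] at this
    norm_num at this
    linarith
  have h5 : 2 * Real.log n ≤ mirrorScale n := by
    rw [mirrorScale]
    exact mul_le_mul_of_nonneg_right (by linarith [Real.exp_one_gt_d9]) (by linarith)
  have h6 := mul_le_mul_of_nonneg_left h4 (by linarith : 0 ≤ Real.log n)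
  rw [bregman]
  linarith [neg_abs_le (dot (mirrorGrad (uniformStart n k)) (u - uniformStart n k))]

theorem stepSize_pos (hn : 3 ≤ n) {R : ℝ} (hR : 0 < R) {T : ℕ} (hT : 1 ≤ T) :
    0 < stepSize n R T := by
  have := mirrorScale_pos hn
  rw [mirrorScale] at this
  have hT0 : (0 : ℝ) < T := by exact_mod_cast hT
  rw [stepSize]
  positivity

/-- The convergence rate of mirror descent with updates of accuracy `δ t`. -/
theorem totalLoss_descent_le {ι : Type} (hn : 3 ≤ n) (hk : 0 < k) (S : Finset ι) {x : ι → Mat n k}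
    {y : ι → ℝ} {R : ℝ} {T : ℕ} {δ : ℕ → ℝ} {w : ℕ → Mat n k} {v : Mat n k}
    (hR : 0 < R) (hT : 1 ≤ T) (hx : ∀ s j, rowNorm (x s) j ≤ 1) (hy : ∀ s, |y s| ≤ 1)
    (hw0 : w 0 = uniformStart n k)
    (hw : ∀ t < T, IsApproxStep (δ t) (stepSize n R T) (lossGrad S x y R (w t)) (w t) (w (t + 1)))
    (hv : groupNorm 1 v ≤ R) :
    totalLoss S x y (R • ((1 / (T : ℝ)) • ∑ t ∈ Finset.range T, w t)) ≤ totalLoss S x y v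
      + S.card * (5 * R * √(mirrorScale n / T)
        + (∑ t ∈ Finset.range T, δ t) / (stepSize n R T * T)) := by
  have hT0 : (0 : ℝ) < T := by exact_mod_cast hT
  set γ := stepSize n R T with hγdef
  have hγ : 0 < γ := stepSize_pos hn hR hT
  set u : Mat n k := (1 / R) • v with hu_def
  have hu : groupNorm 1 u ≤ 1 := by
    rw [hu_def, groupNorm_one_smul, abs_of_pos (by positivity), one_div_mul_eq_div, div_le_one hR]
    exact hv
  have hRu : R • u = v := by rw [hu_def, smul_smul, mul_one_div_cancel hR.ne', one_smul]
  have hreg := regret_le hn hw hγ.le (fun t j => rowNorm_lossGrad_le S hR.le hx hy (w t) j)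
    (by rw [hw0, groupNorm_uniformStart hn hk]) hu
  rw [hw0] at hreg
  have hD := bregman_uniformStart_le hn hk hu
  set q := √(mirrorScale n / T) with hq
  have hq0 : 0 ≤ q := Real.sqrt_nonneg _
  have hγq : γ * (2 * R) = q := by
    rw [hγdef, stepSize, ← mirrorScale, ← hq]; field_simp
  have hqq : q ^ 2 * T = mirrorScale n := by
    rw [hq, Real.sq_sqrt (div_nonneg (mirrorScale_pos hn).le hT0.le)]; field_simp
  -- With c = e ln n, the step size makes T γ² R² equal to c/4. Together with the initial divergence
  -- 2c this stays below 5c/2, which is γ T times 5 R √(c/T).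
  have hsum : ∑ t ∈ Finset.range T, dot (lossGrad S x y R (w t)) (w t - u)
      ≤ T * (5 * R * q + (∑ t ∈ Finset.range T, δ t) / (γ * T)) := by
    have e1 : γ * (T * (5 * R * q + (∑ t ∈ Finset.range T, δ t) / (γ * T)))
        = ∑ t ∈ Finset.range T, δ t + γ * T * (5 * R * q) := by
      field_simp; ring
    have e2 : γ * T * (5 * R * q) = 5 / 2 * mirrorScale n := by
      rw [← hqq, ← hγq]; ring
    have e3 : T * (γ ^ 2 * R ^ 2) = mirrorScale n / 4 := by
      rw [← hqq, ← hγq]; ring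
    refine le_of_mul_le_mul_left ?_ hγ
    rw [e1, e2]
    linarith [mirrorScale_pos hn]
  have havg := totalLoss_average_le S x y hT (fun t => R • w t)
  have hR' : (1 / (T : ℝ)) • ∑ t ∈ Finset.range T, R • w t
      = R • ((1 / (T : ℝ)) • ∑ t ∈ Finset.range T, w t) := by
    rw [← Finset.smul_sum, smul_comm]
  rw [hR'] at havg
  have hterm := Finset.sum_le_sum fun t (_ : t ∈ Finset.range T) =>
    totalLoss_sub_le S x y R (w t) u
  rw [Finset.sum_sub_distrib, ← Finset.mul_sum, hRu] at hterm
  simp only [Finset.sum_const, Finset.card_range, nsmul_eq_mul] at hterm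
  have hcard : (0 : ℝ) ≤ S.card := by positivity
  have h1 := mul_le_mul_of_nonneg_left hsum hcard
  refine le_of_mul_le_mul_left ?_ hT0
  nlinarith

end Descent

/-! ## Values of programs -/

section Values

@[simp] theorem pure_val {α : Type} (a : α) : (pure a : Timed α).val = a := rfl

@[simp] theorem bind_val {α β : Type} (m : Timed α) (f : α → Timed β) :
    (m >>= f).val = (f m.val).val := rfl

theorem op_bind_val {α β : Type} (a : α) (f : α → Timed β) :
    (op a >>= f).val = (f a).val := rfl

@[simp] theorem op_val {α : Type} (a : α) : (op a).val = a := rfl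

@[simp] theorem tabulate_val {m : ℕ} {α : Type} (f : Fin m → Timed α) :
    (tabulate f).val = fun i => (f i).val := rfl

@[simp] theorem tabulate₂_val {m l : ℕ} {α : Type} (f : Fin m → Fin l → Timed α) :
    (tabulate₂ f).val = fun i j => (f i j).val := rfl

@[simp] theorem ite_val {α : Type} (c : Prop) [Decidable c] (a b : Timed α) :
    (if c then a else b).val = if c then a.val else b.val := by
  split <;> rfl

theorem loop_val {ι α : Type} (l : List ι) (f : ι → α → Timed α) (a : α) :
    (loop l f a).val = l.foldl (fun a i => (f i a).val) a := by
  induction l generalizing a with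
  | nil => rfl
  | cons i l ih => simp [loop, ih]

@[simp] theorem select_val {ι : Type} (l : List ι) (p : ι → Timed Bool) :
    (select l p).val = l.filter fun i => (p i).val := by
  induction l with
  | nil => rfl
  | cons i l ih => simp [select, ih, List.filter_cons]

theorem foldl_add_eq {ι M : Type*} [AddCommMonoid M] (l : List ι) (f : ι → M) (a : M) :
    l.foldl (fun a i => a + f i) a = a + (l.map f).sum := by
  induction l generalizing a with
  | nil => simp
  | cons i l ih => simp [ih, add_assoc]

@[simp] theorem sumLoop_val {ι : Type} (l : List ι) (f : ι → Timed ℝ) :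
    (sumLoop l f).val = (l.map fun i => (f i).val).sum := by
  simp [sumLoop, loop_val, foldl_add_eq]

theorem sum_map_finRange {M : Type*} [AddCommMonoid M] {m : ℕ} (f : Fin m → M) :
    ((List.finRange m).map f).sum = ∑ i, f i := (Fin.sum_univ_def f).symm

theorem powProg_val {q : ℝ} (hq : q ≠ 0) (x : ℝ) : (powProg x q).val = max x 0 ^ q := by
  by_cases hx : 0 < x
  · simp [powProg, hx, max_eq_left hx.le, Real.rpow_def_of_pos hx, mul_comm q]
  · simp [powProg, hx, max_eq_right (not_lt.1 hx), Real.zero_rpow hq]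

theorem rowNormsProg_val {n k : ℕ} (w : Mat n k) : (rowNormsProg w).val = rowNorm w := by
  funext j
  simp [rowNormsProg, rowNorm, sum_map_finRange, sq]

/-- The sum `∑_j ((s_j - ν)₊ / c) ^ q`. -/
noncomputable def softTotal {n : ℕ} (s : Fin n → ℝ) (c q ν : ℝ) : ℝ :=
  ∑ j, (max (s j - ν) 0 / c) ^ q

theorem max_div_zero {c : ℝ} (hc : 0 ≤ c) (x : ℝ) : max (x / c) 0 = max x 0 / c := by
  rw [← max_div_div_right hc, zero_div]

theorem totalProg_val {n : ℕ} (s : Fin n → ℝ) {c q : ℝ} (hc : 0 < c) (hq : q ≠ 0) (ν : ℝ) :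
    (totalProg s c q ν).val = softTotal s c q ν := by
  simp [totalProg, softTotal, sum_map_finRange, powProg_val hq, max_div_zero hc.le]

theorem foldl_max_spec {ι : Type*} (l : List ι) (s : ι → ℝ) (a : ℝ) :
    a ≤ l.foldl (fun m j => max m (s j)) a ∧ (∀ j ∈ l, s j ≤ l.foldl (fun m j => max m (s j)) a) ∧
      (l.foldl (fun m j => max m (s j)) a = a ∨
        ∃ j ∈ l, s j = l.foldl (fun m j => max m (s j)) a) := by
  induction l generalizing a with
  | nil => simp
  | cons i l ih =>
    obtain ⟨h1, h2, h3⟩ := ih (max a (s i))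
    simp only [List.foldl_cons, List.mem_cons, forall_eq_or_imp, exists_eq_or_imp]
    refine ⟨(le_max_left _ _).trans h1, ⟨(le_max_right _ _).trans h1, h2⟩, ?_⟩
    rcases h3 with h3 | h3
    · rcases le_total a (s i) with h | h
      · right; left; rw [h3, max_eq_right h]
      · left; rw [h3, max_eq_left h]
    · exact Or.inr (Or.inr h3)

/-- Only the invariant that r exceeds 1 at the lower end and not at the upper end is maintained;
neither monotonicity nor continuity of r is used. -/
theorem bisection_spec {ι : Type*} (S : List ι) (r : ℝ → ℝ) (lo hi : ℝ) (hlh : lo ≤ hi)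
    (hlo : 1 < r lo) (hhi : r hi ≤ 1) :
    let I := S.foldl (fun (I : ℝ × ℝ) _ =>
      if r ((I.1 + I.2) / 2) ≤ 1 then (I.1, (I.1 + I.2) / 2) else ((I.1 + I.2) / 2, I.2)) (lo, hi)
    lo ≤ I.1 ∧ I.1 ≤ I.2 ∧ I.2 ≤ hi ∧ I.2 - I.1 = (hi - lo) / 2 ^ S.length ∧
      1 < r I.1 ∧ r I.2 ≤ 1 := by
  induction S generalizing lo hi with
  | nil => simp [*]
  | cons i S ih =>
    simp only [List.foldl_cons]
    split_ifs with h
    · obtain ⟨h1, h2, h3, h4, h5, h6⟩ := ih lo ((lo + hi) / 2) (by linarith) hlo h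
      refine ⟨h1, h2, h3.trans (by linarith), ?_, h5, h6⟩
      rw [h4, List.length_cons, pow_succ]; field_simp; ring
    · obtain ⟨h1, h2, h3, h4, h5, h6⟩ := ih ((lo + hi) / 2) hi (by linarith) (not_le.1 h) hhi
      refine ⟨le_trans (by linarith) h1, h2, h3, ?_, h5, h6⟩
      rw [h4, List.length_cons, pow_succ]; field_simp; ring

/-- Either no threshold is needed or the bisection ends with a bracket around the level 1. The
bracket starts at [0, max s], and at its upper end every summand vanishes. -/
theorem thresholdProg_spec {n : ℕ} {ι : Type} (S : List ι) {s : Fin n → ℝ} {c q : ℝ}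
    (hn : 0 < n) (hs : ∀ j, 0 ≤ s j) (hc : 0 < c) (hq : 0 < q) :
    let ν := (thresholdProg S s c q).val
    0 ≤ ν ∧ softTotal s c q ν ≤ 1 ∧ (ν = 0 ∨ ∃ lo, ∃ i, (∀ j, s j ≤ s i) ∧ 0 ≤ lo ∧ lo ≤ ν ∧
      ν ≤ s i ∧ ν - lo = s i / 2 ^ S.length ∧ 1 < softTotal s c q lo) := by
  intro ν
  by_cases h : softTotal s c q 0 ≤ 1
  · have hν : ν = 0 := by simp [ν, thresholdProg, totalProg_val s hc hq.ne', h]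
    rw [hν]
    exact ⟨le_rfl, h, Or.inl rfl⟩
  · have hν : ν = (S.foldl (fun (I : ℝ × ℝ) _ =>
        if softTotal s c q ((I.1 + I.2) / 2) ≤ 1 then (I.1, (I.1 + I.2) / 2)
        else ((I.1 + I.2) / 2, I.2))
        (0, (List.finRange n).foldl (fun m j => max m (s j)) 0)).2 := by
      simp [ν, thresholdProg, totalProg_val s hc hq.ne', h, loop_val]
    obtain ⟨h1, h2, h3⟩ := foldl_max_spec (List.finRange n) s 0
    set top := (List.finRange n).foldl (fun m j => max m (s j)) 0
    have h2' : ∀ j, s j ≤ top := fun j => h2 j (List.mem_finRange j)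
    obtain ⟨i, hi⟩ : ∃ i, s i = top := by
      rcases h3 with h3 | ⟨i, -, h3⟩
      · exact ⟨⟨0, hn⟩, le_antisymm (h2' _) (h3 ▸ hs _)⟩
      · exact ⟨i, h3⟩
    have htop : softTotal s c q top ≤ 1 := by
      have : softTotal s c q top = 0 := Finset.sum_eq_zero fun j _ => by
        rw [max_eq_right (by linarith [h2' j]), zero_div, Real.zero_rpow hq.ne']
      rw [this]; exact zero_le_one
    have hb := bisection_spec S (softTotal s c q) 0 top h1 (not_le.1 h) htop
    simp only [← hν] at hb
    obtain ⟨b1, b2, b3, b4, b5, b6⟩ := hb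
    refine ⟨b1.trans b2, b6, Or.inr ⟨_, i, fun j => hi ▸ h2' j, b1, b2, hi ▸ b3, ?_, b5⟩⟩
    rw [b4, hi, sub_zero]

end Values

/-! ## The soft-thresholding step -/

section SoftStep

variable {n k : ℕ}

/-- The matrix whose row `j` is the multiple of `ξ_j` of norm `((‖ξ_j‖ - ν)₊ / (e ln n)) ^ (ln n)`. -/
noncomputable def softStep (ξ : Mat n k) (ν : ℝ) : Mat n k := fun j b =>
  (max (rowNorm ξ j - ν) 0 / mirrorScale n) ^ Real.log n / rowNorm ξ j * ξ j b

theorem rowNorm_softStep (hn : 3 ≤ n) (ξ : Mat n k) {ν : ℝ} (hν : 0 ≤ ν) (j : Fin n) :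
    rowNorm (softStep ξ ν) j = (max (rowNorm ξ j - ν) 0 / mirrorScale n) ^ Real.log n := by
  have hl := one_lt_log hn
  have hc := mirrorScale_pos hn
  have h : rowNorm (softStep ξ ν) j = rowNorm
      (((max (rowNorm ξ j - ν) 0 / mirrorScale n) ^ Real.log n / rowNorm ξ j) • ξ) j := rfl
  have h0 := rowNorm_nonneg ξ j
  have hp : 0 ≤ (max (rowNorm ξ j - ν) 0 / mirrorScale n) ^ Real.log n :=
    Real.rpow_nonneg (div_nonneg (le_max_right _ _) hc.le) _
  rw [h, rowNorm_smul, abs_of_nonneg (div_nonneg hp h0)]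
  rcases h0.eq_or_lt with h0 | h0
  · rw [← h0, max_eq_right (by linarith), zero_div, Real.zero_rpow (by linarith)]; simp
  · rw [div_mul_cancel₀ _ h0.ne']

theorem groupNorm_softStep (hn : 3 ≤ n) (ξ : Mat n k) {ν : ℝ} (hν : 0 ≤ ν) :
    groupNorm 1 (softStep ξ ν) = softTotal (rowNorm ξ) (mirrorScale n) (Real.log n) ν := by
  rw [groupNorm_one, softTotal]
  exact Finset.sum_congr rfl fun j _ => rowNorm_softStep hn ξ hν j

theorem rowNorm_mirrorGrad_softStep (hn : 3 ≤ n) (ξ : Mat n k) {ν : ℝ} (hν : 0 ≤ ν) (j : Fin n) :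
    rowNorm (mirrorGrad (softStep ξ ν)) j = max (rowNorm ξ j - ν) 0 := by
  have hl := one_lt_log hn
  have hc := mirrorScale_pos hn
  rw [rowNorm_mirrorGrad hn, rowNorm_softStep hn ξ hν, ← Real.rpow_mul
    (div_nonneg (le_max_right _ _) hc.le), mul_one_div_cancel (by linarith), Real.rpow_one]
  field_simp

/-- The exponents ln n and 1/ln n cancel, so in dual coordinates the update just shortens every row
of ξ by ν. For a row that vanishes both sides are zero. -/
theorem mirrorGrad_softStep (hn : 3 ≤ n) (ξ : Mat n k) {ν : ℝ} (hν : 0 ≤ ν) (j : Fin n)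
    (b : Fin k) :
    mirrorGrad (softStep ξ ν) j b = max (rowNorm ξ j - ν) 0 / rowNorm ξ j * ξ j b := by
  have hl := one_lt_log hn
  have hc := mirrorScale_pos hn
  rw [mirrorGrad, rowNorm_softStep hn ξ hν, softStep]
  rcases (le_max_right (rowNorm ξ j - ν) 0).eq_or_lt with h | h
  · rw [← h, zero_div, Real.zero_rpow (by linarith : Real.log n ≠ 0)]; simp
  · have hd : 0 < max (rowNorm ξ j - ν) 0 / mirrorScale n := div_pos h hc
    have e : ((max (rowNorm ξ j - ν) 0 / mirrorScale n) ^ Real.log n) ^ (1 / Real.log n - 1)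
        * (max (rowNorm ξ j - ν) 0 / mirrorScale n) ^ Real.log n
        = max (rowNorm ξ j - ν) 0 / mirrorScale n := by
      rw [← Real.rpow_mul hd.le, ← Real.rpow_add hd,
        show Real.log n * (1 / Real.log n - 1) + Real.log n = 1 by field_simp; ring, Real.rpow_one]
    calc _ = mirrorScale n * (((max (rowNorm ξ j - ν) 0 / mirrorScale n) ^ Real.log n)
          ^ (1 / Real.log n - 1) * (max (rowNorm ξ j - ν) 0 / mirrorScale n) ^ Real.log n)
          / rowNorm ξ j * ξ j b := by ring
      _ = _ := by rw [e]; field_simp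

/-- Karush–Kuhn–Tucker conditions with multiplier ν. On a surviving row, ∇Φ(v) - ξ is -ν times the
unit vector along ξ_j; on a vanishing row it is -ξ_j, of norm at most ν. By Cauchy–Schwarz the inner
product with u - v is at least ν(‖v‖ - ‖u‖) in the norm ‖·‖_{2,1}, so the only error is the slack of
the constraint at v. -/
theorem softStep_isApproxStep (hn : 3 ≤ n) {γ ν : ℝ} {g w ξ : Mat n k}
    (hξ : ξ = mirrorGrad w - γ • g) (hν : 0 ≤ ν)
    (h1 : softTotal (rowNorm ξ) (mirrorScale n) (Real.log n) ν ≤ 1) :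
    IsApproxStep (ν * (1 - softTotal (rowNorm ξ) (mirrorScale n) (Real.log n) ν)) γ g w
      (softStep ξ ν) := by
  rw [← groupNorm_softStep hn ξ hν] at h1 ⊢
  refine ⟨h1, fun u hu => ?_⟩
  rw [← hξ]
  set v := softStep ξ ν with hv
  have hrow : ∀ j, ν * (rowNorm v j - rowNorm u j)
      ≤ ∑ b, (mirrorGrad v - ξ) j b * (u - v) j b := by
    intro j
    have hs := rowNorm_nonneg ξ j
    have hcs := abs_le.1 (abs_rowDot_le ξ u j)
    have hu0 := rowNorm_nonneg u j
    by_cases hle : rowNorm ξ j ≤ ν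
    · have hm : max (rowNorm ξ j - ν) 0 = 0 := max_eq_right (by linarith)
      have hl : Real.log n ≠ 0 := by linarith [one_lt_log hn]
      have hvj : ∀ b, v j b = 0 := fun b => by
        simp [hv, softStep, hm, Real.zero_rpow hl]
      have hvn : rowNorm v j = 0 := by
        rw [hv, rowNorm_softStep hn ξ hν, hm, zero_div, Real.zero_rpow hl]
      have : ∑ b, (mirrorGrad v - ξ) j b * (u - v) j b = -∑ b, ξ j b * u j b := by
        rw [← Finset.sum_neg_distrib]
        refine Finset.sum_congr rfl fun b _ => ?_
        simp only [Pi.sub_apply]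
        rw [hv, mirrorGrad_softStep hn ξ hν, hm, ← hv, hvj]; ring
      rw [this, hvn]
      nlinarith
    · have hlt := not_le.1 hle
      have hs0 : 0 < rowNorm ξ j := by linarith
      have hm : max (rowNorm ξ j - ν) 0 = rowNorm ξ j - ν := max_eq_left (by linarith)
      have hvv : ∑ b, ξ j b * v j b = rowNorm ξ j * rowNorm v j := by
        have : ∀ b, ξ j b * v j b = rowNorm v j / rowNorm ξ j * ξ j b ^ 2 := fun b => by
          rw [hv, rowNorm_softStep hn ξ hν, softStep]; ring
        rw [Finset.sum_congr rfl fun b _ => this b, ← Finset.mul_sum, ← rowNorm_sq]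
        field_simp
      have : ∑ b, (mirrorGrad v - ξ) j b * (u - v) j b
          = ν / rowNorm ξ j * (∑ b, ξ j b * v j b - ∑ b, ξ j b * u j b) := by
        rw [← Finset.sum_sub_distrib, Finset.mul_sum]
        refine Finset.sum_congr rfl fun b _ => ?_
        simp only [Pi.sub_apply]
        rw [hv, mirrorGrad_softStep hn ξ hν, hm, ← hv]
        field_simp
        ring
      rw [this, hvv]
      have h2 : ν / rowNorm ξ j * (rowNorm ξ j * (rowNorm v j - rowNorm u j))
          = ν * (rowNorm v j - rowNorm u j) := by field_simp
      rw [← h2]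
      refine mul_le_mul_of_nonneg_left ?_ (div_nonneg hν hs)
      linarith
  have hsum := Finset.sum_le_sum fun j (_ : j ∈ Finset.univ) => hrow j
  rw [← Finset.mul_sum, Finset.sum_sub_distrib, ← groupNorm_one, ← groupNorm_one] at hsum
  have := mul_le_mul_of_nonneg_left hu hν
  rw [dot]
  linarith

/-- The ℓ_q norm of the shrunken vector, q = ln n, changes by at most the norm of a constant vector
when the threshold moves by d. That norm is n^(1/q) d/(e ln n) = d/q, so the total at ν is at least
(1 - d/q)^q, and Bernoulli's inequality finishes. -/
theorem one_sub_softTotal_le (hn : 3 ≤ n) {s : Fin n → ℝ} {lo ν : ℝ} (hlν : lo ≤ ν)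
    (hlo : 1 < softTotal s (mirrorScale n) (Real.log n) lo) :
    1 - softTotal s (mirrorScale n) (Real.log n) ν ≤ ν - lo := by
  have hl := one_lt_log hn
  have hc := mirrorScale_pos hn
  set c := mirrorScale n with hcdef
  set q := Real.log n with hqdef
  set d := ν - lo with hd
  have hd0 : 0 ≤ d := sub_nonneg.2 hlν
  have hpos : ∀ μ j, 0 ≤ max (s j - μ) 0 / c := fun μ j => div_nonneg (le_max_right _ _) hc.le
  have htot : ∀ μ, 0 ≤ softTotal s c q μ := fun μ =>
    Finset.sum_nonneg fun j _ => Real.rpow_nonneg (hpos μ j) _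
  rcases le_or_gt d q with hdq | hdq
  · have hmono : softTotal s c q lo
        ≤ ∑ j, |max (s j - ν) 0 / c + d / c| ^ q := by
      refine Finset.sum_le_sum fun j _ => Real.rpow_le_rpow (hpos lo j) ?_ (by linarith)
      refine le_trans ?_ (le_abs_self _)
      rw [← add_div]
      refine div_le_div_of_nonneg_right (max_le ?_ ?_) hc.le
      · linarith [le_max_left (s j - ν) 0]
      · linarith [le_max_right (s j - ν) 0]
    have hmink := Real.Lp_add_le Finset.univ (fun j => max (s j - ν) 0 / c) (fun _ => d / c) hl.le
    have e1 : (∑ j : Fin n, |(fun _ => d / c) j| ^ q) ^ (1 / q) = d / q := by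
      simp only [Finset.sum_const, Finset.card_univ, Fintype.card_fin, nsmul_eq_mul]
      rw [abs_of_nonneg (by positivity), Real.mul_rpow (by positivity) (by positivity),
        ← Real.rpow_mul (by positivity), mul_one_div_cancel (by positivity), Real.rpow_one,
        rpow_inv_log hn, hcdef, mirrorScale, ← hqdef]
      field_simp
    have e2 : ∑ j, |max (s j - ν) 0 / c| ^ q = softTotal s c q ν :=
      Finset.sum_congr rfl fun j _ => by rw [abs_of_nonneg (hpos ν j)]
    rw [e1, e2] at hmink
    have h1 : 1 ≤ softTotal s c q ν ^ (1 / q) + d / q :=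
      le_trans (Real.one_le_rpow (hlo.le.trans hmono) (by positivity)) hmink
    have h2 : (1 - d / q) ^ q ≤ softTotal s c q ν := by
      have h3 : 0 ≤ 1 - d / q := by
        rw [sub_nonneg, div_le_one (by positivity)]; exact hdq
      have := Real.rpow_le_rpow h3 (sub_le_iff_le_add.2 h1) (by positivity : 0 ≤ q)
      rwa [← Real.rpow_mul (htot ν), one_div_mul_cancel (by positivity), Real.rpow_one] at this
    have h3 := one_add_mul_self_le_rpow_one_add (s := -(d / q))
      (by rw [neg_le_neg_iff, div_le_one (by positivity)]; exact hdq) hl.le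
    have e3 : q * -(d / q) = -d := by field_simp
    rw [e3, ← sub_eq_add_neg, ← sub_eq_add_neg] at h3
    linarith
  -- Here the bracket is longer than q > 1, so the claim only needs a nonnegative total.
  · linarith [htot ν]

end SoftStep

/-! ## Correctness of the program -/

section Programs

variable {n k N : ℕ}

theorem stepProg_val (hn : 3 ≤ n) {ι : Type} (S : List ι) (γ : ℝ) (g w : Mat n k) :
    (stepProg S γ g w).val = softStep (mirrorGrad w - γ • g)
      (thresholdProg S (rowNorm (mirrorGrad w - γ • g)) (mirrorScale n) (Real.log n)).val := by
  have hl := one_lt_log hn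
  have hc := mirrorScale_pos hn
  have hξ : (fun j b => Real.exp 1 * Real.log n * max (rowNorm w j) 0 ^ (1 / Real.log n - 1) * w j b
      - γ * g j b) = mirrorGrad w - γ • g := by
    funext j b
    simp only [Pi.sub_apply, Pi.smul_apply, smul_eq_mul, mirrorGrad, mirrorScale,
      max_eq_left (rowNorm_nonneg w j)]
  have hq : 1 / Real.log n - 1 ≠ 0 := by
    have : 1 / Real.log n < 1 := by rw [div_lt_one (by linarith)]; exact hl
    linarith
  funext j b
  simp only [stepProg, bind_val, op_val, tabulate_val, tabulate₂_val, rowNormsProg_val,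
    powProg_val hq, powProg_val (by linarith : Real.log n ≠ 0), hξ, softStep]
  rw [← mirrorScale, max_div_zero hc.le, ← hξ]
  rfl

theorem rowNorm_dual_le {γ R : ℝ} {g w : Mat n k} (hγ : 0 ≤ γ)
    (hg : ∀ j, rowNorm g j ≤ R) (j : Fin n) :
    rowNorm (mirrorGrad w - γ • g) j ≤ rowNorm (mirrorGrad w) j + γ * R := by
  refine (rowNorm_sub_le _ _ _).trans ?_
  rw [rowNorm_smul, abs_of_nonneg hγ]
  have := mul_le_mul_of_nonneg_left (hg j) hγ
  linarith

theorem stepSize_nonneg (R : ℝ) (hR : 0 ≤ R) (T : ℕ) : 0 ≤ stepSize n R T :=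
  mul_nonneg (by positivity) (Real.sqrt_nonneg _)

theorem stepSize_mul_le (hn : 3 ≤ n) {R : ℝ} (hR : 0 ≤ R) {T : ℕ} (hT : 1 ≤ T) :
    stepSize n R T * R ≤ √(mirrorScale n) / 2 := by
  rcases hR.eq_or_lt with h | h
  · rw [← h, mul_zero]; positivity
  have hT0 : (1 : ℝ) ≤ T := by exact_mod_cast hT
  have h1 : √(mirrorScale n / T) ≤ √(mirrorScale n) :=
    Real.sqrt_le_sqrt (div_le_self (mirrorScale_pos hn).le hT0)
  have h2 : stepSize n R T * R = √(mirrorScale n / T) / 2 := by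
    rw [stepSize, ← mirrorScale]; field_simp
  rw [h2]; linarith

theorem mirrorScale_add_le (hn : 3 ≤ n) :
    mirrorScale n + √(mirrorScale n) / 2 ≤ 4 * Real.log n := by
  have hl := one_lt_log hn
  have he := Real.exp_one_lt_d9
  have he0 := Real.exp_pos 1
  have h1 : mirrorScale n ≤ 2.75 * Real.log n :=
    mul_le_mul_of_nonneg_right (by linarith) (by linarith)
  have h2 : √(mirrorScale n) ≤ 2 * Real.log n := by
    rw [Real.sqrt_le_left (by linarith)]
    nlinarith
  linarith

/-- One update of the program. -/
theorem stepProg_spec (hn : 3 ≤ n) {ι : Type} (S : List ι) {R : ℝ} {T : ℕ} (hR : 0 ≤ R)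
    (hT : 1 ≤ T) {g w : Mat n k} (hw : groupNorm 1 w ≤ 1) (hg : ∀ j, rowNorm g j ≤ R) :
    ∃ δ ν, IsApproxStep δ (stepSize n R T) g w (stepProg S (stepSize n R T) g w).val ∧
      0 ≤ ν ∧ δ ≤ ν * (4 * Real.log n / 2 ^ S.length) ∧
      δ ≤ 16 * Real.log n ^ 2 / 2 ^ S.length ∧
      ∀ B, (∀ j, rowNorm (mirrorGrad w) j ≤ B) → ∀ j,
        rowNorm (mirrorGrad (stepProg S (stepSize n R T) g w).val) j
          ≤ B + stepSize n R T * R - ν := by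
  have hl := one_lt_log hn
  have hc := mirrorScale_pos hn
  set γ := stepSize n R T with hγdef
  have hγ : 0 ≤ γ := stepSize_nonneg R hR T
  rw [stepProg_val hn]
  set ξ := mirrorGrad w - γ • g with hξ
  set ν := (thresholdProg S (rowNorm ξ) (mirrorScale n) (Real.log n)).val with hν
  obtain ⟨h0, h1, h2⟩ := thresholdProg_spec S (n := n) (s := rowNorm ξ) (by omega)
    (rowNorm_nonneg ξ) hc (by linarith : 0 < Real.log n)
  rw [← hν] at h0 h1 h2
  have hbound : ∀ j, rowNorm ξ j ≤ 4 * Real.log n := by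
    intro j
    refine (rowNorm_dual_le hγ hg j).trans ?_
    have h3 : rowNorm (mirrorGrad w) j ≤ mirrorScale n := by
      rw [rowNorm_mirrorGrad hn]
      exact mul_le_of_le_one_right hc.le (Real.rpow_le_one (rowNorm_nonneg w j)
        ((rowNorm_le_groupNorm_one w j).trans hw) (by positivity))
    have := stepSize_mul_le hn hR hT
    linarith [mirrorScale_add_le hn]
  have hgap : 1 - softTotal (rowNorm ξ) (mirrorScale n) (Real.log n) ν
      ≤ 4 * Real.log n / 2 ^ S.length ∨ ν = 0 := by
    rcases h2 with h2 | ⟨lo, i, -, -, h4, -, h5, h6⟩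
    · exact Or.inr h2
    · left
      refine (one_sub_softTotal_le hn h4 h6).trans ?_
      rw [h5]
      exact div_le_div_of_nonneg_right (hbound i) (by positivity)
  have hδ : ν * (1 - softTotal (rowNorm ξ) (mirrorScale n) (Real.log n) ν)
      ≤ ν * (4 * Real.log n / 2 ^ S.length) := by
    rcases hgap with h | h
    · exact mul_le_mul_of_nonneg_left h h0
    · rw [h, zero_mul, zero_mul]
  have hν4 : ν ≤ 4 * Real.log n := by
    rcases h2 with h2 | ⟨lo, i, -, -, -, h4, -⟩
    · rw [h2]; linarith
    · exact h4.trans (hbound i)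
  refine ⟨_, ν, softStep_isApproxStep hn hξ h0 h1, h0, hδ, hδ.trans ?_, fun B hB j => ?_⟩
  · refine (mul_le_mul_of_nonneg_right hν4 (by positivity)).trans (le_of_eq ?_)
    ring
  -- The largest dual row norm grows by at most γ R in the gradient step and then falls by ν. The
  -- truncation at zero does no harm because a positive ν is at most the largest row norm of ξ.
  · rw [rowNorm_mirrorGrad_softStep hn ξ h0]
    have hs : ∀ j, rowNorm ξ j ≤ B + γ * R := fun j =>
      (rowNorm_dual_le hγ hg j).trans (by linarith [hB j])
    refine max_le (by linarith [hs j]) ?_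
    rcases h2 with h2 | ⟨lo, i, -, -, -, h4, -⟩
    · rw [h2]; linarith [hs j, rowNorm_nonneg ξ j]
    · linarith [hs i]

theorem featureProg_val (i : Fin n) (z : Fin n → Fin k) (R : ℝ) (j : Fin n) (b : Fin k) :
    (featureProg i z R j b).val = (R • feature i z) j b := by
  simp only [featureProg, bind_val, op_val, ite_val, decide_eq_true_eq, Pi.smul_apply, feature,
    smul_eq_mul]
  split <;> rfl

theorem gradProg_val {S : List (Fin N)} (hS : S.Nodup) (z : Fin N → Fin n → Fin k) (i : Fin n)
    (α : Fin k) (R : ℝ) (w : Mat n k) :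
    (gradProg S z i α R w).val
      = lossGrad S.toFinset (fun m => feature i (z m)) (fun m => label i α (z m)) R w := by
  have hbody : ∀ l : List (Fin N), l.foldl (fun (g : Mat n k) m => fun j b => g j b
      + (1 / (1 + Real.exp (-dot w (R • feature i (z m))))
        - ((if z m i = α then 1 else -1) + 1) / 2) * (R • feature i (z m)) j b) (fun _ _ => 0)
      = (l.map fun m => (Real.sigmoid (dot w (R • feature i (z m)))
        - (label i α (z m) + 1) / 2) • (R • feature i (z m))).sum := by
    intro l
    rw [← zero_add (List.sum _), ← foldl_add_eq]
    congr 1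
    funext g m j b
    simp only [label, Real.sigmoid_def, one_div, Pi.add_apply, Pi.smul_apply, smul_eq_mul]
  funext j b
  simp only [gradProg, bind_val, op_val, tabulate₂_val, loop_val, sumLoop_val, featureProg_val,
    sum_map_finRange, decide_eq_true_eq]
  have h := congrFun (congrFun (hbody S) j) b
  simp only [dot] at h
  rw [h, lossGrad, List.sum_toFinset _ hS, List.toFinset_card_of_nodup hS]
  simp only [List.map_const', List.sum_replicate, nsmul_eq_mul, mul_one, Pi.smul_apply,
    smul_eq_mul, dot]
  ring

theorem rowNorm_feature_le (i : Fin n) (z : Fin n → Fin k) (j : Fin n) :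
    rowNorm (feature i z) j ≤ 1 := by
  rw [rowNorm, Real.sqrt_le_one]
  by_cases h : j = i
  · have hk : 0 < k := (z i).pos
    have : ∀ b : Fin k, feature i z j b ^ 2 = if b = ⟨0, hk⟩ then 1 else 0 := fun b => by
      simp [feature, h, Fin.ext_iff]
    simp [this]
  · simp only [feature, h, if_false, ite_pow, one_pow, ne_eq, OfNat.ofNat_ne_zero,
      not_false_eq_true, zero_pow, Finset.sum_ite_eq, Finset.mem_univ, if_true, le_refl]

theorem abs_label_le (i : Fin n) (α : Fin k) (z : Fin n → Fin k) : |label i α z| ≤ 1 := by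
  rw [label]; split <;> simp

/-- Mirror descent as it is carried out by the program. -/
theorem descentProg_spec (hn : 3 ≤ n) (hk : 0 < k) {S : List (Fin N)} (hS : S.Nodup)
    (z : Fin N → Fin n → Fin k) (i : Fin n) (α : Fin k) {R : ℝ} (hR : 0 ≤ R) {T : ℕ} (hT : 1 ≤ T) :
    ∃ (w : ℕ → Mat n k) (δ : ℕ → ℝ), w 0 = uniformStart n k ∧
      (∀ t < T, IsApproxStep (δ t) (stepSize n R T) (lossGrad S.toFinset
        (fun m => feature i (z m)) (fun m => label i α (z m)) R (w t)) (w t) (w (t + 1))) ∧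
      (∀ t < T, δ t ≤ 16 * Real.log n ^ 2 / 2 ^ S.length) ∧
      ∑ t ∈ Finset.range T, δ t
        ≤ 4 * Real.log n / 2 ^ S.length * (Real.log n + T * (stepSize n R T * R)) ∧
      (descentProg S z i α R T).val = R • ((1 / (T : ℝ)) • ∑ t ∈ Finset.range T, w t) := by
  have hl := one_lt_log hn
  set γ := stepSize n R T with hγ
  set G : Mat n k → Mat n k := lossGrad S.toFinset (fun m => feature i (z m))
    (fun m => label i α (z m)) R with hG
  let w : ℕ → Mat n k := fun t => (fun v => (stepProg S γ (G v) v).val)^[t] (uniformStart n k)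
  have hw_succ : ∀ t, w (t + 1) = (stepProg S γ (G (w t)) (w t)).val := fun t =>
    Function.iterate_succ_apply' _ _ _
  have hgr : ∀ v j, rowNorm (G v) j ≤ R := fun v j => rowNorm_lossGrad_le _ hR
    (fun m j => rowNorm_feature_le i (z m) j) (fun m => abs_label_le i α (z m)) v j
  have hball : ∀ t, groupNorm 1 (w t) ≤ 1 := by
    intro t
    induction t with
    | zero => exact (groupNorm_uniformStart hn hk).le
    | succ t ih =>
      obtain ⟨δ, ν, h, -⟩ := stepProg_spec hn S hR hT ih (hgr (w t))
      rw [hw_succ]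
      exact h.1
  choose δ ν h1 h2 h3 h4 h5 using fun t => stepProg_spec hn S hR hT (hball t) (hgr (w t))
  -- Potential argument: thresholds are paid for by the growth of the dual row norms. Since these
  -- stay nonnegative, the sum of the ν is at most ln n + TγR. Bounding every δ separately would
  -- leave an error that grows like 1/γ, hence like √T, whereas the number of bisections does not
  -- depend on T.
  have hpot : ∀ m j, rowNorm (mirrorGrad (w m)) j
      ≤ Real.log n + m * (γ * R) - ∑ t ∈ Finset.range m, ν t := by
    intro m
    induction m with
    | zero =>
      intro j
      simp only [CharP.cast_eq_zero, zero_mul, add_zero, Finset.range_zero, Finset.sum_empty,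
        sub_zero]
      exact (rowNorm_mirrorGrad_uniformStart hn hk j).le
    | succ m ih =>
      intro j
      rw [hw_succ, Finset.sum_range_succ]
      refine (h5 m _ ih j).trans (le_of_eq ?_)
      push_cast
      ring
  refine ⟨w, δ, rfl, fun t _ => hw_succ t ▸ h1 t, fun t _ => h4 t, ?_, ?_⟩
  · have hν : ∑ t ∈ Finset.range T, ν t ≤ Real.log n + T * (γ * R) := by
      have := (rowNorm_nonneg (mirrorGrad (w T)) ⟨0, by omega⟩).trans (hpot T _)
      linarith
    calc ∑ t ∈ Finset.range T, δ t
        ≤ ∑ t ∈ Finset.range T, ν t * (4 * Real.log n / 2 ^ S.length) :=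
          Finset.sum_le_sum fun t _ => h3 t
      _ = 4 * Real.log n / 2 ^ S.length * ∑ t ∈ Finset.range T, ν t := by
          rw [← Finset.sum_mul, mul_comm]
      _ ≤ _ := mul_le_mul_of_nonneg_left hν (by positivity)
  · have hloop : ∀ m, (List.range m).foldl (fun (st : Mat n k × Mat n k) _ =>
        ((stepProg S γ (gradProg S z i α R st.1).val st.1).val,
          fun j b => st.2 j b + st.1 j b)) (uniformStart n k, fun _ _ => 0)
        = (w m, ∑ t ∈ Finset.range m, w t) := by
      intro m
      induction m with
      | zero => rfl
      | succ m ih =>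
        rw [List.range_succ, List.foldl_append, ih, Finset.sum_range_succ, hw_succ]
        simp only [List.foldl_cons, List.foldl_nil, gradProg_val hS]
        rfl
    have hγ' : 1 / (2 * R) * √(Real.exp 1 * Real.log n / T) = γ := rfl
    funext j b
    simp only [descentProg, bind_val, op_val, tabulate₂_val, loop_val, pure_val, hγ']
    have := hloop T
    unfold uniformStart at this
    rw [this]
    simp only [Pi.smul_apply, smul_eq_mul]
    ring

theorem centerProg_val (i : Fin n) (w : Mat n k) : (centerProg i w).val = center i w := by
  funext j b
  simp only [centerProg, bind_val, op_val, tabulate_val, tabulate₂_val, sumLoop_val,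
    sum_map_finRange, pure_val, decide_eq_true_eq, center]
  split_ifs with h
  · rw [h, Finset.mul_sum, ← Finset.add_sum_erase _ _ (Finset.mem_univ i), if_pos rfl, zero_add]
    congr 1
    refine Finset.sum_congr rfl fun l hl => ?_
    rw [if_neg (Finset.ne_of_mem_erase hl)]; ring
  · ring

/-- The list of samples of a regression as it is computed by the program. -/
def sampleList (z : Fin N → Fin n → Fin k) (i : Fin n) (α β : Fin k) : List (Fin N) :=
  (List.finRange N).filter fun m => decide (z m i = α) || decide (z m i = β)

theorem nodup_sampleList (z : Fin N → Fin n → Fin k) (i : Fin n) (α β : Fin k) :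
    (sampleList z i α β).Nodup :=
  (List.nodup_finRange N).filter _

theorem toFinset_sampleList (z : Fin N → Fin n → Fin k) (i : Fin n) (α β : Fin k) :
    (sampleList z i α β).toFinset = restricted z i α β := by
  ext m
  simp [sampleList, restricted]

theorem length_sampleList (z : Fin N → Fin n → Fin k) (i : Fin n) (α β : Fin k) :
    (sampleList z i α β).length = (restricted z i α β).card := by
  rw [← toFinset_sampleList, List.toFinset_card_of_nodup (nodup_sampleList z i α β)]

/-- The body of the loop over the second symbol `β`, which adds the centered output of one
regression to an accumulator. -/
noncomputable def regressionProg (z : Fin N → Fin n → Fin k) (i : Fin n) (α : Fin k) (R : ℝ) (T : ℕ)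
    (β : Fin k) (acc : Mat n k) : Timed (Mat n k) := do
  let same ← op (decide (α = β))
  if same then pure acc
  else do
    let S ← select (List.finRange N) fun m => do
      let isα ← op (decide (z m i = α))
      let isβ ← op (decide (z m i = β))
      op (isα || isβ)
    let none ← op S.isEmpty
    if none then pure acc
    else do
      let w ← descentProg S z i α R T
      let U ← centerProg i w
      tabulate₂ fun j b => op (acc j b + U j b)

theorem regressionProg_val (z : Fin N → Fin n → Fin k) (i : Fin n) (α : Fin k) (R : ℝ) (T : ℕ)
    (β : Fin k) (acc : Mat n k) :
    (regressionProg z i α R T β acc).val = acc + if α = β then 0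
      else if (sampleList z i α β).isEmpty then 0
      else center i (descentProg (sampleList z i α β) z i α R T).val := by
  rw [regressionProg, op_bind_val]
  by_cases h : α = β
  · rw [if_pos (decide_eq_true h), if_pos h, add_zero]; rfl
  · rw [if_neg (by simpa using h), if_neg h, bind_val, select_val, op_bind_val]
    change Timed.val (ite ((sampleList z i α β).isEmpty = true) _ _) = _
    by_cases h2 : (sampleList z i α β).isEmpty = true
    · rw [if_pos h2, if_pos h2, add_zero]; rfl
    · rw [if_neg h2, if_neg h2, bind_val, bind_val, centerProg_val]; rfl

theorem learnProg_val_fst (lam η : ℝ) (T : ℕ) (z : Fin N → Fin n → Fin k) (i j : Fin n)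
    (α b : Fin k) :
    (learnProg lam η T z).val.1 i j α b = (1 / (k : ℝ)) * ∑ β ∈ Finset.univ.erase α,
      if (sampleList z i α β).isEmpty then 0
      else center i (descentProg (sampleList z i α β) z i α (2 * lam * √(k : ℝ)) T).val j b := by
  have h : (learnProg lam η T z).val.1 i j α b = (loop (List.finRange k)
      (regressionProg z i α (2 * lam * √(k : ℝ)) T) fun _ _ => 0).val j b / k := rfl
  rw [h, loop_val]
  simp only [regressionProg_val]
  rw [foldl_add_eq, sum_map_finRange, ← Finset.add_sum_erase _ _ (Finset.mem_univ α), if_pos rfl,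
    div_eq_inv_mul, one_div]
  simp only [Pi.add_apply, Finset.sum_apply, zero_add]
  congr 1
  refine Finset.sum_congr rfl fun β hβ => ?_
  rw [if_neg (Finset.ne_of_mem_erase hβ).symm]
  split_ifs <;> rfl

theorem foldl_or_eq {ι : Type*} (l : List ι) (p : ι → Bool) (a : Bool) :
    l.foldl (fun a i => a || p i) a = (a || l.any p) := by
  induction l generalizing a with
  | nil => simp
  | cons i l ih => simp [ih, Bool.or_assoc]

theorem learnProg_val_snd (lam η : ℝ) (T : ℕ) (z : Fin N → Fin n → Fin k) (i j : Fin n) :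
    (learnProg lam η T z).val.2 i j = true ↔
      i < j ∧ ∃ a b, η / 2 ≤ |(learnProg lam η T z).val.1 i j a b| := by
  have h : (learnProg lam η T z).val.2 i j = if i < j then
      (List.finRange k).foldl (fun found a => (List.finRange k).foldl (fun found b =>
        found || decide (η / 2 ≤ |(learnProg lam η T z).val.1 i j a b|)) found) false else false := by
    have hG : ∀ W : Fin k → Fin k → ℝ, (if decide (i < j) = true then
        loop (List.finRange k) (fun a (found : Bool) =>
          loop (List.finRange k) (fun b (found : Bool) => do
            let v ← op |W a b|
            let big ← op (decide (η / 2 ≤ v))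
            op (found || big)) found) false
        else pure false).val = if i < j then
        (List.finRange k).foldl (fun found a => (List.finRange k).foldl (fun found b =>
          found || decide (η / 2 ≤ |W a b|)) found) false else false := fun W => by
      simp only [bind_val, op_val, loop_val, pure_val, ite_val, decide_eq_true_eq]
      split_ifs <;> rfl
    exact hG _
  rw [h]
  simp [foldl_or_eq]

/-- Regressions without samples keep the uniform start, whose rows are constant. Their centered
output vanishes, so skipping them agrees with the algorithm. -/
theorem center_eq_zero {i j : Fin n} (hj : j ≠ i) {w : Mat n k} (hw : ∀ b b', w j b = w j b')
    (b : Fin k) : center i w j b = 0 := by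
  have : (k : ℝ) ≠ 0 := by have := b.pos; positivity
  simp only [center, hj, if_false, fun b' => hw b' b, Finset.sum_const, Finset.card_univ,
    Fintype.card_fin, nsmul_eq_mul]
  field_simp
  ring

/-- The program carries out the learning algorithm. -/
theorem learnProg_isOutput (hn : 3 ≤ n) (hk : 0 < k) {lam η : ℝ} (hlam : 0 ≤ lam) {T : ℕ}
    (hT : 1 ≤ T) (z : Fin N → Fin n → Fin k) :
    IsOutput lam η T (fun m => 16 * Real.log n ^ 2 / 2 ^ m) z
      (learnProg lam η T z).val.1 (learnProg lam η T z).val.2 := by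
  have hl := one_lt_log hn
  have hR : 0 ≤ 2 * lam * √(k : ℝ) := by positivity
  -- For an empty regression the witness is the constant trajectory at the uniform start: the
  -- gradient is zero, so staying put is an exact update.
  refine ⟨⟨fun i α β => if (sampleList z i α β).isEmpty then (2 * lam * √(k : ℝ)) •
      ((1 / (T : ℝ)) • ∑ _t ∈ Finset.range T, uniformStart n k)
    else (descentProg (sampleList z i α β) z i α (2 * lam * √(k : ℝ)) T).val,
    fun i α β hαβ => ?_, fun i j hj α b => ?_⟩, learnProg_val_snd lam η T z⟩
  · dsimp only
    split_ifs with he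
    · have hem : restricted z i α β = ∅ := by
        rw [← toFinset_sampleList, List.isEmpty_iff.1 he, List.toFinset_nil]
      refine ⟨fun _ => uniformStart n k, rfl, fun t _ => ?_, rfl⟩
      refine IsApproxStep.isStep hn ⟨(groupNorm_uniformStart hn hk).le, fun u _ => ?_⟩
      have : mirrorGrad (uniformStart n k) - (mirrorGrad (uniformStart n k)
          - stepSize n (2 * lam * √(k : ℝ)) T • lossGrad (restricted z i α β)
            (fun m => feature i (z m)) (fun m => label i α (z m)) (2 * lam * √(k : ℝ))
            (uniformStart n k)) = 0 := by
        rw [hem]; simp [lossGrad]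
      rw [this]
      simp only [dot, Pi.zero_apply, zero_mul, Finset.sum_const_zero, neg_nonpos]
      positivity
    · obtain ⟨w, δ, h0, h1, h2, -, h3⟩ :=
        descentProg_spec hn hk (nodup_sampleList z i α β) z i α hR hT
      rw [toFinset_sampleList] at h1
      rw [length_sampleList] at h2
      refine ⟨w, h0, fun t ht => ?_, h3⟩
      have := (h1 t ht).isStep hn
      exact ⟨this.1, fun u hu => (this.2 u hu).trans (by linarith [h2 t ht])⟩
  · rw [learnProg_val_fst]
    congr 1
    refine Finset.sum_congr rfl fun β _ => ?_
    dsimp only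
    split_ifs
    · exact (center_eq_zero hj (fun b b' => by simp [uniformStart]) b).symm
    · rfl

end Programs

/-! ## Step counts -/

section Steps

@[simp] theorem pure_steps {α : Type} (a : α) : (pure a : Timed α).steps = 0 := rfl

@[simp] theorem bind_steps {α β : Type} (m : Timed α) (f : α → Timed β) :
    (m >>= f).steps = m.steps + (f m.val).steps := rfl

@[simp] theorem op_steps {α : Type} (a : α) : (op a).steps = 1 := rfl

theorem ite_steps_le {α : Type} {c : Prop} [Decidable c] {a b : Timed α} {B : ℕ} (ha : a.steps ≤ B)
    (hb : b.steps ≤ B) : (if c then a else b).steps ≤ B := by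
  split <;> assumption

/-- A bound depending on the index is needed because the cost of a regression is proportional to its
own number of samples. -/
theorem loop_steps_le_sum {ι α : Type} (l : List ι) {f : ι → α → Timed α} {B : ι → ℕ}
    (h : ∀ i a, (f i a).steps ≤ B i) (a : α) :
    (loop l f a).steps ≤ (l.map fun i => B i + 1).sum := by
  induction l generalizing a with
  | nil => simp [loop]
  | cons i l ih =>
    have h1 := h i a
    have h2 := ih (f i a).val
    simp only [loop, bind_steps, op_steps, op_val, List.map_cons, List.sum_cons]
    omega

theorem loop_steps_le {ι α : Type} (l : List ι) {f : ι → α → Timed α} {B : ℕ}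
    (h : ∀ i a, (f i a).steps ≤ B) (a : α) : (loop l f a).steps ≤ l.length * (B + 1) := by
  simpa using loop_steps_le_sum l h a

theorem sumLoop_steps_le {ι : Type} (l : List ι) {f : ι → Timed ℝ} {B : ℕ}
    (h : ∀ i, (f i).steps ≤ B) : (sumLoop l f).steps ≤ l.length * (B + 2) :=
  loop_steps_le l (B := B + 1) (fun i a => by simpa using h i) 0

theorem select_steps_le {ι : Type} (l : List ι) {p : ι → Timed Bool} {B : ℕ}
    (h : ∀ i, (p i).steps ≤ B) : (select l p).steps ≤ l.length * (B + 1) := by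
  induction l with
  | nil => simp [select]
  | cons i l ih =>
    have := h i
    simp only [select, bind_steps, op_steps, List.length_cons]
    nlinarith

theorem tabulate_steps_le {m : ℕ} {α : Type} {f : Fin m → Timed α} {B : ℕ}
    (h : ∀ i, (f i).steps ≤ B) : (tabulate f).steps ≤ m * (B + 1) := by
  calc (tabulate f).steps = ∑ i, ((f i).steps + 1) := rfl
    _ ≤ ∑ _i : Fin m, (B + 1) := Finset.sum_le_sum fun i _ => Nat.add_le_add_right (h i) 1
    _ = m * (B + 1) := by simp

theorem tabulate₂_steps_le {m l : ℕ} {α : Type} {f : Fin m → Fin l → Timed α} {B : ℕ}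
    (h : ∀ i j, (f i j).steps ≤ B) : (tabulate₂ f).steps ≤ m * (l * (B + 1) + 1) :=
  tabulate_steps_le fun i => tabulate_steps_le fun j => h i j

variable {n k N : ℕ}

theorem powProg_steps_le (x q : ℝ) : (powProg x q).steps ≤ 4 := by
  simp only [powProg, bind_steps, op_steps]
  have : (if (op (decide (0 < x))).val = true then do
      let l ← op (Real.log x)
      let m ← op (q * l)
      op (Real.exp m)
    else pure 0).steps ≤ 3 := ite_steps_le (by simp) (by simp)
  omega

theorem rowNormsProg_steps_le (w : Mat n k) : (rowNormsProg w).steps ≤ n * (3 * k + 2) := by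
  refine (tabulate_steps_le (B := 3 * k + 1) fun j => ?_).trans (le_of_eq (by ring))
  have := sumLoop_steps_le (List.finRange k) (f := fun b => op (w j b * w j b)) (B := 1)
    fun b => le_rfl
  simp only [List.length_finRange, bind_steps, op_steps] at this ⊢
  omega

theorem totalProg_steps_le (s : Fin n → ℝ) (c q ν : ℝ) : (totalProg s c q ν).steps ≤ 8 * n := by
  refine (sumLoop_steps_le (B := 6) _ fun j => ?_).trans (le_of_eq ?_)
  · have := powProg_steps_le ((s j - ν) / c) q
    simp only [bind_steps, op_steps, op_val]
    omega
  · rw [List.length_finRange]; ring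

/-- Each bisection evaluates one sum over the rows. With one bisection per sample, the search costs
no more than computing a gradient, up to a constant. -/
theorem thresholdProg_steps_le {ι : Type} (hn : 1 ≤ n) (S : List ι) (s : Fin n → ℝ) (c q : ℝ) :
    (thresholdProg S s c q).steps ≤ 12 * n * (S.length + 1) := by
  have h0 := totalProg_steps_le s c q 0
  have h1 := loop_steps_le (List.finRange n) (f := fun j m => op (max m (s j))) (B := 1)
    (fun _ _ => le_rfl) 0
  have h2 := loop_steps_le S (f := fun _ (I : ℝ × ℝ) => do
      let a ← op (I.1 + I.2)
      let mid ← op (a / 2)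
      let r ← totalProg s c q mid
      let ok ← op (decide (r ≤ 1))
      pure (if ok then (I.1, mid) else (mid, I.2))) (B := 8 * n + 3) (fun _ I => by
    have := totalProg_steps_le s c q ((I.1 + I.2) / 2)
    simp only [bind_steps, op_steps, op_val, pure_steps]
    omega) (0, ((loop (List.finRange n) (fun j m => op (max m (s j))) 0).val))
  rw [List.length_finRange] at h1
  rw [show 8 * n + 3 + 1 = 8 * n + 4 from rfl] at h2
  simp only [thresholdProg, bind_steps, op_steps]
  refine (Nat.add_le_add h0 (Nat.add_le_add_left (ite_steps_le (B := n * 2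
    + S.length * (8 * n + 4)) (by simp) ?_) 1)).trans ?_
  · simp only [bind_steps, pure_steps] at h1 h2 ⊢
    omega
  · have : S.length ≤ n * S.length := Nat.le_mul_of_pos_left _ hn
    nlinarith

theorem stepProg_steps_le {ι : Type} (hn : 1 ≤ n) (hk : 1 ≤ k) (S : List ι) (γ : ℝ) (g w : Mat n k) :
    (stepProg S γ g w).steps ≤ 50 * (n * k) * (S.length + 1) := by
  simp only [stepProg, bind_steps, op_steps, op_val]
  set w₁ := (rowNormsProg w).val
  set ξ := (tabulate₂ _ : Timed (Mat n k)).val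
  set s := (rowNormsProg ξ).val
  have h1 := rowNormsProg_steps_le w
  have h2 := rowNormsProg_steps_le ξ
  have h3 := thresholdProg_steps_le hn S s (Real.exp 1 * Real.log n) (Real.log n)
  have h4 : ∀ c ex : ℝ, (tabulate fun j => do
      let v ← powProg (w₁ j) ex
      op (c * v)).steps ≤ n * 6 := fun c ex => tabulate_steps_le fun j => by
    have := powProg_steps_le (w₁ j) ex
    simp only [bind_steps, op_steps]
    omega
  have h5 : ∀ h : Fin n → ℝ, (tabulate₂ fun j b => do
      let u ← op (h j * w j b)
      let v ← op (γ * g j b)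
      op (u - v)).steps ≤ n * (k * 4 + 1) := fun h => tabulate₂_steps_le fun j b => by simp
  have h6 : ∀ ν c q : ℝ, (tabulate fun j => do
      let d ← op (s j - ν)
      let d' ← op (d / c)
      let v ← powProg d' q
      op (v / s j)).steps ≤ n * 8 := fun ν c q => tabulate_steps_le fun j => by
    have := powProg_steps_le ((s j - ν) / c) q
    simp only [bind_steps, op_steps, op_val]
    omega
  have h7 : ∀ f : Fin n → ℝ, (tabulate₂ fun j b => op (f j * ξ j b)).steps ≤ n * (k * 2 + 1) :=
    fun f => tabulate₂_steps_le fun j b => by simp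
  refine (Nat.add_le_add_left (Nat.add_le_add_left (Nat.add_le_add_left (Nat.add_le_add_left
    (Nat.add_le_add_left (Nat.add_le_add h1 (Nat.add_le_add (h4 _ _) (Nat.add_le_add (h5 _)
    (Nat.add_le_add h2 (Nat.add_le_add h3 (Nat.add_le_add (h6 _ _ _) (h7 _))))))) _) _) _) _) _).trans
    ?_
  have e1 : n ≤ n * k := Nat.le_mul_of_pos_right _ hk
  have e2 : n * S.length ≤ n * k * S.length := Nat.mul_le_mul_right _ e1
  have e3 : 0 ≤ n * k * S.length := Nat.zero_le _
  nlinarith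

theorem featureProg_steps_le (i : Fin n) (z : Fin n → Fin k) (R : ℝ) (j : Fin n) (b : Fin k) :
    (featureProg i z R j b).steps ≤ 3 := by
  rw [featureProg, bind_steps]
  exact Nat.add_le_add_left (ite_steps_le (B := 2) (by simp) (by simp)) 1

theorem gradProg_steps_le (hn : 1 ≤ n) (hk : 1 ≤ k) (S : List (Fin N)) (z : Fin N → Fin n → Fin k)
    (i : Fin n) (α : Fin k) (R : ℝ) (w : Mat n k) :
    (gradProg S z i α R w).steps ≤ 28 * (n * k) * (S.length + 1) := by
  have e1 : n ≤ n * k := Nat.le_mul_of_pos_right _ hk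
  simp only [gradProg]
  rw [bind_steps, bind_steps, bind_steps]
  have h1 : (tabulate₂ fun (_ : Fin n) (_ : Fin k) => op (0 : ℝ)).steps ≤ n * (k * 2 + 1) :=
    tabulate₂_steps_le fun j b => by simp
  have h2 := sumLoop_steps_le S (f := fun _ => op (1 : ℝ)) (B := 1) fun _ => le_rfl
  have h4 : ∀ (g : Mat n k) (c : ℝ), (tabulate₂ fun j b => op (g j b / c)).steps
      ≤ n * (k * 2 + 1) := fun g c => tabulate₂_steps_le fun j b => by simp
  refine (Nat.add_le_add h1 (Nat.add_le_add h2 (Nat.add_le_add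
    (loop_steps_le (B := 24 * (n * k)) _ (fun m g => ?_) _) (h4 _ _)))).trans ?_
  · rw [bind_steps]
    have h5 : (sumLoop (List.finRange n) fun j => sumLoop (List.finRange k) fun b => do
        let x ← featureProg i (z m) R j b
        op (w j b * x)).steps ≤ n * (k * 6 + 2) := by
      refine (sumLoop_steps_le (B := k * 6) _ fun j => ?_).trans (by rw [List.length_finRange])
      refine (sumLoop_steps_le (B := 4) _ fun b => ?_).trans (by rw [List.length_finRange])
      have := featureProg_steps_le i (z m) R j b
      simp only [bind_steps, op_steps]
      omega
    have h6 : ∀ c : ℝ, (tabulate₂ fun j b => do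
        let x ← featureProg i (z m) R j b
        let v ← op (c * x)
        op (g j b + v)).steps ≤ n * (k * 6 + 1) := fun c => tabulate₂_steps_le fun j b => by
      have := featureProg_steps_le i (z m) R j b
      simp only [bind_steps, op_steps, op_val]
      omega
    refine (Nat.add_le_add h5 (b := _) (d := 8 + n * (k * 6 + 1)) ?_).trans ?_
    · simp only [bind_steps (op _), op_steps, op_val, ← Nat.add_assoc]
      exact Nat.add_le_add_left (h6 _) 8
    · nlinarith
  · have e2 : S.length ≤ n * k * S.length := Nat.le_mul_of_pos_left _ (Nat.mul_pos hn hk)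
    nlinarith

theorem descentProg_steps_le (hn : 1 ≤ n) (hk : 1 ≤ k) (S : List (Fin N))
    (z : Fin N → Fin n → Fin k) (i : Fin n) (α : Fin k) (R : ℝ) {T : ℕ} (hT : 1 ≤ T) :
    (descentProg S z i α R T).steps ≤ 110 * T * (n * k) * (S.length + 1) := by
  have e1 : n ≤ n * k := Nat.le_mul_of_pos_right _ hk
  have h1 : ∀ c : ℝ, (tabulate₂ fun (_ : Fin n) (_ : Fin k) => op c).steps ≤ n * (k * 2 + 1) :=
    fun c => tabulate₂_steps_le fun j b => by simp
  have h2 : ∀ st : Mat n k × Mat n k, (tabulate₂ fun j b => op (st.2 j b + st.1 j b)).steps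
      ≤ n * (k * 2 + 1) := fun st => tabulate₂_steps_le fun j b => by simp
  have h3 : ∀ g : Mat n k, (tabulate₂ fun j b => do
      let v ← op (g j b / T)
      op (R * v)).steps ≤ n * (k * 3 + 1) := fun g => tabulate₂_steps_le fun j b => by simp
  have h4 : ∀ γ : ℝ, ∀ a : Mat n k × Mat n k, (loop (List.range T)
      (fun _ (st : Mat n k × Mat n k) => do
        let sum ← tabulate₂ fun j b => op (st.2 j b + st.1 j b)
        let g ← gradProg S z i α R st.1
        let w ← stepProg S γ g st.1
        pure (w, sum)) a).steps ≤ T * (n * (k * 2 + 1) + (28 * (n * k) * (S.length + 1)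
          + 50 * (n * k) * (S.length + 1)) + 1) := by
    intro γ a
    refine (loop_steps_le _ (fun _ st => ?_) a).trans (by rw [List.length_range])
    have s1 := gradProg_steps_le hn hk S z i α R st.1
    have s2 := stepProg_steps_le hn hk S γ (gradProg S z i α R st.1).val st.1
    have s3 := h2 st
    simp only [bind_steps, pure_steps] at s1 s2 s3 ⊢
    omega
  have h5 : (descentProg S z i α R T).steps ≤ 10 + (n * (k * 2 + 1) + (n * (k * 2 + 1)
      + (T * (n * (k * 2 + 1) + (28 * (n * k) * (S.length + 1)
          + 50 * (n * k) * (S.length + 1)) + 1) + n * (k * 3 + 1)))) := by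
    simp only [descentProg, bind_steps (op _), op_steps, op_val]
    simp only [bind_steps (tabulate₂ _), bind_steps (loop _ _ _)]
    have h6 : ∀ x y : ℕ, x ≤ y →
        1 + (1 + (1 + (1 + (1 + (1 + (1 + (1 + (1 + (1 + x))))))))) ≤ 10 + y := by omega
    exact h6 _ _ (Nat.add_le_add (h1 _) (Nat.add_le_add (h1 _) (Nat.add_le_add (h4 _ _) (h3 _))))
  refine h5.trans ?_
  have e2 : 1 ≤ n * k := Nat.mul_pos hn hk
  have e3 : n * k ≤ T * (n * k) := Nat.le_mul_of_pos_left _ hT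
  have e4 : T * n ≤ T * (n * k) := Nat.mul_le_mul_left _ e1
  have e5 : T ≤ T * (n * k) := Nat.le_mul_of_pos_right _ e2
  have e6 : 0 ≤ T * (n * k) * S.length := Nat.zero_le _
  nlinarith

theorem centerProg_steps_le (hk : 1 ≤ k) (i : Fin n) (w : Mat n k) :
    (centerProg i w).steps ≤ 12 * (n * k) := by
  have e1 : n ≤ n * k := Nat.le_mul_of_pos_right _ hk
  rw [centerProg, bind_steps, bind_steps]
  have h1 : (tabulate fun j => do
      let s ← sumLoop (List.finRange k) fun a => op (w j a)
      op (s / k)).steps ≤ n * (k * 3 + 2) := tabulate_steps_le fun j => by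
    have := sumLoop_steps_le (List.finRange k) (f := fun a => op (w j a)) (B := 1) fun _ => le_rfl
    simp only [List.length_finRange, bind_steps, op_steps] at this ⊢
    omega
  have h2 : ∀ f : Fin n → ℝ, (sumLoop (List.finRange n) fun j => do
      let same ← op (decide (j = i))
      pure (if same then 0 else f j)).steps ≤ n * 3 := fun f =>
    (sumLoop_steps_le (B := 1) _ fun j => by simp).trans (by rw [List.length_finRange])
  have h3 : ∀ (f : Fin n → ℝ) (t : ℝ), (tabulate₂ fun j b => do
      let same ← op (decide (j = i))
      op (if same then w j b + t else w j b - f j)).steps ≤ n * (k * 3 + 1) :=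
    fun f t => tabulate₂_steps_le fun j b => by simp
  refine (Nat.add_le_add h1 (Nat.add_le_add (h2 _) (h3 _ _))).trans ?_
  nlinarith

/-- There is no additive term of order T n k: empty regressions are skipped, and for the others m +
1 ≤ 2m. Otherwise the k² pairs of symbols would cost T n k³ per variable, too much when N < k. -/
theorem regressionProg_steps_le (hn : 1 ≤ n) (hk : 1 ≤ k) (z : Fin N → Fin n → Fin k) (i : Fin n)
    (α : Fin k) (R : ℝ) {T : ℕ} (hT : 1 ≤ T) (hN : 1 ≤ N) (β : Fin k) (acc : Mat n k) :
    (regressionProg z i α R T β acc).steps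
      ≤ 6 * N + 240 * T * (n * k) * (restricted z i α β).card := by
  have e1 : n ≤ n * k := Nat.le_mul_of_pos_right _ hk
  rw [regressionProg, bind_steps, op_steps]
  refine (Nat.add_le_add_left (ite_steps_le (B := 4 * N + 1
    + 240 * T * (n * k) * (restricted z i α β).card) (by simp) ?_) 1).trans (by omega)
  rw [bind_steps, bind_steps, op_steps]
  have h1 : (select (List.finRange N) fun m => do
      let isα ← op (decide (z m i = α))
      let isβ ← op (decide (z m i = β))
      op (isα || isβ)).steps ≤ 4 * N :=
    (select_steps_le (B := 3) _ fun m => by simp).trans (by rw [List.length_finRange]; omega)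
  have h2 : (select (List.finRange N) fun m => do
      let isα ← op (decide (z m i = α))
      let isβ ← op (decide (z m i = β))
      op (isα || isβ)).val = sampleList z i α β := by
    rw [select_val]; rfl
  refine (Nat.add_le_add h1 (Nat.add_le_add_left (m := 240 * T * (n * k)
    * (restricted z i α β).card) ?_ 1)).trans (by omega)
  rw [h2, ← length_sampleList]
  by_cases h : (sampleList z i α β).isEmpty = true
  · rw [if_pos (by exact h)]; simp
  · rw [if_neg (by exact h), bind_steps, bind_steps]
    have hpos : 1 ≤ (sampleList z i α β).length := by
      rw [Nat.one_le_iff_ne_zero]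
      exact fun h0 => h (List.isEmpty_iff_length_eq_zero.2 h0)
    have h3 := descentProg_steps_le hn hk (sampleList z i α β) z i α R hT
    have h4 := centerProg_steps_le hk i (descentProg (sampleList z i α β) z i α R T).val
    have h5 : ∀ U : Mat n k, (tabulate₂ fun j b => op (acc j b + U j b)).steps
        ≤ n * (k * 2 + 1) := fun U => tabulate₂_steps_le fun j b => by simp
    refine (Nat.add_le_add h3 (Nat.add_le_add h4 (h5 _))).trans ?_
    have e3 : n * k ≤ T * (n * k) := Nat.le_mul_of_pos_left _ hT
    have e4 : T * (n * k) ≤ T * (n * k) * (sampleList z i α β).length :=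
      Nat.le_mul_of_pos_right _ hpos
    nlinarith

/-- The samples with z_i = α partition all N samples as α varies, so each sample is counted at most
2k times. This saves a factor k over bounding every regression by N. -/
theorem sum_card_restricted_le (z : Fin N → Fin n → Fin k) (i : Fin n) :
    ∑ α, ∑ β, (restricted z i α β).card ≤ 2 * (k * N) := by
  have h1 : ∑ α, (Finset.univ.filter fun m => z m i = α).card = N := by
    rw [← Finset.card_eq_sum_card_fiberwise (fun _ _ => Finset.mem_coe.2 (Finset.mem_univ _)),
      Finset.card_univ, Fintype.card_fin]
  calc ∑ α, ∑ β, (restricted z i α β).card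
      ≤ ∑ α, ∑ β, ((Finset.univ.filter fun m => z m i = α).card
          + (Finset.univ.filter fun m => z m i = β).card) := by
        refine Finset.sum_le_sum fun α _ => Finset.sum_le_sum fun β _ => ?_
        rw [restricted, Finset.filter_or]
        exact Finset.card_union_le _ _
    _ = 2 * (k * N) := by
        simp only [Finset.sum_add_distrib, Finset.sum_const, Finset.card_univ, Fintype.card_fin,
          smul_eq_mul, h1, ← Finset.mul_sum]
        ring

/-- The number of steps of the program. -/
theorem learnProg_steps_le (hn : 1 ≤ n) (hk : 1 ≤ k) (lam η : ℝ) {T : ℕ} (hT : 1 ≤ T) (hN : 1 ≤ N)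
    (z : Fin N → Fin n → Fin k) :
    (learnProg lam η T z).steps ≤ 600 * (T * N * n ^ 2 * k ^ 2) := by
  set R := 2 * lam * √(k : ℝ) with hR
  have hrow : ∀ i α, ((tabulate₂ fun (_ : Fin n) (_ : Fin k) => op (0 : ℝ)) >>= fun acc₀ =>
      loop (List.finRange k) (regressionProg z i α R T) acc₀ >>= fun acc =>
      tabulate₂ fun j b => op (acc j b / (k : ℝ))).steps + 1
      ≤ 7 * (n * k) + (7 * (k * N) + 240 * T * (n * k) * ∑ β, (restricted z i α β).card) := by
    intro i α
    rw [bind_steps, bind_steps]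
    have h1 : (tabulate₂ fun (_ : Fin n) (_ : Fin k) => op (0 : ℝ)).steps ≤ n * (k * 2 + 1) :=
      tabulate₂_steps_le fun j b => by simp
    have h2 : ∀ acc : Mat n k, (tabulate₂ fun j b => op (acc j b / (k : ℝ))).steps
        ≤ n * (k * 2 + 1) := fun acc => tabulate₂_steps_le fun j b => by simp
    have h3 : ∀ acc, (loop (List.finRange k) (regressionProg z i α R T) acc).steps
        ≤ 7 * (k * N) + 240 * T * (n * k) * ∑ β, (restricted z i α β).card := by
      intro acc
      refine (loop_steps_le_sum _ (fun β acc =>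
        regressionProg_steps_le hn hk z i α R hT hN β acc) acc).trans ?_
      rw [sum_map_finRange, Finset.mul_sum]
      simp only [Finset.sum_add_distrib, Finset.sum_const, Finset.card_univ, Fintype.card_fin,
        smul_eq_mul]
      nlinarith
    refine (Nat.add_le_add_right (Nat.add_le_add h1 (Nat.add_le_add (h3 _) (h2 _))) 1).trans ?_
    have e1 : n ≤ n * k := Nat.le_mul_of_pos_right _ hk
    nlinarith
  set P := T * N * n * k ^ 2 with hP
  have hvar : ∀ i, (((tabulate fun α => (tabulate₂ fun (_ : Fin n) (_ : Fin k) => op (0 : ℝ)) >>=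
      fun acc₀ => loop (List.finRange k) (regressionProg z i α R T) acc₀ >>= fun acc =>
      tabulate₂ fun j b => op (acc j b / (k : ℝ))) : Timed (Fin k → Mat n k)) >>= fun A =>
      tabulate fun j => tabulate₂ fun α b => op (A α j b)).steps ≤ 500 * P := by
    intro i
    rw [bind_steps]
    have h1 : ∀ A : Fin k → Mat n k, (tabulate fun j => tabulate₂ fun α b => op (A α j b)).steps
        ≤ n * (k * (k * 2 + 1) + 1) := fun A => tabulate_steps_le fun j =>
      tabulate₂_steps_le fun α b => by simp
    have h2 := Finset.sum_le_sum fun α (_ : α ∈ Finset.univ) => hrow i α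
    have h3 : ∑ α, (7 * (n * k) + (7 * (k * N) + 240 * T * (n * k) *
        ∑ β, (restricted z i α β).card)) ≤ k * (7 * (n * k)) + (k * (7 * (k * N))
          + 240 * T * (n * k) * (2 * (k * N))) := by
      rw [Finset.sum_add_distrib, Finset.sum_add_distrib, ← Finset.mul_sum Finset.univ
        (fun α => ∑ β, (restricted z i α β).card), Finset.sum_const,
        Finset.sum_const, Finset.card_univ, Fintype.card_fin, smul_eq_mul, smul_eq_mul]
      exact Nat.add_le_add_left (Nat.add_le_add_left
        (Nat.mul_le_mul_left _ (sum_card_restricted_le z i)) _) _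
    refine (Nat.add_le_add (h2.trans h3) (h1 _)).trans ?_
    have hTN : 1 ≤ T * N := Nat.mul_pos hT hN
    have hTn : 1 ≤ T * n := Nat.mul_pos hT hn
    have e1 : n * k ^ 2 ≤ P := by
      rw [hP, mul_assoc]; exact Nat.le_mul_of_pos_left _ hTN
    have e2 : N * k ^ 2 ≤ P := by
      calc N * k ^ 2 ≤ (T * n) * (N * k ^ 2) := Nat.le_mul_of_pos_left _ hTn
        _ = P := by rw [hP]; ring
    have e3 : k ≤ k ^ 2 := Nat.le_self_pow two_ne_zero k
    have e4 : n * k ≤ n * k ^ 2 := Nat.mul_le_mul_left _ e3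
    have e5 : n ≤ n * k := Nat.le_mul_of_pos_right _ hk
    -- The dominant term: all regressions of one variable together.
    have e6 : 240 * T * (n * k) * (2 * (k * N)) = 480 * P := by rw [hP]; ring
    rw [e6]
    nlinarith
  have hlearn : (learnProg lam η T z).steps ≤ 3 + (n * (500 * P + 1) + (1
      + n * (n * (1 + k * (k * 4 + 1) + 1) + 1))) := by
    have h1 := tabulate_steps_le hvar
    have h2 : ∀ (W : Fin n → Fin n → Fin k → Fin k → ℝ) (half : ℝ), (tabulate₂ fun i j => do
        let lt ← op (decide (i < j))
        if lt then
          loop (List.finRange k) (fun a (found : Bool) =>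
            loop (List.finRange k) (fun b (found : Bool) => do
              let v ← op |W i j a b|
              let big ← op (decide (half ≤ v))
              op (found || big)) found) false
        else pure false).steps ≤ n * (n * (1 + k * (k * 4 + 1) + 1) + 1) := by
      intro W half
      refine tabulate₂_steps_le fun i j => ?_
      rw [bind_steps, op_steps]
      refine Nat.add_le_add_left (ite_steps_le ?_ (by simp)) 1
      refine (loop_steps_le (B := k * 4) _ (fun a found => ?_) _).trans
        (by rw [List.length_finRange])
      exact (loop_steps_le (B := 3) _ (fun b found => by simp) _).trans
        (by rw [List.length_finRange])
    refine le_trans (le_of_eq ?_) (Nat.add_le_add_left (Nat.add_le_add h1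
      (Nat.add_le_add_left (h2 (learnProg lam η T z).val.1 (η / 2)) 1)) 3)
    simp only [learnProg]
    rw [bind_steps, bind_steps, bind_steps, bind_steps, bind_steps, bind_steps, op_steps, op_steps,
      op_steps, op_steps, pure_steps]
    rw [← Nat.add_assoc, ← Nat.add_assoc]
    rfl
  refine hlearn.trans ?_
  have hP2 : T * N * n ^ 2 * k ^ 2 = n * P := by rw [hP]; ring
  rw [hP2]
  have e0 : 1 ≤ P := Nat.mul_pos (Nat.mul_pos (Nat.mul_pos hT hN) hn) (pow_pos hk 2)
  have e1 : n * k ^ 2 ≤ P := by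
    rw [hP, mul_assoc]; exact Nat.le_mul_of_pos_left _ (Nat.mul_pos hT hN)
  have e2 : n * (n * k ^ 2) ≤ n * P := Nat.mul_le_mul_left _ e1
  have e3 : n * (n * k) ≤ n * (n * k ^ 2) :=
    Nat.mul_le_mul_left _ (Nat.mul_le_mul_left _ (Nat.le_self_pow two_ne_zero k))
  have e4 : n * n ≤ n * (n * k) := Nat.mul_le_mul_left _ (Nat.le_mul_of_pos_right _ hk)
  have e5 : n ≤ n * n := Nat.le_mul_of_pos_right _ hn
  have e6 : 1 ≤ n * P := Nat.mul_pos hn e0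
  nlinarith

end Steps

/-! ## Sparse approximation -/

section Sparse

variable {n k : ℕ}

theorem exists_le_of_weighted_sum_le {ι : Type*} [Fintype ι] {p f : ι → ℝ} {B : ℝ}
    (hp : ∀ a, 0 ≤ p a) (hp1 : ∑ a, p a = 1) (h : ∑ a, p a * f a ≤ B) : ∃ a, f a ≤ B := by
  by_contra! hc
  have h1 : ∑ a, p a * (f a - B) ≤ 0 := by
    simp only [mul_sub, Finset.sum_sub_distrib, ← Finset.sum_mul, hp1]
    linarith
  have h2 : ∀ a, 0 ≤ p a * (f a - B) := fun a => mul_nonneg (hp a) (by linarith [hc a])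
  have h3 := (Finset.sum_eq_zero_iff_of_nonneg fun a _ => h2 a).1
    (le_antisymm h1 (Finset.sum_nonneg fun a _ => h2 a))
  have h4 : ∑ a, p a = 0 := Finset.sum_eq_zero fun a ha => by
    rcases mul_eq_zero.1 (h3 a ha) with h | h
    · exact h
    · linarith [hc a]
  linarith

/-- The greedy form of Maurey's argument. -/
theorem exists_sum_sub_le {ι L : Type*} [Fintype ι] [Fintype L] {p : ι → ℝ} {a : ι → Mat n k}
    {w c : Mat n k} {μ : L → ℝ} {x : L → Mat n k} {B : ℝ} (hp : ∀ i, 0 ≤ p i)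
    (hp1 : ∑ i, p i = 1) (hw : ∑ i, p i • a i = w) (hμ : ∀ l, 0 ≤ μ l)
    (hB : ∑ l, μ l * ∑ i, p i * dot (a i) (x l) ^ 2 ≤ B) (κ : ℕ) :
    ∃ f : Fin κ → ι, dot c (∑ m, (a (f m) - w))
      + ∑ l, μ l * dot (∑ m, (a (f m) - w)) (x l) ^ 2 ≤ κ * B := by
  induction κ with
  | zero => exact ⟨Fin.elim0, by simp [dot]⟩
  | succ κ ih =>
    obtain ⟨f, hf⟩ := ih
    set u := ∑ m, (a (f m) - w) with hu
    have hmean : ∀ y : Mat n k, ∑ i, p i * dot (a i) y = dot w y := fun y => by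
      rw [← hw, dot_sum_left]
      exact Finset.sum_congr rfl fun i _ => (dot_smul_left _ _ _).symm
    -- The random atom has mean w, so on average the linear term does not change.
    have hlin : ∑ i, p i * dot c (u + (a i - w)) = dot c u := by
      have h : ∀ i, p i * dot c (u + (a i - w))
          = p i * (dot c u - dot w c) + p i * dot (a i) c := fun i => by
        rw [dot_add_right, dot_sub_right, dot_comm c (a i), dot_comm c w]; ring
      rw [Finset.sum_congr rfl fun i _ => h i, Finset.sum_add_distrib, ← Finset.sum_mul, hp1, hmean]
      ring
    -- The increment a_i - w has mean zero, so the cross term disappears and the variance is at most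
    -- the second moment.
    have hquad : ∀ l, ∑ i, p i * dot (u + (a i - w)) (x l) ^ 2
        ≤ dot u (x l) ^ 2 + ∑ i, p i * dot (a i) (x l) ^ 2 := by
      intro l
      have h : ∀ i, p i * dot (u + (a i - w)) (x l) ^ 2
          = p i * (dot u (x l) - dot w (x l)) ^ 2
            + 2 * (dot u (x l) - dot w (x l)) * (p i * dot (a i) (x l))
            + p i * dot (a i) (x l) ^ 2 := fun i => by
        rw [dot_add_left, dot_sub_left]; ring
      rw [Finset.sum_congr rfl fun i _ => h i, Finset.sum_add_distrib, Finset.sum_add_distrib,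
        ← Finset.sum_mul, hp1, ← Finset.mul_sum, hmean]
      nlinarith [sq_nonneg (dot w (x l))]
    obtain ⟨i, hi⟩ := exists_le_of_weighted_sum_le
      (f := fun i => dot c (u + (a i - w)) + ∑ l, μ l * dot (u + (a i - w)) (x l) ^ 2)
      (B := dot c u + ∑ l, μ l * dot u (x l) ^ 2 + B) hp hp1 (by
        simp only [mul_add, Finset.sum_add_distrib, hlin]
        have h1 : ∑ i, p i * ∑ l, μ l * dot (u + (a i - w)) (x l) ^ 2
            = ∑ l, μ l * ∑ i, p i * dot (u + (a i - w)) (x l) ^ 2 := by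
          simp only [Finset.mul_sum]
          rw [Finset.sum_comm]
          exact Finset.sum_congr rfl fun l _ => Finset.sum_congr rfl fun i _ => by ring
        rw [h1]
        have h2 := Finset.sum_le_sum fun l (_ : l ∈ Finset.univ) =>
          mul_le_mul_of_nonneg_left (hquad l) (hμ l)
        simp only [mul_add, Finset.sum_add_distrib] at h2
        linarith)
    refine ⟨Fin.snoc f i, ?_⟩
    have hsum : ∑ m, (a (Fin.snoc (α := fun _ => ι) f i m) - w) = u + (a i - w) := by
      rw [Fin.sum_univ_castSucc]
      simp [hu]
    rw [hsum]
    push_cast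
    linarith

/-- Labels of the atoms: the zero matrix, or an entry with an integer magnitude and a sign. -/
abbrev AtomIndex (n k : ℕ) := Option (Fin n × Fin k × Fin k × Bool)

/-- The atoms: signed multiples of the matrix units, with magnitudes `2 R, 4 R, …, 2 k R`. -/
noncomputable def atom (R : ℝ) : AtomIndex n k → Mat n k
  | none => 0
  | some (j, b, m, s) => fun j' b' =>
      if j' = j ∧ b' = b then (if s then 1 else -1) * (2 * R * ((m : ℕ) + 1)) else 0

/-- The average of a sequence of atoms. -/
noncomputable def atomAverage {κ : ℕ} (R : ℝ) (g : Fin κ → AtomIndex n k) : Mat n k :=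
  (1 / (κ : ℝ)) • ∑ m, atom R (g m)

theorem dot_atom (R : ℝ) (j : Fin n) (b m : Fin k) (s : Bool) (x : Mat n k) :
    dot (atom R (some (j, b, m, s))) x
      = (if s then 1 else -1) * (2 * R * ((m : ℕ) + 1)) * x j b := by
  have h : ∀ j' b', atom R (some (j, b, m, s)) j' b' * x j' b' = if j' = j then (if b' = b then
      (if s then 1 else -1) * (2 * R * ((m : ℕ) + 1)) * x j b else 0) else 0 := fun j' b' => by
    simp only [atom]
    by_cases h1 : j' = j <;> by_cases h2 : b' = b <;> simp [h1, h2]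
  simp only [dot, h]
  rw [Finset.sum_eq_single j (fun j' _ hj => by simp [hj]) (by simp)]
  simp

/-- An integer magnitude adapted to the size `t` of an entry relative to its row. -/
theorem exists_magnitude (hk : 0 < k) {t : ℝ} (ht0 : 0 ≤ t) (ht : t ≤ 1) :
    ∃ m : Fin k, t / ((m : ℕ) + 1) ≤ t ^ 2 + t / k ∧ t * ((m : ℕ) + 1) ≤ 2 := by
  have hk0 : (0 : ℝ) < k := by exact_mod_cast hk
  have hk1 : (1 : ℝ) ≤ k := by exact_mod_cast hk
  -- The ideal magnitude is 1/t; it is capped at k and rounded up to an integer so that only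
  -- finitely many atoms occur. Capping costs the t/k in the first bound, rounding the factor 2 in
  -- the second.
  set s := max t (1 / k) with hs
  have hs0 : 0 < s := lt_max_of_lt_right (by positivity)
  have hs1 : s ≤ 1 := max_le ht ((div_le_one hk0).2 hk1)
  have hts : t ≤ s := le_max_left _ _
  have hV0 : 0 < ⌈1 / s⌉₊ := Nat.ceil_pos.2 (by positivity)
  have hVk : ⌈1 / s⌉₊ ≤ k := by
    rw [Nat.ceil_le, div_le_iff₀ hs0]
    have := le_max_right t (1 / (k : ℝ))
    calc (1 : ℝ) = k * (1 / k) := by field_simp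
      _ ≤ k * s := mul_le_mul_of_nonneg_left this hk0.le
  have hcast : ((⌈1 / s⌉₊ - 1 : ℕ) : ℝ) + 1 = ⌈1 / s⌉₊ := by
    rw [← Nat.cast_add_one]; congr 1; omega
  refine ⟨⟨⌈1 / s⌉₊ - 1, by omega⟩, ?_, ?_⟩
  · simp only [hcast]
    have h1 : 1 / s ≤ ⌈1 / s⌉₊ := Nat.le_ceil _
    calc t / ⌈1 / s⌉₊ ≤ t / (1 / s) := div_le_div_of_nonneg_left ht0 (by positivity) h1
      _ = t * s := by field_simp
      _ ≤ t * (t + 1 / k) := mul_le_mul_of_nonneg_left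
          (max_le (by linarith [one_div_pos.2 hk0]) (by linarith)) ht0
      _ = t ^ 2 + t / k := by ring
  · simp only [hcast]
    have h1 : (⌈1 / s⌉₊ : ℝ) ≤ 1 / s + 1 := (Nat.ceil_lt_add_one (by positivity)).le
    calc t * ⌈1 / s⌉₊ ≤ s * (1 / s + 1) := mul_le_mul hts h1 (by positivity) hs0.le
      _ = 1 + s := by field_simp
      _ ≤ 2 := by linarith

/-- Every matrix of the ball of radius `R` of `‖·‖_{2,1}` is approximated by an average of `κ` atoms,
in quadratic mean with respect to any measure on matrices with rows in the unit ball. -/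
theorem exists_atomAverage_le (hk : 0 < k) {L : Type*} [Fintype L] {R : ℝ} (hR : 0 < R)
    {w : Mat n k} (hw : groupNorm 1 w ≤ R) (c : Mat n k) {μ : L → ℝ} (hμ : ∀ l, 0 ≤ μ l)
    {x : L → Mat n k} (hx : ∀ l j, rowNorm (x l) j ≤ 1) {κ : ℕ} (hκ : 0 < κ) :
    ∃ g : Fin κ → AtomIndex n k, dot c (atomAverage R g - w)
      + ∑ l, μ l * dot (atomAverage R g - w) (x l) ^ 2 ≤ 4 * R ^ 2 / κ * ∑ l, μ l := by
  have hk0 : (0 : ℝ) < k := by exact_mod_cast hk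
  have hratio : ∀ j b, |w j b| / rowNorm w j ≤ 1 := fun j b =>
    div_le_one_of_le₀ (abs_le_rowNorm w j b) (rowNorm_nonneg w j)
  choose m hm1 hm2 using fun j b => exists_magnitude hk
    (div_nonneg (abs_nonneg (w j b)) (rowNorm_nonneg w j)) (hratio j b)
  have hmul : ∀ j b, |w j b| / rowNorm w j * rowNorm w j = |w j b| := fun j b => by
    rcases (rowNorm_nonneg w j).eq_or_lt with h | h
    · rw [← h, eq_zero_of_rowNorm_eq_zero h.symm]; simp
    · rw [div_mul_cancel₀ _ h.ne']
  let V : Fin n → Fin k → ℝ := fun j b => ((m j b : ℕ) : ℝ) + 1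
  have hV : ∀ j b, 0 < V j b := fun j b => by positivity
  -- Probability of drawing the entry with magnitude 2RV, so that its mean contribution is the entry
  -- itself. As V is about ‖w_j‖/|w_jb|, the entry is drawn nearly in proportion to w_jb²/‖w_j‖.
  -- Sampling in proportion to |w_jb| alone would lose a dimension factor, since a row may have ℓ₁
  -- norm √k times its Euclidean norm.
  let P : Fin n × Fin k → ℝ := fun e => |w e.1 e.2| / (2 * R * V e.1 e.2)
  have hP : ∀ e, 0 ≤ P e := fun e => div_nonneg (abs_nonneg _) (by have := hV e.1 e.2; positivity)
  -- A row has total probability at most ‖w_j‖/R, the factor 2 in the magnitudes compensating for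
  -- the two terms of the magnitude bound. The remaining mass goes to the zero atom.
  have hPsum : ∑ e, P e ≤ 1 := by
    rw [Fintype.sum_prod_type]
    have hrow : ∀ j, ∑ b, P (j, b) ≤ rowNorm w j / R := by
      intro j
      have h1 : ∀ b, P (j, b) ≤ rowNorm w j / (2 * R)
          * ((|w j b| / rowNorm w j) ^ 2 + 1 / k) := by
        intro b
        have e : P (j, b) = rowNorm w j / (2 * R) * (|w j b| / rowNorm w j / V j b) := by
          simp only [P]
          rw [← hmul j b]
          have := hV j b
          field_simp
        rw [e]
        refine mul_le_mul_of_nonneg_left ((hm1 j b).trans ?_)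
          (div_nonneg (rowNorm_nonneg w j) (by positivity))
        have := div_le_div_of_nonneg_right (hratio j b) hk0.le
        linarith
      have h2 : ∑ b, (|w j b| / rowNorm w j) ^ 2 ≤ 1 := by
        simp only [div_pow, sq_abs, ← Finset.sum_div, ← rowNorm_sq]
        exact div_self_le_one _
      calc ∑ b, P (j, b) ≤ ∑ b, rowNorm w j / (2 * R) * ((|w j b| / rowNorm w j) ^ 2 + 1 / k) :=
            Finset.sum_le_sum fun b _ => h1 b
        _ = rowNorm w j / (2 * R) * (∑ b, (|w j b| / rowNorm w j) ^ 2 + 1) := by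
            rw [← Finset.mul_sum, Finset.sum_add_distrib]
            simp only [Finset.sum_const, Finset.card_univ, Fintype.card_fin, nsmul_eq_mul]
            field_simp
        _ ≤ rowNorm w j / (2 * R) * 2 := mul_le_mul_of_nonneg_left (by linarith)
            (div_nonneg (rowNorm_nonneg w j) (by positivity))
        _ = rowNorm w j / R := by field_simp
    refine (Finset.sum_le_sum fun j _ => hrow j).trans ?_
    rw [← Finset.sum_div, ← groupNorm_one, div_le_one hR]
    exact hw
  let φ : Option (Fin n × Fin k) → AtomIndex n k := fun e =>
    e.map fun e => (e.1, e.2, m e.1 e.2, decide (0 ≤ w e.1 e.2))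
  let p : Option (Fin n × Fin k) → ℝ := fun e => e.elim (1 - ∑ e, P e) P
  have hsign : ∀ j b, P (j, b) * ((if decide (0 ≤ w j b) = true then 1 else -1)
      * (2 * R * (((m j b : ℕ) : ℝ) + 1))) = w j b := fun j b => by
    have := hV j b
    simp only [P, V] at this ⊢
    by_cases h : 0 ≤ w j b
    · simp only [h, decide_true, if_true, abs_of_nonneg]; field_simp
    · simp only [h, decide_false, Bool.false_eq_true, if_false, abs_of_neg (not_le.1 h)]
      field_simp
  have hmean : ∑ e, p e • atom R (φ e) = w := by
    rw [Fintype.sum_option]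
    have h0 : atom R (φ none) = (0 : Mat n k) := rfl
    rw [h0, smul_zero, zero_add, Fintype.sum_prod_type]
    funext j b
    simp only [Finset.sum_apply, Pi.smul_apply, smul_eq_mul, p, φ, Option.elim_some,
      Option.map_some, atom]
    rw [Finset.sum_eq_single j (fun j' _ hj => by simp [Ne.symm hj]) (by simp),
      Finset.sum_eq_single b (fun b' _ hb => by simp [Ne.symm hb]) (by simp)]
    simp only [and_self, if_true]
    exact hsign j b
  -- An entry contributes 2R|w_jb| V x_jb² ≤ 4R‖w_j‖ x_jb²; summing over b uses only that the rows
  -- of x lie in the Euclidean unit ball.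
  have hsecond : ∀ l, ∑ e, p e * dot (atom R (φ e)) (x l) ^ 2 ≤ 4 * R ^ 2 := by
    intro l
    rw [Fintype.sum_option]
    have h0 : dot (atom R (φ none)) (x l) = 0 := by
      have : atom R (φ none) = (0 : Mat n k) := rfl
      simp [this, dot]
    rw [h0, zero_pow two_ne_zero, mul_zero, zero_add, Fintype.sum_prod_type]
    have hterm : ∀ j b, p (some (j, b)) * dot (atom R (φ (some (j, b)))) (x l) ^ 2
        ≤ 4 * R * rowNorm w j * x l j b ^ 2 := by
      intro j b
      simp only [p, φ, Option.elim_some, Option.map_some, dot_atom]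
      have hV' := hV j b
      have e : P (j, b) * ((if decide (0 ≤ w j b) = true then 1 else -1)
          * (2 * R * (((m j b : ℕ) : ℝ) + 1)) * x l j b) ^ 2
          = 2 * R * (|w j b| * V j b) * x l j b ^ 2 := by
        have hs2 : (if decide (0 ≤ w j b) = true then (1 : ℝ) else -1) ^ 2 = 1 := by
          split_ifs <;> norm_num
        rw [mul_pow, mul_pow, hs2]
        simp only [P, V] at hV' ⊢
        field_simp
      rw [e]
      refine mul_le_mul_of_nonneg_right ?_ (sq_nonneg _)
      have h1 := mul_le_mul_of_nonneg_right (hm2 j b) (rowNorm_nonneg w j)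
      have h2 : |w j b| * V j b ≤ 2 * rowNorm w j := by
        rw [← hmul j b]
        refine le_trans (le_of_eq ?_) h1
        simp only [V]; ring
      nlinarith
    calc _ ≤ ∑ j, ∑ b, 4 * R * rowNorm w j * x l j b ^ 2 :=
          Finset.sum_le_sum fun j _ => Finset.sum_le_sum fun b _ => hterm j b
      _ = ∑ j, 4 * R * rowNorm w j * rowNorm (x l) j ^ 2 :=
          Finset.sum_congr rfl fun j _ => by rw [← Finset.mul_sum, rowNorm_sq]
      _ ≤ ∑ j, 4 * R * rowNorm w j := Finset.sum_le_sum fun j _ =>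
          mul_le_of_le_one_right (mul_nonneg (by positivity) (rowNorm_nonneg w j))
            (pow_le_one₀ (rowNorm_nonneg _ _) (hx l j))
      _ ≤ 4 * R ^ 2 := by
          rw [← Finset.mul_sum, ← groupNorm_one]
          nlinarith
  -- The sum of the increments is κ times the error of the average, so the quadratic part scales
  -- with κ². Multiplying c by κ gives the linear part the same factor.
  obtain ⟨f, hf⟩ := exists_sum_sub_le (c := (κ : ℝ) • c) (μ := μ) (x := x) (a := fun e => atom R (φ e))
    (B := 4 * R ^ 2 * ∑ l, μ l) (p := p) (w := w)
    (fun e => by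
      cases e with
      | none => exact sub_nonneg.2 hPsum
      | some e => exact hP e)
    (by rw [Fintype.sum_option]; simp only [p, Option.elim_none, Option.elim_some]; ring)
    hmean hμ (by
      rw [Finset.mul_sum]
      exact Finset.sum_le_sum fun l _ =>
        (mul_le_mul_of_nonneg_left (hsecond l) (hμ l)).trans (by linarith)) κ
  have hκ0 : (0 : ℝ) < κ := by exact_mod_cast hκ
  refine ⟨fun i => φ (f i), ?_⟩
  have hu : ∑ i, (atom R (φ (f i)) - w) = (κ : ℝ) • (atomAverage R (fun i => φ (f i)) - w) := by
    rw [Finset.sum_sub_distrib, smul_sub, atomAverage, smul_smul, mul_one_div_cancel hκ0.ne',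
      one_smul]
    simp only [Finset.sum_const, Finset.card_univ, Fintype.card_fin]
    congr 1
    exact (Nat.cast_smul_eq_nsmul ℝ κ w).symm
  rw [hu] at hf
  simp only [dot_smul_left, dot_smul_right] at hf
  set d := atomAverage R (fun i => φ (f i)) - w
  have e1 : ∑ l, μ l * (κ * dot d (x l)) ^ 2 = κ ^ 2 * ∑ l, μ l * dot d (x l) ^ 2 := by
    rw [Finset.mul_sum]; exact Finset.sum_congr rfl fun l _ => by ring
  rw [e1] at hf
  have e2 : 4 * R ^ 2 / κ * ∑ l, μ l = κ * (4 * R ^ 2 * ∑ l, μ l) / κ ^ 2 := by field_simp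
  rw [e2, le_div_iff₀ (by positivity)]
  linarith

end Sparse

/-! ## Probabilities of configurations -/

section Configurations

variable {n k : ℕ}

/-- Resampling one coordinate preserves sums over all configurations. -/
theorem sum_sum_update (j : Fin n) (φ : (Fin n → Fin k) → ℝ) :
    ∑ z : Fin n → Fin k, ∑ b, φ (Function.update z j b) = k * ∑ z, φ z := by
  have h : ∑ q : (Fin n → Fin k) × Fin k, φ (Function.update q.1 j q.2)
      = ∑ q : (Fin n → Fin k) × Fin k, φ q.1 := by
    refine Finset.sum_nbij' (fun q => (Function.update q.1 j q.2, q.1 j))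
      (fun q => (Function.update q.1 j q.2, q.1 j)) (by simp) (by simp) ?_ ?_ (by simp)
    · rintro ⟨z, b⟩ -; simp
    · rintro ⟨z, b⟩ -; simp
  rw [Fintype.sum_prod_type, Fintype.sum_prod_type] at h
  rw [h]
  simp [Finset.mul_sum]

namespace Model

variable (M : Model n k)

/-- The part of the energy that involves variable `i`. -/
noncomputable def localEnergy (i : Fin n) (a : Fin k) (z : Fin n → Fin k) : ℝ :=
  (∑ j ∈ Finset.univ.erase i, M.W i j a (z j)) + M.θ i a

/-- The part of the energy that does not involve variable `i`. -/
noncomputable def restEnergy (i : Fin n) (z : Fin n → Fin k) : ℝ :=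
  (∑ l ∈ Finset.univ.erase i, ∑ j ∈ Finset.univ.erase i, if l < j then M.W l j (z l) (z j) else 0)
    + ∑ l ∈ Finset.univ.erase i, M.θ l (z l)

/-- Every pair of variables occurs once in the energy, ordered by index; symmetry of the weights
allows all pairs containing i to be read from the side of i. -/
theorem weight_eq (i : Fin n) (z : Fin n → Fin k) :
    M.weight z = Real.exp (M.localEnergy i (z i) z + M.restEnergy i z) := by
  rw [weight]
  congr 1
  have h1 : ∀ l, ∑ j ∈ Finset.univ.filter (fun j => l < j), M.W l j (z l) (z j)
      = (if l < i then M.W l i (z l) (z i) else 0)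
        + ∑ j ∈ Finset.univ.erase i, if l < j then M.W l j (z l) (z j) else 0 := fun l => by
    rw [Finset.sum_filter, ← Finset.add_sum_erase _ _ (Finset.mem_univ i)]
  have h2 : ∑ l ∈ Finset.univ.erase i, (if l < i then M.W l i (z l) (z i) else 0)
      + ∑ j ∈ Finset.univ.erase i, (if i < j then M.W i j (z i) (z j) else 0)
      = ∑ j ∈ Finset.univ.erase i, M.W i j (z i) (z j) := by
    rw [← Finset.sum_add_distrib]
    refine Finset.sum_congr rfl fun j hj => ?_
    have hji := Finset.ne_of_mem_erase hj
    rcases lt_or_gt_of_ne hji with h | h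
    · rw [if_pos h, if_neg h.not_gt, add_zero, M.symm j i hji]
    · rw [if_pos h, if_neg h.not_gt, zero_add]
  rw [Finset.sum_congr rfl fun l _ => h1 l,
    ← Finset.add_sum_erase _ (fun l => (if l < i then M.W l i (z l) (z i) else 0)
      + ∑ j ∈ Finset.univ.erase i, if l < j then M.W l j (z l) (z j) else 0) (Finset.mem_univ i),
    ← Finset.add_sum_erase _ (fun i => M.θ i (z i)) (Finset.mem_univ i),
    Finset.sum_add_distrib, localEnergy, restEnergy, ← h2]
  simp only [lt_self_iff_false, if_false]
  ring

theorem localEnergy_update (i : Fin n) (a b : Fin k) (z : Fin n → Fin k) :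
    M.localEnergy i a (Function.update z i b) = M.localEnergy i a z := by
  rw [localEnergy, localEnergy]
  congr 1
  exact Finset.sum_congr rfl fun j hj => by
    rw [Function.update_of_ne (Finset.ne_of_mem_erase hj)]

theorem restEnergy_update (i : Fin n) (b : Fin k) (z : Fin n → Fin k) :
    M.restEnergy i (Function.update z i b) = M.restEnergy i z := by
  rw [restEnergy, restEnergy]
  congr 1
  · exact Finset.sum_congr rfl fun l hl => Finset.sum_congr rfl fun j hj => by
      rw [Function.update_of_ne (Finset.ne_of_mem_erase hj),
        Function.update_of_ne (Finset.ne_of_mem_erase hl)]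
  · exact Finset.sum_congr rfl fun l hl => by
      rw [Function.update_of_ne (Finset.ne_of_mem_erase hl)]

theorem weight_pos (z : Fin n → Fin k) : 0 < M.weight z := Real.exp_pos _

/-- The probability of a configuration. -/
noncomputable def prob (z : Fin n → Fin k) : ℝ := M.weight z / ∑ z', M.weight z'

theorem sum_weight_pos (hk : 0 < k) : 0 < ∑ z, M.weight z :=
  Finset.sum_pos (fun z _ => M.weight_pos z) ⟨fun _ => ⟨0, hk⟩, Finset.mem_univ _⟩

theorem prob_pos (hk : 0 < k) (z : Fin n → Fin k) : 0 < M.prob z :=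
  div_pos (M.weight_pos z) (M.sum_weight_pos hk)

theorem sum_prob (hk : 0 < k) : ∑ z, M.prob z = 1 := by
  simp only [prob, ← Finset.sum_div]
  exact div_self (M.sum_weight_pos hk).ne'

theorem prob_update_eq (i : Fin n) (a b : Fin k) (z : Fin n → Fin k) :
    M.prob (Function.update z i a)
      = Real.exp (M.localEnergy i a z - M.localEnergy i b z) * M.prob (Function.update z i b) := by
  rw [prob, prob, M.weight_eq i, M.weight_eq i (Function.update z i b)]
  simp only [Function.update_self, localEnergy_update, restEnergy_update]
  rw [← mul_div_assoc, ← Real.exp_add]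
  congr 2
  ring

theorem row_le_width (i : Fin n) (a : Fin k) :
    (∑ j ∈ Finset.univ.erase i, ⨆ b, |M.W i j a b|) + |M.θ i a| ≤ M.width := by
  rw [width]
  refine le_trans ?_ (le_ciSup (Set.finite_range _).bddAbove i)
  exact le_ciSup (f := fun a => (∑ j ∈ Finset.univ.erase i, ⨆ b, |M.W i j a b|) + |M.θ i a|)
    (Set.finite_range _).bddAbove a

theorem abs_W_le_iSup (i j : Fin n) (a b : Fin k) : |M.W i j a b| ≤ ⨆ b, |M.W i j a b| :=
  le_ciSup (f := fun b => |M.W i j a b|) (Set.finite_range _).bddAbove b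

theorem iSup_abs_W_nonneg (i j : Fin n) (a : Fin k) : 0 ≤ ⨆ b, |M.W i j a b| :=
  Real.iSup_nonneg fun _ => abs_nonneg _

theorem abs_W_le_width {i j : Fin n} (hij : i ≠ j) (a b : Fin k) : |M.W i j a b| ≤ M.width := by
  refine le_trans ?_ (M.row_le_width i a)
  have h := Finset.single_le_sum (f := fun j => ⨆ b, |M.W i j a b|)
    (fun j _ => M.iSup_abs_W_nonneg i j a) (Finset.mem_erase.2 ⟨hij.symm, Finset.mem_univ j⟩)
  linarith [M.abs_W_le_iSup i j a b, abs_nonneg (M.θ i a)]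

theorem abs_localEnergy_le (i : Fin n) (a : Fin k) (z : Fin n → Fin k) :
    |M.localEnergy i a z| ≤ M.width := by
  refine le_trans ?_ (M.row_le_width i a)
  rw [localEnergy]
  refine (abs_add_le _ _).trans (add_le_add_left ((Finset.abs_sum_le_sum_abs _ _).trans ?_) _)
  exact Finset.sum_le_sum fun j _ => M.abs_W_le_iSup i j a (z j)

theorem width_nonneg (hn : 0 < n) (hk : 0 < k) : 0 ≤ M.width :=
  (abs_nonneg _).trans (M.abs_localEnergy_le ⟨0, hn⟩ ⟨0, hk⟩ fun _ => ⟨0, hk⟩)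

theorem prob_le_update (hk : 0 < k) {lam : ℝ} (hlam : M.width ≤ lam) (j : Fin n) (b : Fin k)
    (z : Fin n → Fin k) : M.prob z ≤ Real.exp (2 * lam) * M.prob (Function.update z j b) := by
  have h := M.prob_update_eq j (z j) b z
  rw [Function.update_eq_self] at h
  rw [h]
  refine mul_le_mul_of_nonneg_right (Real.exp_le_exp.2 ?_) (M.prob_pos hk _).le
  have h1 := abs_le.1 (M.abs_localEnergy_le j (z j) z)
  have h2 := abs_le.1 (M.abs_localEnergy_le j b z)
  linarith

/-- Every conditional probability of a symbol is at least `e ^ (-2 λ) / k`. -/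
theorem sum_prob_update_le (hk : 0 < k) {lam : ℝ} (hlam : M.width ≤ lam) (j : Fin n)
    {φ : (Fin n → Fin k) → ℝ} (hφ : ∀ z, 0 ≤ φ z) :
    ∑ z, M.prob z * ∑ b, φ (Function.update z j b)
      ≤ k * Real.exp (2 * lam) * ∑ z, M.prob z * φ z := by
  calc ∑ z, M.prob z * ∑ b, φ (Function.update z j b)
      ≤ ∑ z, ∑ b, Real.exp (2 * lam)
          * (M.prob (Function.update z j b) * φ (Function.update z j b)) := by
        refine Finset.sum_le_sum fun z _ => ?_
        rw [Finset.mul_sum]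
        refine Finset.sum_le_sum fun b _ => ?_
        rw [← mul_assoc]
        exact mul_le_mul_of_nonneg_right (M.prob_le_update hk hlam j b z) (hφ _)
    _ = k * Real.exp (2 * lam) * ∑ z, M.prob z * φ z := by
        rw [sum_sum_update j fun z => Real.exp (2 * lam) * (M.prob z * φ z), ← Finset.mul_sum]
        ring

/-! ## The conditional logistic model -/

/-- The weights of the logistic regression of variable `i` between the symbols `α` and `β`. -/
noncomputable def trueWeight (i : Fin n) (α β : Fin k) : Mat n k := fun j b =>
  if j = i then (if (b : ℕ) = 0 then M.θ i α - M.θ i β else 0) else M.W i j α b - M.W i j β b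

end Model

theorem dot_feature (hk : 0 < k) (i : Fin n) (w : Mat n k) (z : Fin n → Fin k) :
    dot w (feature i z) = (∑ j ∈ Finset.univ.erase i, w j (z j)) + w i ⟨0, hk⟩ := by
  rw [dot, ← Finset.add_sum_erase _ _ (Finset.mem_univ i), add_comm]
  congr 1
  · refine Finset.sum_congr rfl fun j hj => ?_
    simp [feature, Finset.ne_of_mem_erase hj]
  · rw [Finset.sum_eq_single ⟨0, hk⟩ (fun b _ hb => ?_) (by simp)]
    · simp [feature]
    · have : (b : ℕ) ≠ 0 := fun h => hb (Fin.ext h)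
      simp [feature, this]

theorem feature_update (i : Fin n) (z : Fin n → Fin k) (a : Fin k) :
    feature i (Function.update z i a) = feature i z := by
  funext j b
  by_cases h : j = i
  · simp [feature, h]
  · simp [feature, h]

/-- Predictions determine only differences within a row: a constant added to row j can be offset in
the constant-feature row. This is why the output is centered. -/
theorem dot_feature_update {i j : Fin n} (hj : j ≠ i) (w : Mat n k) (z : Fin n → Fin k)
    (b b' : Fin k) :
    dot w (feature i (Function.update z j b)) - dot w (feature i (Function.update z j b'))
      = w j b - w j b' := by
  have hk : 0 < k := b.pos
  have hmem : j ∈ Finset.univ.erase i := Finset.mem_erase.2 ⟨hj, Finset.mem_univ j⟩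
  rw [dot_feature hk, dot_feature hk, ← Finset.add_sum_erase _ _ hmem,
    ← Finset.add_sum_erase (Finset.univ.erase i) (fun l => w l (Function.update z j b' l)) hmem]
  have h : ∑ l ∈ (Finset.univ.erase i).erase j, w l (Function.update z j b l)
      = ∑ l ∈ (Finset.univ.erase i).erase j, w l (Function.update z j b' l) :=
    Finset.sum_congr rfl fun l hl => by
      rw [Function.update_of_ne (Finset.ne_of_mem_erase hl),
        Function.update_of_ne (Finset.ne_of_mem_erase hl)]
  rw [h, Function.update_self, Function.update_self]
  ring

namespace Model

variable (M : Model n k)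

theorem dot_trueWeight (i : Fin n) (α β : Fin k) (z : Fin n → Fin k) :
    dot (M.trueWeight i α β) (feature i z) = M.localEnergy i α z - M.localEnergy i β z := by
  rw [dot_feature α.pos, localEnergy, localEnergy]
  have h : ∑ j ∈ Finset.univ.erase i, M.trueWeight i α β j (z j)
      = ∑ j ∈ Finset.univ.erase i, (M.W i j α (z j) - M.W i j β (z j)) :=
    Finset.sum_congr rfl fun j hj => by simp [trueWeight, Finset.ne_of_mem_erase hj]
  rw [h, Finset.sum_sub_distrib]
  simp only [trueWeight, if_true]
  ring

theorem abs_dot_trueWeight_le {lam : ℝ} (hlam : M.width ≤ lam) (i : Fin n) (α β : Fin k)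
    (z : Fin n → Fin k) : |dot (M.trueWeight i α β) (feature i z)| ≤ 2 * lam := by
  rw [dot_trueWeight]
  refine (abs_sub _ _).trans ?_
  linarith [M.abs_localEnergy_le i α z, M.abs_localEnergy_le i β z]

/-- The width controls maxima of rows, and passing to Euclidean norms costs √k. The external fields
sit in a single entry of row i. This fixes the radius used by the algorithm. -/
theorem groupNorm_trueWeight_le {lam : ℝ} (hlam : M.width ≤ lam) (i : Fin n) (α β : Fin k) :
    groupNorm 1 (M.trueWeight i α β) ≤ 2 * lam * √(k : ℝ) := by
  have hk : 0 < k := α.pos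
  have hk1 : 1 ≤ √(k : ℝ) := Real.one_le_sqrt.2 (by exact_mod_cast hk)
  have hoff : ∀ j ∈ Finset.univ.erase i, rowNorm (M.trueWeight i α β) j
      ≤ √(k : ℝ) * ((⨆ b, |M.W i j α b|) + ⨆ b, |M.W i j β b|) := by
    intro j hj
    set B := (⨆ b, |M.W i j α b|) + ⨆ b, |M.W i j β b| with hB
    have hB0 : 0 ≤ B := add_nonneg (M.iSup_abs_W_nonneg i j α) (M.iSup_abs_W_nonneg i j β)
    have hentry : ∀ b, M.trueWeight i α β j b ^ 2 ≤ B ^ 2 := fun b => by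
      rw [← sq_abs]
      refine pow_le_pow_left₀ (abs_nonneg _) ?_ 2
      simp only [trueWeight, Finset.ne_of_mem_erase hj, if_false]
      exact (abs_sub _ _).trans (add_le_add (M.abs_W_le_iSup i j α b) (M.abs_W_le_iSup i j β b))
    rw [rowNorm]
    calc √(∑ b, M.trueWeight i α β j b ^ 2) ≤ √(∑ _b : Fin k, B ^ 2) :=
          Real.sqrt_le_sqrt (Finset.sum_le_sum fun b _ => hentry b)
      _ = √(k : ℝ) * B := by
          rw [Finset.sum_const, Finset.card_univ, Fintype.card_fin, nsmul_eq_mul,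
            Real.sqrt_mul (by positivity), Real.sqrt_sq hB0]
  have hdiag : rowNorm (M.trueWeight i α β) i ≤ |M.θ i α| + |M.θ i β| := by
    have : ∀ b : Fin k, M.trueWeight i α β i b ^ 2
        = if b = ⟨0, hk⟩ then (M.θ i α - M.θ i β) ^ 2 else 0 := fun b => by
      by_cases h : (b : ℕ) = 0 <;> simp [trueWeight, h, Fin.ext_iff]
    rw [rowNorm]
    simp only [this, Finset.sum_ite_eq', Finset.mem_univ, if_true, Real.sqrt_sq_eq_abs]
    exact abs_sub _ _
  rw [groupNorm_one, ← Finset.add_sum_erase _ _ (Finset.mem_univ i)]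
  have h1 := Finset.sum_le_sum hoff
  rw [← Finset.mul_sum, Finset.sum_add_distrib] at h1
  have h2 := M.row_le_width i α
  have h3 := M.row_le_width i β
  have h4 : |M.θ i α| + |M.θ i β| ≤ √(k : ℝ) * (|M.θ i α| + |M.θ i β|) :=
    le_mul_of_one_le_left (by positivity) hk1
  have h5 := mul_le_mul_of_nonneg_left (add_le_add (h2.trans hlam) (h3.trans hlam))
    (Real.sqrt_nonneg (k : ℝ))
  linarith

theorem prob_update_sigmoid (i : Fin n) (α β : Fin k) (z : Fin n → Fin k) :
    M.prob (Function.update z i α)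
      = Real.sigmoid (dot (M.trueWeight i α β) (feature i z))
        * (M.prob (Function.update z i α) + M.prob (Function.update z i β)) := by
  rw [dot_trueWeight, M.prob_update_eq i β α z, Real.sigmoid_def, neg_sub]
  have := Real.exp_pos (M.localEnergy i β z - M.localEnergy i α z)
  field_simp

/-! ## Means over the configurations with variable `i` in `{α, β}` -/

/-- The mean of `φ` over the configurations in which variable `i` has one of the values `α`, `β`. -/
noncomputable def pairMean (i : Fin n) (α β : Fin k) (φ : (Fin n → Fin k) → ℝ) : ℝ :=
  ∑ z, M.prob z * if z i = α ∨ z i = β then φ z else 0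

theorem pairMean_mono (hk : 0 < k) {i : Fin n} {α β : Fin k} {φ ψ : (Fin n → Fin k) → ℝ}
    (h : ∀ z, φ z ≤ ψ z) : M.pairMean i α β φ ≤ M.pairMean i α β ψ := by
  refine Finset.sum_le_sum fun z _ => mul_le_mul_of_nonneg_left ?_ (M.prob_pos hk z).le
  split_ifs
  · exact h z
  · exact le_rfl

theorem pairMean_add (i : Fin n) (α β : Fin k) (φ ψ : (Fin n → Fin k) → ℝ) :
    M.pairMean i α β (fun z => φ z + ψ z) = M.pairMean i α β φ + M.pairMean i α β ψ := by
  rw [pairMean, pairMean, pairMean, ← Finset.sum_add_distrib]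
  refine Finset.sum_congr rfl fun z _ => ?_
  split_ifs <;> ring

theorem pairMean_mul (i : Fin n) (α β : Fin k) (r : ℝ) (φ : (Fin n → Fin k) → ℝ) :
    M.pairMean i α β (fun z => r * φ z) = r * M.pairMean i α β φ := by
  rw [pairMean, pairMean, Finset.mul_sum]
  refine Finset.sum_congr rfl fun z _ => ?_
  split_ifs <;> ring

theorem pairMean_const (i : Fin n) (α β : Fin k) (r : ℝ) :
    M.pairMean i α β (fun _ => r) = r * M.pairMean i α β fun _ => 1 := by
  rw [← pairMean_mul]; simp

theorem pairMean_nonneg (hk : 0 < k) {i : Fin n} {α β : Fin k} {φ : (Fin n → Fin k) → ℝ}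
    (h : ∀ z, 0 ≤ φ z) : 0 ≤ M.pairMean i α β φ := by
  refine Finset.sum_nonneg fun z _ => mul_nonneg (M.prob_pos hk z).le ?_
  split_ifs
  · exact h z
  · exact le_rfl

/-- Grouping the configurations by the values of the variables other than `i`. -/
theorem pairMean_eq {i : Fin n} {α β : Fin k} (hαβ : α ≠ β)
    (φ : (Fin n → Fin k) → ℝ) :
    k * M.pairMean i α β φ = ∑ z,
      (M.prob (Function.update z i α) * φ (Function.update z i α)
        + M.prob (Function.update z i β) * φ (Function.update z i β)) := by
  -- The factor k arises because the summand on the right no longer depends on z_i.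
  rw [pairMean, ← sum_sum_update i]
  refine Finset.sum_congr rfl fun z _ => ?_
  simp only [Function.update_self]
  have h : ∀ b, M.prob (Function.update z i b)
      * (if b = α ∨ b = β then φ (Function.update z i b) else 0)
      = (if b = α then M.prob (Function.update z i b) * φ (Function.update z i b) else 0)
        + if b = β then M.prob (Function.update z i b) * φ (Function.update z i b) else 0 := by
    intro b
    by_cases h1 : b = α
    · have : b ≠ β := fun h => hαβ (h1.symm.trans h)
      simp [h1, hαβ]
    · simp [h1]
  rw [Finset.sum_congr rfl fun b _ => h b, Finset.sum_add_distrib]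
  simp

theorem pairMean_one_ge (hk : 0 < k) {lam : ℝ} (hlam : M.width ≤ lam) (i : Fin n) (α β : Fin k) :
    1 ≤ k * Real.exp (2 * lam) * M.pairMean i α β fun _ => 1 := by
  have h := M.sum_prob_update_le hk hlam i
    (φ := fun z => if z i = α ∨ z i = β then 1 else 0) (fun z => by split_ifs <;> norm_num)
  refine le_trans ?_ h
  refine (M.sum_prob hk).ge.trans ?_
  refine Finset.sum_le_sum fun z _ => le_mul_of_one_le_right (M.prob_pos hk z).le ?_
  simp only [Function.update_self]
  calc (1 : ℝ) = if α = α ∨ α = β then 1 else 0 := by simp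
    _ ≤ _ := Finset.single_le_sum (f := fun b => if b = α ∨ b = β then (1 : ℝ) else 0)
      (fun b _ => by split_ifs <;> norm_num) (Finset.mem_univ α)

end Model

end Configurations

/-! ## Concentration -/

section Concentration

variable {n k : ℕ}

/-- The logistic loss of a single configuration in the regression of variable `i`. -/
noncomputable def pointLoss (i : Fin n) (α : Fin k) (w : Mat n k) (z : Fin n → Fin k) : ℝ :=
  softplus (dot w (feature i z)) - (label i α z + 1) / 2 * dot w (feature i z)

theorem exp_neg_softplus (s : ℝ) : Real.exp (-softplus s) = 1 - Real.sigmoid s := by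
  rw [softplus, Real.exp_neg, Real.exp_log (by positivity), ← Real.sigmoid_neg, Real.sigmoid_def,
    neg_neg]

theorem exp_sub_softplus (s : ℝ) : Real.exp (s - softplus s) = Real.sigmoid s := by
  have := Real.exp_pos s
  rw [softplus, Real.exp_sub, Real.exp_log (by positivity), Real.sigmoid_def, Real.exp_neg]
  field_simp
  ring

/-- The affinity of two Bernoulli distributions is bounded in terms of the difference of their
parameters. -/
theorem affinity_le {a a' b b' : ℝ} (h1 : a ^ 2 + a' ^ 2 = 1) (h2 : b ^ 2 + b' ^ 2 = 1) :
    a * b + a' * b' ≤ 1 - 1 / 2 * (a ^ 2 - b ^ 2) ^ 2 := by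
  -- Two unit vectors at angle φ: the affinity is cos φ and the second square is sin² φ. The
  -- difference of the parameters is ± sin φ times the sine of the sum of the two angles, so its
  -- square is at most 1 - cos² φ, which is at most 2(1 - cos φ).
  have hc : (a * b + a' * b') ^ 2 + (a' * b - a * b') ^ 2 = 1 := by
    calc _ = (a ^ 2 + a' ^ 2) * (b ^ 2 + b' ^ 2) := by ring
      _ = 1 := by rw [h1, h2, one_mul]
  have hs : (a' * b + a * b') ^ 2 ≤ 1 := by
    have : (a' * b + a * b') ^ 2 + (a' * b' - a * b) ^ 2 = (a ^ 2 + a' ^ 2) * (b ^ 2 + b' ^ 2) := by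
      ring
    rw [h1, h2] at this
    nlinarith [sq_nonneg (a' * b' - a * b)]
  have hd : a ^ 2 - b ^ 2 = -((a' * b - a * b') * (a' * b + a * b')) := by
    have e1 : a' ^ 2 = 1 - a ^ 2 := by linarith
    have e2 : b' ^ 2 = 1 - b ^ 2 := by linarith
    have : (a' * b - a * b') * (a' * b + a * b') = a' ^ 2 * b ^ 2 - a ^ 2 * b' ^ 2 := by ring
    rw [this, e1, e2]; ring
  have hd2 : (a ^ 2 - b ^ 2) ^ 2 ≤ (a' * b - a * b') ^ 2 := by
    rw [hd, neg_sq, mul_pow]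
    exact mul_le_of_le_one_right (sq_nonneg _) hs
  nlinarith [sq_nonneg (a * b + a' * b' - 1)]

namespace Model

variable (M : Model n k)

/-- The exponential moment of half the difference of two losses. -/
theorem pairMean_exp_le (hk : 0 < k) {i : Fin n} {α β : Fin k} (hαβ : α ≠ β) (v : Mat n k) :
    M.pairMean i α β (fun z => Real.exp
        (1 / 2 * (pointLoss i α (M.trueWeight i α β) z - pointLoss i α v z)))
      ≤ M.pairMean i α β (fun z => 1 - 1 / 2 * (Real.sigmoid (dot (M.trueWeight i α β) (feature i z))
          - Real.sigmoid (dot v (feature i z))) ^ 2) := by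
  have hk0 : (0 : ℝ) < k := by exact_mod_cast hk
  refine le_of_mul_le_mul_left ?_ hk0
  rw [M.pairMean_eq hαβ, M.pairMean_eq hαβ]
  refine Finset.sum_le_sum fun z _ => ?_
  have hβ : label i α (Function.update z i β) = -1 := by simp [label, hαβ.symm]
  have hα : label i α (Function.update z i α) = 1 := by simp [label]
  have h1 := M.prob_update_sigmoid i α β z
  have h2 : M.prob (Function.update z i β)
      = (1 - Real.sigmoid (dot (M.trueWeight i α β) (feature i z)))
        * (M.prob (Function.update z i α) + M.prob (Function.update z i β)) := by linarith
  simp only [pointLoss, feature_update, hα, hβ]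
  have hS : 0 ≤ M.prob (Function.update z i α) + M.prob (Function.update z i β) :=
    add_nonneg (M.prob_pos hk _).le (M.prob_pos hk _).le
  set S := M.prob (Function.update z i α) + M.prob (Function.update z i β)
  set s := dot (M.trueWeight i α β) (feature i z)
  set t := dot v (feature i z)
  -- The exponential of minus the loss is the predicted probability of the label, so these halved
  -- exponents are square roots of probabilities. Weighting the two labels by their true
  -- probabilities in `e1` and `e2` produces the two terms of the affinity.
  have hA : ∀ r : ℝ, Real.exp ((r - softplus r) / 2) ^ 2 = Real.sigmoid r := fun r => by
    rw [← exp_sub_softplus, ← Real.exp_nat_mul]; congr 1; push_cast; ring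
  have hB : ∀ r : ℝ, Real.exp (-softplus r / 2) ^ 2 = 1 - Real.sigmoid r := fun r => by
    rw [← exp_neg_softplus, ← Real.exp_nat_mul]; congr 1; push_cast; ring
  have haff := affinity_le (a := Real.exp ((s - softplus s) / 2))
    (a' := Real.exp (-softplus s / 2)) (b := Real.exp ((t - softplus t) / 2))
    (b' := Real.exp (-softplus t / 2)) (by rw [hA, hB]; ring) (by rw [hA, hB]; ring)
  rw [hA, hA] at haff
  have e1 : Real.sigmoid s * Real.exp (1 / 2 * (softplus s - (1 + 1) / 2 * s
      - (softplus t - (1 + 1) / 2 * t)))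
      = Real.exp ((s - softplus s) / 2) * Real.exp ((t - softplus t) / 2) := by
    rw [← exp_sub_softplus, ← Real.exp_add, ← Real.exp_add]; congr 1; ring
  have e2 : (1 - Real.sigmoid s) * Real.exp (1 / 2 * (softplus s - (-1 + 1) / 2 * s
      - (softplus t - (-1 + 1) / 2 * t)))
      = Real.exp (-softplus s / 2) * Real.exp (-softplus t / 2) := by
    rw [← exp_neg_softplus, ← Real.exp_add, ← Real.exp_add]; congr 1; ring
  rw [h1, h2]
  have := mul_le_mul_of_nonneg_right haff hS
  rw [← e1, ← e2] at this
  linarith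

theorem sum_prob_exp_ite (hk : 0 < k) (i : Fin n) (α β : Fin k) (f : (Fin n → Fin k) → ℝ) :
    ∑ z, M.prob z * Real.exp (if z i = α ∨ z i = β then f z else 0)
      = 1 - M.pairMean i α β (fun _ => 1) + M.pairMean i α β fun z => Real.exp (f z) := by
  rw [pairMean, pairMean, ← M.sum_prob hk, ← Finset.sum_sub_distrib, ← Finset.sum_add_distrib]
  refine Finset.sum_congr rfl fun z _ => ?_
  split_ifs
  · rw [M.sum_prob hk]; ring
  · rw [Real.exp_zero]; ring

theorem isProbabilityMeasure_law (hk : 0 < k) : IsProbabilityMeasure M.law := by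
  refine ⟨?_⟩
  rw [law, Measure.finsetSum_apply]
  simp only [Measure.smul_apply, measure_univ, smul_eq_mul, mul_one]
  change ∑ z, ENNReal.ofReal (M.prob z) = 1
  rw [← ENNReal.ofReal_sum_of_nonneg fun z _ => (M.prob_pos hk z).le, M.sum_prob hk,
    ENNReal.ofReal_one]

theorem integral_law (hk : 0 < k) (f : (Fin n → Fin k) → ℝ) :
    ∫ z, f z ∂M.law = ∑ z, M.prob z * f z := by
  rw [law, integral_finsetSum_measure]
  · refine Finset.sum_congr rfl fun z _ => ?_
    rw [integral_smul_measure, integral_dirac]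
    change (ENNReal.ofReal (M.prob z)).toReal * f z = _
    rw [ENNReal.toReal_ofReal (M.prob_pos hk z).le]
  · intro z _
    exact Integrable.smul_measure (integrable_dirac (by simp)) ENNReal.ofReal_ne_top

theorem isProbabilityMeasure_samples (hk : 0 < k) (N : ℕ) :
    IsProbabilityMeasure (M.samples N) := by
  have := M.isProbabilityMeasure_law hk
  rw [samples]
  infer_instance

/-- The exponential Markov inequality for i.i.d. samples. -/
theorem samples_sum_ge_le (hk : 0 < k) (N : ℕ) {f : (Fin n → Fin k) → ℝ} {L : ℝ}
    (h : ∑ z, M.prob z * Real.exp (f z) ≤ Real.exp L) (t : ℝ) :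
    M.samples N {z | t ≤ ∑ m, f (z m)} ≤ ENNReal.ofReal (Real.exp (N * L - t)) := by
  have := M.isProbabilityMeasure_law hk
  have := M.isProbabilityMeasure_samples hk N
  have hmgf : ∫ z, Real.exp (∑ m, f (z m)) ∂M.samples N
      = (∑ z, M.prob z * Real.exp (f z)) ^ N := by
    have h1 : ∀ z : Fin N → Fin n → Fin k, Real.exp (∑ m, f (z m)) = ∏ m, Real.exp (f (z m)) :=
      fun z => Real.exp_sum _ _
    simp only [h1]
    rw [samples, integral_fintype_prod_eq_prod (fun (_ : Fin N) z => Real.exp (f z))]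
    simp only [M.integral_law hk, Finset.prod_const, Finset.card_univ, Fintype.card_fin]
  have hmarkov := ProbabilityTheory.measure_ge_le_exp_mul_mgf (μ := M.samples N)
    (X := fun z => ∑ m, f (z m)) t zero_le_one Integrable.of_finite
  rw [ProbabilityTheory.mgf] at hmarkov
  simp only [one_mul, hmgf] at hmarkov
  rw [← ofReal_measureReal]
  refine ENNReal.ofReal_le_ofReal (hmarkov.trans ?_)
  have h0 : 0 ≤ ∑ z, M.prob z * Real.exp (f z) :=
    Finset.sum_nonneg fun z _ => mul_nonneg (M.prob_pos hk z).le (Real.exp_pos _).le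
  calc Real.exp (-1 * t) * (∑ z, M.prob z * Real.exp (f z)) ^ N
      ≤ Real.exp (-1 * t) * Real.exp L ^ N :=
        mul_le_mul_of_nonneg_left (pow_le_pow_left₀ h0 h N) (Real.exp_pos _).le
    _ = Real.exp (N * L - t) := by
        rw [← Real.exp_nat_mul, ← Real.exp_add]; congr 1; ring

/-- The mean squared difference of the conditional probabilities given by two weight matrices. -/
noncomputable def predictionGap (i : Fin n) (α β : Fin k) (u v : Mat n k) : ℝ :=
  M.pairMean i α β fun z =>
    (Real.sigmoid (dot u (feature i z)) - Real.sigmoid (dot v (feature i z))) ^ 2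

theorem totalLoss_eq {N : ℕ} (z : Fin N → Fin n → Fin k) (i : Fin n) (α β : Fin k) (w : Mat n k) :
    totalLoss (restricted z i α β) (fun m => feature i (z m)) (fun m => label i α (z m)) w
      = ∑ m, if z m i = α ∨ z m i = β then pointLoss i α w (z m) else 0 := by
  rw [totalLoss, restricted, Finset.sum_filter]
  rfl

/-- The samples for which all regressions behave as expected. -/
def IsTypical (R : ℝ) (κ : ℕ) (t : ℝ) {N : ℕ} (z : Fin N → Fin n → Fin k) : Prop :=
  ∀ (i : Fin n) (α β : Fin k), α ≠ β →
    ((restricted z i α β).card : ℝ) ≤ 3 * (N * M.pairMean i α β fun _ => 1) ∧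
    1 / 4 * (N * M.pairMean i α β fun _ => 1) ≤ (restricted z i α β).card ∧
    ∀ g : Fin κ → AtomIndex n k,
      1 / 2 * (totalLoss (restricted z i α β) (fun m => feature i (z m)) (fun m => label i α (z m))
          (M.trueWeight i α β)
        - totalLoss (restricted z i α β) (fun m => feature i (z m)) (fun m => label i α (z m))
          (atomAverage R g))
      + N * (1 / 2 * M.predictionGap i α β (M.trueWeight i α β) (atomAverage R g)) ≤ t

/-- Samples with other values of z_i contribute a factor 1 to the exponential moment, which is thus
at most 1 - E/2 ≤ e^(-E/2), where E is the prediction gap. Markov's inequality needs no bound on the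
losses and yields a deviation of order 1/N. -/
theorem samples_loss_le (hk : 0 < k) (N : ℕ) {i : Fin n} {α β : Fin k} (hαβ : α ≠ β) (v : Mat n k)
    (t : ℝ) :
    M.samples N {z | t < 1 / 2 * (totalLoss (restricted z i α β) (fun m => feature i (z m))
          (fun m => label i α (z m)) (M.trueWeight i α β)
        - totalLoss (restricted z i α β) (fun m => feature i (z m)) (fun m => label i α (z m)) v)
      + N * (1 / 2 * M.predictionGap i α β (M.trueWeight i α β) v)}
      ≤ ENNReal.ofReal (Real.exp (-t)) := by
  set E := M.predictionGap i α β (M.trueWeight i α β) v with hE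
  have hexp : ∑ z, M.prob z * Real.exp (if z i = α ∨ z i = β then
      1 / 2 * (pointLoss i α (M.trueWeight i α β) z - pointLoss i α v z) else 0)
      ≤ Real.exp (-(1 / 2 * E)) := by
    rw [M.sum_prob_exp_ite hk]
    have h1 := M.pairMean_exp_le hk hαβ (i := i) v
    have h2 : M.pairMean i α β (fun z => 1 - 1 / 2 * (Real.sigmoid
        (dot (M.trueWeight i α β) (feature i z)) - Real.sigmoid (dot v (feature i z))) ^ 2)
        = M.pairMean i α β (fun _ => 1) - 1 / 2 * E := by
      have h3 := M.pairMean_add i α β (fun _ => 1) (fun z => (-(1 / 2)) * (Real.sigmoid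
        (dot (M.trueWeight i α β) (feature i z)) - Real.sigmoid (dot v (feature i z))) ^ 2)
      rw [M.pairMean_mul] at h3
      rw [hE, predictionGap, sub_eq_add_neg, ← neg_mul, ← h3]
      congr 1
      funext z
      ring
    have h4 := Real.add_one_le_exp (-(1 / 2 * E))
    linarith
  refine le_trans (measure_mono fun z hz => ?_)
    ((M.samples_sum_ge_le hk N hexp (t - N * (1 / 2 * E))).trans (le_of_eq ?_))
  · simp only [Set.mem_ofPred_eq, totalLoss_eq] at hz ⊢
    rw [← Finset.sum_sub_distrib, Finset.mul_sum] at hz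
    have : ∀ m, (1 / 2 * ((if z m i = α ∨ z m i = β then pointLoss i α (M.trueWeight i α β) (z m)
        else 0) - if z m i = α ∨ z m i = β then pointLoss i α v (z m) else 0))
        = if z m i = α ∨ z m i = β then
          1 / 2 * (pointLoss i α (M.trueWeight i α β) (z m) - pointLoss i α v (z m)) else 0 :=
      fun m => by split_ifs <;> ring
    simp only [this] at hz
    linarith
  · congr 2; ring

theorem card_restricted_eq {N : ℕ} (z : Fin N → Fin n → Fin k) (i : Fin n) (α β : Fin k) (r : ℝ) :
    ∑ m, (if z m i = α ∨ z m i = β then r else 0) = r * (restricted z i α β).card := by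
  rw [restricted, ← Finset.sum_filter, Finset.sum_const, nsmul_eq_mul, mul_comm]

theorem samples_card_gt_le (hk : 0 < k) (N : ℕ) (i : Fin n) (α β : Fin k) :
    M.samples N {z | 3 * (N * M.pairMean i α β fun _ => 1) < (restricted z i α β).card}
      ≤ ENNReal.ofReal (Real.exp (-(1 / 4 * (N * M.pairMean i α β fun _ => 1)))) := by
  set q := M.pairMean i α β fun _ => 1 with hq
  have hq0 : 0 ≤ q := M.pairMean_nonneg hk fun _ => zero_le_one
  have hexp : ∑ z, M.prob z * Real.exp (if z i = α ∨ z i = β then 1 else 0)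
      ≤ Real.exp (q * (Real.exp 1 - 1)) := by
    rw [M.sum_prob_exp_ite hk i α β fun _ => 1, M.pairMean_const i α β (Real.exp 1), ← hq]
    have := Real.add_one_le_exp (q * (Real.exp 1 - 1))
    linarith
  refine le_trans (measure_mono fun z hz => ?_)
    ((M.samples_sum_ge_le hk N hexp (3 * (N * q))).trans (ENNReal.ofReal_le_ofReal
      (Real.exp_le_exp.2 ?_)))
  · simp only [Set.mem_ofPred_eq] at hz ⊢
    rw [card_restricted_eq]
    linarith
  -- The exponent is Nq(e - 1 - 3), comfortably below -Nq/4.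
  · have h1 := Real.exp_one_lt_d9
    have h2 : 0 ≤ N * q := by positivity
    nlinarith

theorem samples_card_lt_le (hk : 0 < k) (N : ℕ) (i : Fin n) (α β : Fin k) :
    M.samples N {z | (restricted z i α β).card < 1 / 4 * (N * M.pairMean i α β fun _ => 1)}
      ≤ ENNReal.ofReal (Real.exp (-(1 / 4 * (N * M.pairMean i α β fun _ => 1)))) := by
  set q := M.pairMean i α β fun _ => 1 with hq
  have hq0 : 0 ≤ q := M.pairMean_nonneg hk fun _ => zero_le_one
  have hexp : ∑ z, M.prob z * Real.exp (if z i = α ∨ z i = β then -1 else 0)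
      ≤ Real.exp (q * (Real.exp (-1) - 1)) := by
    rw [M.sum_prob_exp_ite hk i α β fun _ => -1, M.pairMean_const i α β (Real.exp (-1)), ← hq]
    have := Real.add_one_le_exp (q * (Real.exp (-1) - 1))
    linarith
  refine le_trans (measure_mono fun z hz => ?_)
    ((M.samples_sum_ge_le hk N hexp (-(1 / 4 * (N * q)))).trans (ENNReal.ofReal_le_ofReal
      (Real.exp_le_exp.2 ?_)))
  · simp only [Set.mem_ofPred_eq] at hz ⊢
    rw [card_restricted_eq]
    linarith
  · have h1 : Real.exp (-1) ≤ 1 / 2 := by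
      rw [Real.exp_neg, inv_eq_one_div]
      exact one_div_le_one_div_of_le (by norm_num) (by linarith [Real.exp_one_gt_d9])
    have h2 : 0 ≤ N * q := by positivity
    nlinarith

/-- Union bound over n k² regressions and over all sequences of κ out of 2nk² + 1 atoms; the two
count estimates are brought to the same form by the lower bound on the probability of each pair of
symbols. -/
theorem samples_not_isTypical_le (hk : 0 < k) {lam : ℝ} (hlam : M.width ≤ lam) (N : ℕ) (R : ℝ)
    (κ : ℕ) (t : ℝ) :
    M.samples N {z | ¬ M.IsTypical R κ t z} ≤ ENNReal.ofReal ((n * k ^ 2 : ℕ)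
      * (((2 * n * k ^ 2 + 1) ^ κ : ℕ) * Real.exp (-t)
        + 2 * Real.exp (-(1 / 4 * (N * (k * Real.exp (2 * lam))⁻¹))))) := by
  have hk0 : (0 : ℝ) < k := by exact_mod_cast hk
  set D := Real.exp (-(1 / 4 * (N * (k * Real.exp (2 * lam))⁻¹))) with hD
  have hqD : ∀ i α β, Real.exp (-(1 / 4 * (N * M.pairMean i α β fun _ => 1))) ≤ D := by
    intro i α β
    have h1 := M.pairMean_one_ge hk hlam i α β
    have h2 : (k * Real.exp (2 * lam))⁻¹ ≤ M.pairMean i α β fun _ => 1 := by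
      rw [inv_le_iff_one_le_mul₀ (by positivity)]
      linarith
    refine Real.exp_le_exp.2 ?_
    have := mul_le_mul_of_nonneg_left h2 (Nat.cast_nonneg (α := ℝ) N)
    linarith
  let bad : Fin n × Fin k × Fin k → Set (Fin N → Fin n → Fin k) := fun e =>
    {z | e.2.1 ≠ e.2.2 ∧ ¬ (((restricted z e.1 e.2.1 e.2.2).card : ℝ)
        ≤ 3 * (N * M.pairMean e.1 e.2.1 e.2.2 fun _ => 1) ∧
      1 / 4 * (N * M.pairMean e.1 e.2.1 e.2.2 fun _ => 1) ≤ (restricted z e.1 e.2.1 e.2.2).card ∧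
      ∀ g : Fin κ → AtomIndex n k,
        1 / 2 * (totalLoss (restricted z e.1 e.2.1 e.2.2) (fun m => feature e.1 (z m))
            (fun m => label e.1 e.2.1 (z m)) (M.trueWeight e.1 e.2.1 e.2.2)
          - totalLoss (restricted z e.1 e.2.1 e.2.2) (fun m => feature e.1 (z m))
            (fun m => label e.1 e.2.1 (z m)) (atomAverage R g))
        + N * (1 / 2 * M.predictionGap e.1 e.2.1 e.2.2 (M.trueWeight e.1 e.2.1 e.2.2)
          (atomAverage R g)) ≤ t)}
  have hsub : {z | ¬ M.IsTypical R κ t z} ⊆ ⋃ e, bad e := by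
    intro z hz
    simp only [Set.mem_ofPred_eq, IsTypical, not_forall] at hz
    obtain ⟨i, α, β, hαβ, h⟩ := hz
    exact Set.mem_iUnion.2 ⟨(i, α, β), hαβ, h⟩
  have hbad : ∀ e, M.samples N (bad e) ≤ ENNReal.ofReal
      (((2 * n * k ^ 2 + 1) ^ κ : ℕ) * Real.exp (-t) + 2 * D) := by
    rintro ⟨i, α, β⟩
    by_cases hαβ : α = β
    · have : bad (i, α, β) = ∅ := by
        ext z; simp [bad, hαβ]
      rw [this, measure_empty]; exact zero_le
    have hcover : bad (i, α, β) ⊆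
        {z | 3 * (N * M.pairMean i α β fun _ => 1) < (restricted z i α β).card} ∪
        ({z | (restricted z i α β).card < 1 / 4 * (N * M.pairMean i α β fun _ => 1)} ∪
        ⋃ g : Fin κ → AtomIndex n k, {z | t < 1 / 2 * (totalLoss (restricted z i α β)
          (fun m => feature i (z m)) (fun m => label i α (z m)) (M.trueWeight i α β)
        - totalLoss (restricted z i α β) (fun m => feature i (z m)) (fun m => label i α (z m))
          (atomAverage R g))
      + N * (1 / 2 * M.predictionGap i α β (M.trueWeight i α β) (atomAverage R g))}) := by
      rintro z ⟨-, hz⟩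
      by_contra hc
      simp only [Set.mem_union, Set.mem_iUnion, Set.mem_ofPred_eq, not_or, not_exists, not_lt] at hc
      exact hz ⟨hc.1, hc.2.1, hc.2.2⟩
    refine (measure_mono hcover).trans ((measure_union_le _ _).trans ?_)
    have h3 : M.samples N (⋃ g : Fin κ → AtomIndex n k, {z | t < 1 / 2 * (totalLoss
          (restricted z i α β) (fun m => feature i (z m)) (fun m => label i α (z m))
          (M.trueWeight i α β)
        - totalLoss (restricted z i α β) (fun m => feature i (z m)) (fun m => label i α (z m))
          (atomAverage R g))
      + N * (1 / 2 * M.predictionGap i α β (M.trueWeight i α β) (atomAverage R g))})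
        ≤ ENNReal.ofReal (((2 * n * k ^ 2 + 1) ^ κ : ℕ) * Real.exp (-t)) := by
      refine (measure_iUnion_fintype_le _ _).trans ((Finset.sum_le_sum fun g _ =>
        M.samples_loss_le hk N hαβ (atomAverage R g) t).trans (le_of_eq ?_))
      rw [Finset.sum_const, ENNReal.ofReal_mul (by positivity), ENNReal.ofReal_natCast,
        nsmul_eq_mul]
      congr 2
      simp only [Finset.card_univ, Fintype.card_fun, Fintype.card_option, Fintype.card_prod,
        Fintype.card_fin, Fintype.card_bool]
      congr 1
      ring
    have h1 := (M.samples_card_gt_le hk N i α β).trans (ENNReal.ofReal_le_ofReal (hqD i α β))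
    have h2 := (M.samples_card_lt_le hk N i α β).trans (ENNReal.ofReal_le_ofReal (hqD i α β))
    refine (add_le_add h1 ((measure_union_le _ _).trans (add_le_add h2 h3))).trans (le_of_eq ?_)
    rw [← ENNReal.ofReal_add (by positivity) (by positivity),
      ← ENNReal.ofReal_add (by positivity) (by positivity)]
    congr 1
    ring
  refine (measure_mono hsub).trans ((measure_iUnion_fintype_le _ _).trans
    ((Finset.sum_le_sum fun e _ => hbad e).trans (le_of_eq ?_)))
  rw [Finset.sum_const, ENNReal.ofReal_mul (by positivity), ENNReal.ofReal_natCast, nsmul_eq_mul]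
  congr 2
  simp only [Finset.card_univ, Fintype.card_prod, Fintype.card_fin]
  ring

end Model

end Concentration

/-! ## From the excess loss to the parameters -/

section Estimation

variable {n k : ℕ}

theorem exp_neg_le_sigmoid_slope (t : ℝ) :
    Real.exp (-|t| - 2) ≤ Real.sigmoid t * (1 - Real.sigmoid t) := by
  have hpos : ∀ s : ℝ, 0 ≤ s → Real.exp (-s - 2) ≤ Real.sigmoid s * (1 - Real.sigmoid s) := by
    intro s hs
    have h1 : 1 / 2 ≤ Real.sigmoid s := by
      rw [← Real.sigmoid_zero.trans (by norm_num : (2 : ℝ)⁻¹ = 1 / 2)]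
      exact Real.sigmoid_le hs
    have h2 : 1 / 2 * Real.exp (-s) ≤ 1 - Real.sigmoid s := by
      rw [← Real.sigmoid_neg, Real.sigmoid_def, neg_neg, Real.exp_neg, ← one_div, ← one_div,
        one_div_mul_one_div]
      have := Real.one_le_exp hs
      exact one_div_le_one_div_of_le (by positivity) (by linarith)
    have h3 : Real.exp (-2) ≤ 1 / 4 := by
      rw [Real.exp_neg, ← one_div]
      refine one_div_le_one_div_of_le (by norm_num) ?_
      have h4 := Real.exp_one_gt_d9
      have h5 : Real.exp 2 = Real.exp 1 * Real.exp 1 := by rw [← Real.exp_add]; norm_num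
      nlinarith
    calc Real.exp (-s - 2) = Real.exp (-2) * Real.exp (-s) := by rw [← Real.exp_add]; ring_nf
      _ ≤ 1 / 4 * Real.exp (-s) := mul_le_mul_of_nonneg_right h3 (Real.exp_pos _).le
      _ = 1 / 2 * (1 / 2 * Real.exp (-s)) := by ring
      _ ≤ Real.sigmoid s * (1 - Real.sigmoid s) :=
        mul_le_mul h1 h2 (by positivity) (by linarith)
  rcases le_total 0 t with h | h
  · rw [abs_of_nonneg h]; exact hpos t h
  · have := hpos (-t) (by linarith)
    rw [Real.sigmoid_neg] at this
    rw [abs_of_nonpos h]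
    linarith

/-- Within distance 1 of a the slope of σ is at least e^(-|a|-3). For more distant b, monotonicity
reduces to a ± 1, hence the truncation at 1. Only |a| enters, so no bound on the estimated
predictions is required. -/
theorem exp_mul_min_le_abs_sigmoid_sub (a b : ℝ) :
    Real.exp (-|a| - 3) * min 1 |a - b| ≤ |Real.sigmoid a - Real.sigmoid b| := by
  have near : ∀ b, |a - b| ≤ 1 →
      Real.exp (-|a| - 3) * |a - b| ≤ |Real.sigmoid a - Real.sigmoid b| := by
    intro b hb
    obtain ⟨c, hc, -, he⟩ := exists_slope Real.hasDerivAt_sigmoid a b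
    rw [abs_sub_comm, abs_sub_comm (Real.sigmoid a), he, abs_mul]
    refine mul_le_mul_of_nonneg_right ?_ (abs_nonneg _)
    refine le_trans ?_ (le_abs_self _)
    refine le_trans (Real.exp_le_exp.2 ?_) (exp_neg_le_sigmoid_slope c)
    rw [abs_sub_comm] at hb
    have := abs_sub_abs_le_abs_sub c a
    linarith
  rcases le_total |a - b| 1 with h | h
  · rw [min_eq_right h]; exact near b h
  · rw [min_eq_left h]
    rcases le_total a b with hab | hab
    · have h1 := near (a + 1) (by norm_num)
      have h2 : Real.sigmoid (a + 1) ≤ Real.sigmoid b := Real.sigmoid_le (by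
        rw [abs_of_nonpos (by linarith)] at h; linarith)
      have h3 : Real.sigmoid a ≤ Real.sigmoid (a + 1) := Real.sigmoid_le (by linarith)
      have h4 : |a - (a + 1)| = 1 := by norm_num
      rw [h4, abs_sub_comm (Real.sigmoid a), abs_of_nonneg (a := Real.sigmoid (a + 1) - _)
        (by linarith)] at h1
      rw [abs_sub_comm (Real.sigmoid a), abs_of_nonneg (a := Real.sigmoid b - _) (by linarith)]
      linarith
    · have h1 := near (a - 1) (by norm_num)
      have h2 : Real.sigmoid b ≤ Real.sigmoid (a - 1) := Real.sigmoid_le (by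
        rw [abs_of_nonneg (by linarith)] at h; linarith)
      have h3 : Real.sigmoid (a - 1) ≤ Real.sigmoid a := Real.sigmoid_le (by linarith)
      have h4 : |a - (a - 1)| = 1 := by norm_num
      rw [h4, abs_of_nonneg (a := Real.sigmoid a - _) (by linarith)] at h1
      rw [abs_of_nonneg (a := Real.sigmoid a - _) (by linarith)]
      linarith

theorem min_one_abs_sub_le (a b : ℝ) : min 1 |a - b| ≤ min 1 |a| + min 1 |b| := by
  have h := abs_sub a b
  rcases le_total 1 |a| with h1 | h1
  · rw [min_eq_left h1]
    have := min_le_left 1 |a - b|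
    have : 0 ≤ min 1 |b| := le_min zero_le_one (abs_nonneg _)
    linarith
  · rcases le_total 1 |b| with h2 | h2
    · rw [min_eq_left h2]
      have := min_le_left 1 |a - b|
      have : 0 ≤ min 1 |a| := le_min zero_le_one (abs_nonneg _)
      linarith
    · rw [min_eq_right h1, min_eq_right h2]
      exact (min_le_right _ _).trans h

/-- The gap between losses is at most its quadratic expansion. -/
theorem totalLoss_sub_le_quadratic {ι : Type} (S : Finset ι) (x : ι → Mat n k) (y : ι → ℝ)
    (v w : Mat n k) :
    totalLoss S x y v - totalLoss S x y w
      ≤ dot (∑ s ∈ S, (Real.sigmoid (dot w (x s)) - (y s + 1) / 2) • x s) (v - w)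
        + ∑ s ∈ S, 1 / 4 * dot (v - w) (x s) ^ 2 := by
  rw [totalLoss, totalLoss, ← Finset.sum_sub_distrib, dot_sum_left, ← Finset.sum_add_distrib]
  refine Finset.sum_le_sum fun s _ => ?_
  have h := softplus_le_quadratic (dot w (x s)) (dot v (x s))
  rw [dot_smul_left, dot_comm (x s), dot_sub_left]
  linarith

namespace Model

variable (M : Model n k)

/-- In a typical sample, a small excess loss implies a small prediction gap. -/
theorem IsTypical.predictionGap_le {M : Model n k} (hk : 0 < k) {N κ : ℕ} (hN : 1 ≤ N)
    (hκ : 0 < κ) {R t opt : ℝ} (hR : 0 < R) (hopt : 0 ≤ opt) {z : Fin N → Fin n → Fin k}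
    (hz : M.IsTypical R κ t z) {i : Fin n} {α β : Fin k} (hαβ : α ≠ β) {w : Mat n k}
    (hw : groupNorm 1 w ≤ R)
    (hloss : totalLoss (restricted z i α β) (fun m => feature i (z m)) (fun m => label i α (z m)) w
      ≤ totalLoss (restricted z i α β) (fun m => feature i (z m)) (fun m => label i α (z m))
          (M.trueWeight i α β) + (restricted z i α β).card * opt) :
    M.predictionGap i α β (M.trueWeight i α β) w
      ≤ M.pairMean i α β (fun _ => 1) * (6 * opt + 7 * R ^ 2 / κ) + 4 * t / N := by
  obtain ⟨hcard, -, htyp⟩ := hz i α β hαβ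
  set q := M.pairMean i α β fun _ => 1 with hq
  set S := restricted z i α β with hS
  set x : Fin N → Mat n k := fun m => feature i (z m) with hx
  set y : Fin N → ℝ := fun m => label i α (z m) with hy
  set ws := M.trueWeight i α β with hws
  have hN0 : (0 : ℝ) < N := by exact_mod_cast hN
  have hκ0 : (0 : ℝ) < κ := by exact_mod_cast hκ
  have hq0 : 0 ≤ q := M.pairMean_nonneg hk fun _ => zero_le_one
  -- The output w depends on the samples, but v is taken from a finite family that does not. Here c
  -- is 2/N times the gradient of the empirical loss at w; it need not be small, since the greedy
  -- choice of v balances its linear term as well.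
  set c : Mat n k := (2 / (N : ℝ)) • ∑ s ∈ S, (Real.sigmoid (dot w (x s)) - (y s + 1) / 2) • x s
    with hc
  -- A mixture of the empirical and the model distribution, so that one v serves both. The weights
  -- are the coefficients met below: 2/N · 1/4 from the curvature of the loss and 1/8 from comparing
  -- the gaps of w and v.
  let μ : Fin N ⊕ (Fin n → Fin k) → ℝ := Sum.elim (fun m => if m ∈ S then 1 / (2 * (N : ℝ)) else 0)
    fun ζ => 1 / 8 * (M.prob ζ * if ζ i = α ∨ ζ i = β then 1 else 0)
  have hμ : ∀ l, 0 ≤ μ l := by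
    rintro (m | ζ)
    · simp only [μ, Sum.elim_inl]; split_ifs <;> positivity
    · have := (M.prob_pos hk ζ).le
      simp only [μ, Sum.elim_inr]; split_ifs <;> positivity
  obtain ⟨g, hg⟩ := exists_atomAverage_le hk hR hw c hμ
    (x := Sum.elim x fun ζ => feature i ζ) (by
      rintro (m | ζ) j
      · exact rowNorm_feature_le i (z m) j
      · exact rowNorm_feature_le i ζ j) hκ
  set v := atomAverage R g with hv
  have hsum : ∑ l, μ l = S.card / (2 * (N : ℝ)) + 1 / 8 * q := by
    rw [Fintype.sum_sum_type]
    simp only [μ, Sum.elim_inl, Sum.elim_inr]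
    rw [← Finset.mul_sum, ← pairMean, ← hq]
    simp only [Finset.sum_ite_mem, Finset.univ_inter, Finset.sum_const, nsmul_eq_mul]
    ring
  have hquad : ∑ l, μ l * dot (v - w) (Sum.elim x (fun ζ => feature i ζ) l) ^ 2
      = 2 / N * ∑ s ∈ S, 1 / 4 * dot (v - w) (x s) ^ 2
        + 1 / 8 * M.pairMean i α β fun ζ => dot (v - w) (feature i ζ) ^ 2 := by
    rw [Fintype.sum_sum_type]
    simp only [μ, Sum.elim_inl, Sum.elim_inr]
    congr 1
    · simp only [ite_mul, zero_mul, Finset.sum_ite_mem, Finset.univ_inter]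
      rw [Finset.mul_sum]
      exact Finset.sum_congr rfl fun s _ => by field_simp; ring
    · rw [pairMean, Finset.mul_sum]
      exact Finset.sum_congr rfl fun ζ _ => by split_ifs <;> ring
  rw [hsum, hquad] at hg
  have hlq := mul_le_mul_of_nonneg_left (totalLoss_sub_le_quadratic S x y v w)
    (show 0 ≤ 2 / (N : ℝ) by positivity)
  rw [mul_add, ← dot_smul_left, ← hc] at hlq
  -- From (x + y)² ≤ 2x² + 2y² and the Lipschitz constant 1/4 of σ: 2 · (1/4)² = 1/8.
  have hgap : M.predictionGap i α β ws w
      ≤ 2 * M.predictionGap i α β ws v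
        + 1 / 8 * M.pairMean i α β fun ζ => dot (v - w) (feature i ζ) ^ 2 := by
    rw [predictionGap, predictionGap, ← pairMean_mul, ← pairMean_mul, ← pairMean_add]
    refine M.pairMean_mono hk fun ζ => ?_
    have h1 := abs_sigmoid_sub_le (dot w (feature i ζ)) (dot v (feature i ζ))
    have h2 := pow_le_pow_left₀ (abs_nonneg _) h1 2
    rw [sq_abs, mul_pow, sq_abs, ← dot_sub_left] at h2
    nlinarith [sq_nonneg (Real.sigmoid (dot ws (feature i ζ)) - Real.sigmoid (dot v (feature i ζ))
      - (Real.sigmoid (dot v (feature i ζ)) - Real.sigmoid (dot w (feature i ζ))))]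
  have ht := htyp g
  have ht2 : 2 * M.predictionGap i α β ws v
      ≤ 4 * t / N + 2 / N * (totalLoss S x y v - totalLoss S x y ws) := by
    have := mul_le_mul_of_nonneg_left ht (show 0 ≤ 4 / (N : ℝ) by positivity)
    have e : 4 / (N : ℝ) * (1 / 2 * (totalLoss S x y ws - totalLoss S x y v)
        + N * (1 / 2 * M.predictionGap i α β ws v))
        = 2 * M.predictionGap i α β ws v
          - 2 / N * (totalLoss S x y v - totalLoss S x y ws) := by
      field_simp; ring
    rw [e] at this
    have e2 : 4 / (N : ℝ) * t = 4 * t / N := by ring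
    linarith
  have hS1 : S.card / (N : ℝ) ≤ 3 * q := by
    rw [div_le_iff₀ hN0]; linarith
  have hl2 : 2 / N * (totalLoss S x y w - totalLoss S x y ws) ≤ 6 * q * opt := by
    calc 2 / N * (totalLoss S x y w - totalLoss S x y ws) ≤ 2 / N * (S.card * opt) :=
          mul_le_mul_of_nonneg_left (by linarith) (by positivity)
      _ = 2 * (S.card / N) * opt := by ring
      _ ≤ 2 * (3 * q) * opt := by gcongr
      _ = _ := by ring
  -- The total mass of μ is at most 3q/2 + q/8 ≤ 7q/4, by the upper bound on the number of samples.
  have hlast : 4 * R ^ 2 / κ * (S.card / (2 * (N : ℝ)) + 1 / 8 * q) ≤ q * (7 * R ^ 2 / κ) := by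
    have e : S.card / (2 * (N : ℝ)) = 1 / 2 * (S.card / N) := by ring
    calc _ ≤ 4 * R ^ 2 / κ * (7 / 4 * q) := by
          refine mul_le_mul_of_nonneg_left ?_ (by positivity)
          rw [e]; linarith
      _ = _ := by ring
  have e3 : 2 / (N : ℝ) * (totalLoss S x y v - totalLoss S x y ws)
      = 2 / N * (totalLoss S x y v - totalLoss S x y w)
        + 2 / N * (totalLoss S x y w - totalLoss S x y ws) := by ring
  nlinarith

/-- Differences within a row of the error are controlled by the prediction gap. -/
theorem min_one_abs_sub_sq_le (hk : 0 < k) {lam : ℝ} (hlam : M.width ≤ lam) {i j : Fin n}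
    (hj : j ≠ i) (α β b b' : Fin k) (w : Mat n k) :
    M.pairMean i α β (fun _ => 1) * min 1 |(M.trueWeight i α β - w) j b
        - (M.trueWeight i α β - w) j b'| ^ 2
      ≤ 2 * k * Real.exp (6 * lam + 6) * M.predictionGap i α β (M.trueWeight i α β) w := by
  have hk0 : (0 : ℝ) < k := by exact_mod_cast hk
  set ws := M.trueWeight i α β with hws
  set u := ws - w with hu
  rcases eq_or_ne b b' with rfl | hb
  · rw [sub_self, abs_zero, min_eq_right zero_le_one]
    have : 0 ≤ M.predictionGap i α β ws w := M.pairMean_nonneg hk fun _ => sq_nonneg _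
    have h2 : 0 ≤ 2 * k * Real.exp (6 * lam + 6) * M.predictionGap i α β ws w := by positivity
    simpa using h2
  set φ : (Fin n → Fin k) → ℝ := fun ζ =>
    if ζ i = α ∨ ζ i = β then min 1 |dot u (feature i ζ)| ^ 2 else 0 with hφ
  have hφ0 : ∀ ζ, 0 ≤ φ ζ := fun ζ => by
    simp only [hφ]; split_ifs <;> positivity
  have h1 := M.sum_prob_update_le hk hlam j hφ0
  -- Of the sum over the resampled symbol at j only b and b' are kept. Their features differ in row
  -- j alone, so at least one of the two truncated errors must be large if the row difference is.
  have h2 : 1 / 2 * (M.pairMean i α β (fun _ => 1) * min 1 |u j b - u j b'| ^ 2)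
      ≤ ∑ ζ, M.prob ζ * ∑ b, φ (Function.update ζ j b) := by
    rw [mul_left_comm, mul_comm, ← M.pairMean_mul, pairMean]
    refine Finset.sum_le_sum fun ζ _ => mul_le_mul_of_nonneg_left ?_ (M.prob_pos hk ζ).le
    have h3 : φ (Function.update ζ j b) + φ (Function.update ζ j b')
        ≤ ∑ b, φ (Function.update ζ j b) := by
      rw [← Finset.sum_pair (f := fun b => φ (Function.update ζ j b)) hb]
      exact Finset.sum_le_sum_of_subset_of_nonneg (Finset.subset_univ _) fun _ _ _ => hφ0 _
    refine le_trans ?_ h3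
    simp only [hφ, Function.update_of_ne hj.symm]
    split_ifs
    · rw [← dot_feature_update hj u ζ b b']
      set A := dot u (feature i (Function.update ζ j b))
      set B := dot u (feature i (Function.update ζ j b'))
      have h4 := min_one_abs_sub_le A B
      have h5 : 0 ≤ min 1 |A - B| := le_min zero_le_one (abs_nonneg _)
      nlinarith [sq_nonneg (min 1 |A| - min 1 |B|)]
    · simp
  -- The factor is the square of e^(2λ+3), as the true predictions are at most 2λ in absolute value.
  -- Resampling contributes the other e^(2λ).
  have h3 : ∑ ζ, M.prob ζ * φ ζ ≤ Real.exp (4 * lam + 6) * M.predictionGap i α β ws w := by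
    rw [predictionGap, ← pairMean_mul, pairMean]
    refine Finset.sum_le_sum fun ζ _ => mul_le_mul_of_nonneg_left ?_ (M.prob_pos hk ζ).le
    simp only [hφ]
    split_ifs
    · have h4 := exp_mul_min_le_abs_sigmoid_sub (dot ws (feature i ζ)) (dot w (feature i ζ))
      rw [← dot_sub_left, ← hu] at h4
      have h5 := M.abs_dot_trueWeight_le hlam i α β ζ
      rw [← hws] at h5
      have h6 : Real.exp (-(2 * lam) - 3) * min 1 |dot u (feature i ζ)|
          ≤ |Real.sigmoid (dot ws (feature i ζ)) - Real.sigmoid (dot w (feature i ζ))| :=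
        le_trans (mul_le_mul_of_nonneg_right (Real.exp_le_exp.2 (by linarith))
          (le_min zero_le_one (abs_nonneg _))) h4
      have h7 := pow_le_pow_left₀ (by positivity) h6 2
      rw [sq_abs, mul_pow, ← Real.exp_nat_mul] at h7
      have h8 := mul_le_mul_of_nonneg_left h7 (Real.exp_pos (4 * lam + 6)).le
      rw [← mul_assoc, ← Real.exp_add] at h8
      have e : 4 * lam + 6 + ((2 : ℕ) : ℝ) * (-(2 * lam) - 3) = 0 := by push_cast; ring
      rwa [e, Real.exp_zero, one_mul] at h8
    · exact le_rfl
  have h4 : Real.exp (6 * lam + 6) = Real.exp (2 * lam) * Real.exp (4 * lam + 6) := by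
    rw [← Real.exp_add]; ring_nf
  have h5 := mul_le_mul_of_nonneg_left h3 (show 0 ≤ k * Real.exp (2 * lam) by positivity)
  rw [h4]
  linarith

theorem sum_trueWeight {i j : Fin n} (hj : j ≠ i) (α β : Fin k) :
    ∑ b, M.trueWeight i α β j b = 0 := by
  simp only [trueWeight, if_neg hj, Finset.sum_sub_distrib, M.row_centered i j hj.symm, sub_zero]

/-- A small prediction gap gives accurate centered weights. -/
theorem abs_center_sub_le (hk : 0 < k) {lam ε : ℝ} (hlam : M.width ≤ lam) (hε : 0 < ε)
    (hε1 : ε ≤ 1) {i j : Fin n} (hj : j ≠ i) (α β b : Fin k) {w : Mat n k}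
    (h : M.predictionGap i α β (M.trueWeight i α β) w
      ≤ M.pairMean i α β (fun _ => 1) * (ε ^ 2 / (8 * k * Real.exp (6 * lam + 6)))) :
    |center i w j b - M.trueWeight i α β j b| ≤ ε / 2 := by
  have hk0 : (0 : ℝ) < k := by exact_mod_cast hk
  have hq0 : 0 < M.pairMean i α β fun _ => 1 := by
    have h1 := M.pairMean_one_ge hk hlam i α β
    by_contra hc
    have : k * Real.exp (2 * lam) * (M.pairMean i α β fun _ => 1) ≤ 0 :=
      mul_nonpos_of_nonneg_of_nonpos (by positivity) (not_lt.1 hc)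
    linarith
  set u := M.trueWeight i α β - w with hu
  have hΔ : ∀ b', |u j b - u j b'| ≤ ε / 2 := by
    intro b'
    have h1 := M.min_one_abs_sub_sq_le hk hlam hj α β b b' w
    have h2 := h1.trans (mul_le_mul_of_nonneg_left h (by positivity))
    have e : 2 * k * Real.exp (6 * lam + 6) * ((M.pairMean i α β fun _ => 1)
        * (ε ^ 2 / (8 * k * Real.exp (6 * lam + 6))))
        = (M.pairMean i α β fun _ => 1) * (ε / 2) ^ 2 := by
      field_simp; ring
    rw [e] at h2
    have h3 := abs_le_of_sq_le_sq (le_of_mul_le_mul_left h2 hq0) (by positivity)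
    rw [abs_of_nonneg (le_min zero_le_one (abs_nonneg _))] at h3
    rcases min_le_iff.1 h3 with h4 | h4
    · linarith
    · exact h4
  -- Row j of the true weights is already centered, so the error of the centered estimate is the
  -- mean of differences within the row of u.
  have e : center i w j b - M.trueWeight i α β j b
      = -((1 / (k : ℝ)) * ∑ b', (u j b - u j b')) := by
    have h1 := M.sum_trueWeight hj α β
    simp only [hu, Pi.sub_apply, Finset.sum_sub_distrib, h1, Finset.sum_const, Finset.card_univ,
      Fintype.card_fin, nsmul_eq_mul, center, if_neg hj]
    field_simp
    ring
  rw [e, abs_neg, abs_mul, abs_of_pos (by positivity)]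
  calc 1 / (k : ℝ) * |∑ b', (u j b - u j b')| ≤ 1 / k * ∑ _b' : Fin k, ε / 2 :=
        mul_le_mul_of_nonneg_left ((Finset.abs_sum_le_sum_abs _ _).trans
          (Finset.sum_le_sum fun b' _ => hΔ b')) (by positivity)
    _ = ε / 2 := by
      rw [Finset.sum_const, Finset.card_univ, Fintype.card_fin, nsmul_eq_mul]; field_simp

/-- The weights are averages of weights of the regressions. -/
theorem W_eq (hk : 0 < k) {i j : Fin n} (hj : j ≠ i) (α b : Fin k) :
    M.W i j α b = (1 / (k : ℝ)) * ∑ β ∈ Finset.univ.erase α, M.trueWeight i α β j b := by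
  have hk0 : (k : ℝ) ≠ 0 := by exact_mod_cast hk.ne'
  have h1 : ∑ β ∈ Finset.univ.erase α, M.trueWeight i α β j b
      = ∑ β, (M.W i j α b - M.W i j β b) := by
    rw [← Finset.add_sum_erase _ _ (Finset.mem_univ α), sub_self, zero_add]
    exact Finset.sum_congr rfl fun β _ => by simp [trueWeight, hj]
  rw [h1, Finset.sum_sub_distrib, M.col_centered i j hj.symm, Finset.sum_const, Finset.card_univ,
    Fintype.card_fin, nsmul_eq_mul, sub_zero]
  field_simp

theorem abs_average_le (hk : 0 < k) (α : Fin k) {f : Fin k → ℝ} {r : ℝ} (hr : 0 ≤ r)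
    (h : ∀ β, α ≠ β → |f β| ≤ r) : |(1 / (k : ℝ)) * ∑ β ∈ Finset.univ.erase α, f β| ≤ r := by
  have hk0 : (0 : ℝ) < k := by exact_mod_cast hk
  rw [abs_mul, abs_of_pos (by positivity)]
  calc 1 / (k : ℝ) * |∑ β ∈ Finset.univ.erase α, f β| ≤ 1 / k * ∑ _β : Fin k, r := by
        refine mul_le_mul_of_nonneg_left ((Finset.abs_sum_le_sum_abs _ _).trans
          ((Finset.sum_le_sum fun β hβ => h β (Finset.ne_of_mem_erase hβ).symm).trans
          (Finset.sum_le_sum_of_subset_of_nonneg (Finset.subset_univ _) fun _ _ _ => hr)))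
          (by positivity)
    _ = r := by
      rw [Finset.sum_const, Finset.card_univ, Fintype.card_fin, nsmul_eq_mul]; field_simp

theorem close_of_center (hk : 0 < k) {ε : ℝ} (hε : 0 < ε)
    {What : Fin n → Fin n → Fin k → Fin k → ℝ} {U : Fin n → Fin k → Fin k → Mat n k}
    (hW : ∀ i j, j ≠ i → ∀ α b,
      What i j α b = (1 / (k : ℝ)) * ∑ β ∈ Finset.univ.erase α, U i α β j b)
    (hU : ∀ i j, j ≠ i → ∀ α β, α ≠ β → ∀ b,
      |U i α β j b - M.trueWeight i α β j b| ≤ ε / 2) : M.Close ε What := by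
  intro i j hij α b
  rw [M.W_eq hk hij.symm, hW i j hij.symm, ← mul_sub, ← Finset.sum_sub_distrib]
  refine abs_average_le hk α hε.le fun β hβ => ?_
  rw [abs_sub_comm]
  linarith [hU i j hij.symm α β hβ b]

/-- When 5λ√k ≤ ε the size of the estimate suffices: |W| ≤ λ and |Ŵ| ≤ 4λ√k. No property of the
samples is used. -/
theorem close_of_small (hk : 0 < k) {lam ε : ℝ} (hlam : M.width ≤ lam) (hlam0 : 0 ≤ lam)
    (hsmall : 5 * lam * √(k : ℝ) ≤ ε)
    {What : Fin n → Fin n → Fin k → Fin k → ℝ} {U : Fin n → Fin k → Fin k → Mat n k}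
    (hW : ∀ i j, j ≠ i → ∀ α b,
      What i j α b = (1 / (k : ℝ)) * ∑ β ∈ Finset.univ.erase α, U i α β j b)
    (hU : ∀ i j, j ≠ i → ∀ α β, α ≠ β → ∀ b, |U i α β j b| ≤ 4 * lam * √(k : ℝ)) :
    M.Close ε What := by
  intro i j hij α b
  have h1 : 1 ≤ √(k : ℝ) := Real.one_le_sqrt.2 (by exact_mod_cast hk)
  have h2 := (M.abs_W_le_width hij α b).trans hlam
  have h3 := abs_average_le hk α (by positivity) fun β hβ => hU i j hij.symm α β hβ b
  rw [← hW i j hij.symm] at h3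
  have h4 := abs_sub (M.W i j α b) (What i j α b)
  nlinarith

end Model

theorem abs_center_le (hk : 0 < k) {R : ℝ} {w : Mat n k} (hw : groupNorm 1 w ≤ R) {i j : Fin n}
    (hj : j ≠ i) (b : Fin k) : |center i w j b| ≤ 2 * R := by
  have hk0 : (0 : ℝ) < k := by exact_mod_cast hk
  have h : ∀ b, |w j b| ≤ R := fun b =>
    (abs_le_rowNorm w j b).trans ((rowNorm_le_groupNorm_one w j).trans hw)
  rw [center, if_neg hj]
  have h2 : |1 / (k : ℝ) * ∑ a, w j a| ≤ R := by
    rw [abs_mul, abs_of_pos (by positivity)]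
    calc 1 / (k : ℝ) * |∑ a, w j a| ≤ 1 / k * ∑ _a : Fin k, R :=
          mul_le_mul_of_nonneg_left ((Finset.abs_sum_le_sum_abs _ _).trans
            (Finset.sum_le_sum fun a _ => h a)) (by positivity)
      _ = R := by
        rw [Finset.sum_const, Finset.card_univ, Fintype.card_fin, nsmul_eq_mul]; field_simp
  linarith [abs_sub (w j b) (1 / (k : ℝ) * ∑ a, w j a), h b]

/-- Averages of points of the unit ball, rescaled by `R`. -/
theorem groupNorm_average_le {R : ℝ} (hR : 0 ≤ R) {T : ℕ} {w : ℕ → Mat n k}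
    (hw : ∀ t < T, groupNorm 1 (w t) ≤ 1) :
    groupNorm 1 (R • ((1 / (T : ℝ)) • ∑ t ∈ Finset.range T, w t)) ≤ R := by
  rw [groupNorm_one_smul, groupNorm_one_smul, abs_of_nonneg hR, abs_of_nonneg (by positivity)]
  refine mul_le_of_le_one_right hR ?_
  have h1 : groupNorm 1 (∑ t ∈ Finset.range T, w t) ≤ T := by
    refine (groupNorm_one_sum_le _ _).trans ((Finset.sum_le_sum fun t ht =>
      hw t (Finset.mem_range.1 ht)).trans ?_)
    simp
  rcases T.eq_zero_or_pos with h | h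
  · simp [h]
  · have : (0 : ℝ) < T := by exact_mod_cast h
    rw [one_div, inv_mul_le_iff₀ this, mul_one]
    exact h1

theorem IsMirrorDescentOutput.groupNorm_le {ι : Type} (hn : 3 ≤ n) (hk : 0 < k) {S : Finset ι}
    {x : ι → Mat n k} {y : ι → ℝ} {R τ : ℝ} (hR : 0 ≤ R) {T : ℕ} {w : Mat n k}
    (h : IsMirrorDescentOutput S x y R T τ w) : groupNorm 1 w ≤ R := by
  obtain ⟨v, hv0, hv, rfl⟩ := h
  refine groupNorm_average_le hR fun t ht => ?_
  rcases t with _ | t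
  · rw [hv0]
    exact (groupNorm_uniformStart hn hk).le
  · exact (hv t (by omega)).1

theorem IsMirrorDescentOutput.totalLoss_le {ι : Type} (hn : 3 ≤ n) (hk : 0 < k) {S : Finset ι}
    {x : ι → Mat n k} {y : ι → ℝ} {R : ℝ} (hR : 0 < R) {T : ℕ} (hT : 1 ≤ T) {w : Mat n k}
    (hx : ∀ s j, rowNorm (x s) j ≤ 1) (hy : ∀ s, |y s| ≤ 1)
    (h : IsMirrorDescentOutput S x y R T 0 w) {v : Mat n k} (hv : groupNorm 1 v ≤ R) :
    totalLoss S x y w ≤ totalLoss S x y v + S.card * (5 * R * √(mirrorScale n / T)) := by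
  obtain ⟨u, hu0, hu, rfl⟩ := h
  have := totalLoss_descent_le (δ := fun _ => 0) hn hk S hR hT hx hy hu0
    (fun t ht => (hu t ht).isApproxStep hn) hv
  simpa using this

theorem exists_isMirrorDescentOutput {ι : Type} (hn : 3 ≤ n) (S : Finset ι) (x : ι → Mat n k)
    (y : ι → ℝ) (R : ℝ) (T : ℕ) : ∃ w, IsMirrorDescentOutput S x y R T 0 w := by
  choose f hf using fun w : Mat n k => exists_isStep hn (stepSize n R T) (lossGrad S x y R w) w
  exact ⟨_, fun t => f^[t] (uniformStart n k), rfl,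
    fun t _ => by simpa only [Function.iterate_succ_apply'] using hf (f^[t] (uniformStart n k)), rfl⟩

theorem exists_isOutput (hn : 3 ≤ n) (lam η : ℝ) (T : ℕ) {N : ℕ} (z : Fin N → Fin n → Fin k) :
    ∃ What G, IsOutput lam η T (fun _ => 0) z What G := by
  classical
  choose w hw using fun i α β => exists_isMirrorDescentOutput hn (restricted z i α β)
    (fun m => feature i (z m)) (fun m => label i α (z m)) (2 * lam * √(k : ℝ)) T
  refine ⟨fun i j α b => (1 / (k : ℝ)) * ∑ β ∈ Finset.univ.erase α, center i (w i α β) j b,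
    fun i j => decide (i < j ∧ ∃ a b, η / 2 ≤ |(1 / (k : ℝ)) * ∑ β ∈ Finset.univ.erase a,
      center i (w i a β) j b|), ⟨w, fun i α β _ => hw i α β, fun _ _ _ _ _ => rfl⟩,
    fun i j => decide_eq_true_iff⟩

end Estimation

/-! ## Choice of the parameters -/

section Parameters

variable {n k : ℕ}

/-- The accuracy to which the regressions have to be solved. -/
noncomputable def accuracy (k : ℕ) (lam ε : ℝ) : ℝ := ε ^ 2 / (24 * k * Real.exp (6 * lam + 6))

theorem accuracy_pos (hk : 0 < k) {lam ε : ℝ} (hε : 0 < ε) : 0 < accuracy k lam ε := by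
  have : (0 : ℝ) < k := by exact_mod_cast hk
  exact div_pos (by positivity) (by positivity)

theorem exp_six_sq (lam : ℝ) :
    Real.exp (6 * lam + 6) ^ 2 = Real.exp 12 * Real.exp (12 * lam) := by
  rw [← Real.exp_nat_mul, ← Real.exp_add]; congr 1; push_cast; ring

theorem sq_accuracy (hk : 0 < k) {lam ε : ℝ} (hε : 0 < ε) :
    accuracy k lam ε ^ 2 * (576 * k ^ 2 * Real.exp 12 * Real.exp (12 * lam)) = ε ^ 4 := by
  have : (0 : ℝ) < k := by exact_mod_cast hk
  rw [mul_assoc _ (Real.exp 12), ← exp_six_sq, accuracy]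
  field_simp
  norm_num

/-- Solving R√(ln n/T) ≲ τ gives T of order λ²k ln n/τ², which is the assumed bound because 1/τ² is
of order k²e^{12λ}/ε⁴. The other half of the accuracy is reserved for the bisections. -/
theorem sqrt_iterations_le (hn : 3 ≤ n) (hk : 0 < k) {lam ε : ℝ} (hlam : 0 < lam) (hε : 0 < ε)
    {T : ℕ} (hT1 : 1 ≤ T) (hT : 10 ^ 8 * Real.exp 12
      * (lam ^ 2 * (k : ℝ) ^ 3 * Real.exp (12 * lam) * Real.log n / ε ^ 4) ≤ T) :
    6 * (5 * (2 * lam * √(k : ℝ)) * √(mirrorScale n / T)) ≤ accuracy k lam ε / 2 := by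
  have hk0 : (0 : ℝ) < k := by exact_mod_cast hk
  have hT0 : (0 : ℝ) < T := by exact_mod_cast hT1
  have hL := one_lt_log hn
  have hτ := accuracy_pos hk hε (lam := lam)
  have hs := sq_accuracy hk hε (lam := lam)
  set τ := accuracy k lam ε
  have h1 : 10 ^ 8 * (lam ^ 2 * k * Real.log n) ≤ 576 * (T * τ ^ 2) := by
    rw [← hs] at hT
    have e : 10 ^ 8 * Real.exp 12 * (lam ^ 2 * (k : ℝ) ^ 3 * Real.exp (12 * lam) * Real.log n
        / (τ ^ 2 * (576 * k ^ 2 * Real.exp 12 * Real.exp (12 * lam))))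
        = 10 ^ 8 * (lam ^ 2 * k * Real.log n) / (576 * τ ^ 2) := by
      field_simp
    rw [e, div_le_iff₀ (by positivity)] at hT
    linarith
  have h2 : √(mirrorScale n / T) ≤ τ / (60 * (2 * lam * √(k : ℝ)) * 2) := by
    rw [Real.sqrt_le_left (by positivity), div_le_iff₀ hT0, div_pow, mul_pow, mul_pow, mul_pow,
      Real.sq_sqrt hk0.le, mul_comm, ← mul_div_assoc, le_div_iff₀ (by positivity), mirrorScale]
    have h3 := Real.exp_one_lt_d9
    have h4 : Real.exp 1 * (lam ^ 2 * k * Real.log n) ≤ 2.72 * (lam ^ 2 * k * Real.log n) :=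
      mul_le_mul_of_nonneg_right (by linarith) (by positivity)
    nlinarith
  rw [le_div_iff₀ (by positivity)] at h2
  linarith

/-- The number of atoms in the approximations of the weights. -/
noncomputable def atomCount (k : ℕ) (lam ε : ℝ) : ℕ :=
  ⌈7 * (2 * lam * √(k : ℝ)) ^ 2 / accuracy k lam ε⌉₊

theorem atomCount_pos (hk : 0 < k) {lam ε : ℝ} (hlam : 0 < lam) (hε : 0 < ε) :
    0 < atomCount k lam ε := by
  have := accuracy_pos hk hε (lam := lam)
  have : (0 : ℝ) < k := by exact_mod_cast hk
  exact Nat.ceil_pos.2 (by positivity)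

theorem atomCount_ge (hk : 0 < k) {lam ε : ℝ} (hlam : 0 < lam) (hε : 0 < ε) :
    7 * (2 * lam * √(k : ℝ)) ^ 2 / atomCount k lam ε ≤ accuracy k lam ε := by
  have h1 := accuracy_pos hk hε (lam := lam)
  have h2 : (0 : ℝ) < atomCount k lam ε := by exact_mod_cast atomCount_pos hk hlam hε
  have h3 : 7 * (2 * lam * √(k : ℝ)) ^ 2 / accuracy k lam ε ≤ atomCount k lam ε := Nat.le_ceil _
  rw [div_le_iff₀ h1] at h3
  rw [div_le_iff₀ h2]
  linarith

theorem sq_lt_of_sqrt_lt {lam ε : ℝ} (hε : 0 < ε)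
    (hbig : ε < 5 * lam * √(k : ℝ)) : ε ^ 2 ≤ 25 * (lam ^ 2 * k) := by
  have h := pow_le_pow_left₀ hε.le hbig.le 2
  rw [mul_pow, mul_pow, Real.sq_sqrt (Nat.cast_nonneg k)] at h
  linarith

theorem one_le_exp_six {lam : ℝ} (hlam : 0 < lam) : 1 ≤ Real.exp (6 * lam + 6) :=
  Real.one_le_exp (by linarith)

/-- Rounding up costs at most one accuracy, which is below ε²/24 and hence negligible against λ²k,
because ε < 5λ√k. -/
theorem atomCount_le (hk : 0 < k) {lam ε : ℝ} (hlam : 0 < lam) (hε : 0 < ε)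
    (hbig : ε < 5 * lam * √(k : ℝ)) :
    atomCount k lam ε * accuracy k lam ε ≤ 56 * (lam ^ 2 * k) := by
  have h1 := accuracy_pos hk hε (lam := lam)
  have hk1 : (1 : ℝ) ≤ k := by exact_mod_cast hk
  have h2 := Nat.ceil_lt_add_one (a := 7 * (2 * lam * √(k : ℝ)) ^ 2 / accuracy k lam ε)
    (by positivity)
  have h3 := mul_le_mul_of_nonneg_right h2.le h1.le
  have hR : (2 * lam * √(k : ℝ)) ^ 2 = 4 * (lam ^ 2 * k) := by
    rw [mul_pow, mul_pow, Real.sq_sqrt (by linarith)]; ring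
  rw [add_mul, div_mul_cancel₀ _ h1.ne', one_mul] at h3
  have h4 : accuracy k lam ε ≤ ε ^ 2 / 24 := by
    have h5 := one_le_exp_six hlam
    refine div_le_div_of_nonneg_left (by positivity) (by norm_num) ?_
    nlinarith
  have h6 := sq_lt_of_sqrt_lt hε hbig
  rw [atomCount]
  linarith [mul_nonneg (sq_nonneg lam) (Nat.cast_nonneg (α := ℝ) k)]

/-- This is where the sample size is used: κ is of order λ²k/τ, so N must exceed a multiple of λ²k ·
k e^{2λ} · X/τ², and 1/τ² supplies k²e^{12λ}/ε⁴. -/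
theorem threshold_le (hk : 0 < k) {lam ε X : ℝ} (hlam : 0 < lam) (hε : 0 < ε)
    (hbig : ε < 5 * lam * √(k : ℝ)) (hX : 0 ≤ X) {N : ℕ} (hN : 10 ^ 8 * Real.exp 12
      * (lam ^ 2 * (k : ℝ) ^ 4 * Real.exp (14 * lam) * X / ε ^ 4) ≤ N) :
    4 * (6 * atomCount k lam ε * X) * (k * Real.exp (2 * lam)) ≤ N * accuracy k lam ε := by
  have hk0 : (0 : ℝ) < k := by exact_mod_cast hk
  have hτ := accuracy_pos hk hε (lam := lam)
  have hs := sq_accuracy hk hε (lam := lam)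
  have hκ := atomCount_le hk hlam hε hbig
  set τ := accuracy k lam ε
  set κ := atomCount k lam ε
  have h14 : Real.exp (14 * lam) = Real.exp (12 * lam) * Real.exp (2 * lam) := by
    rw [← Real.exp_add]; ring_nf
  have h1 : 10 ^ 8 * (lam ^ 2 * k ^ 2 * Real.exp (2 * lam) * X) ≤ 576 * (N * τ ^ 2) := by
    rw [← hs, h14] at hN
    have e : 10 ^ 8 * Real.exp 12 * (lam ^ 2 * (k : ℝ) ^ 4
        * (Real.exp (12 * lam) * Real.exp (2 * lam)) * X
        / (τ ^ 2 * (576 * k ^ 2 * Real.exp 12 * Real.exp (12 * lam))))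
        = 10 ^ 8 * (lam ^ 2 * k ^ 2 * Real.exp (2 * lam) * X) / (576 * τ ^ 2) := by
      field_simp
    rw [e, div_le_iff₀ (by positivity)] at hN
    linarith
  refine le_of_mul_le_mul_right ?_ hτ
  have h2 := mul_le_mul_of_nonneg_right hκ
    (show 0 ≤ 24 * X * (k * Real.exp (2 * lam)) by positivity)
  have h3 : 0 ≤ lam ^ 2 * k ^ 2 * Real.exp (2 * lam) * X := by positivity
  linarith

/-- A lower bound for the expected number of samples of a regression. -/
theorem sample_count_ge (hk : 0 < k) {lam ε X : ℝ} (hε : 0 < ε)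
    (hbig : ε < 5 * lam * √(k : ℝ)) (hX : 0 ≤ X) {N : ℕ} (hN : 10 ^ 8 * Real.exp 12
      * (lam ^ 2 * (k : ℝ) ^ 4 * Real.exp (14 * lam) * X / ε ^ 4) ≤ N) :
    10 ^ 6 * (k ^ 2 * Real.exp (6 * lam + 6) ^ 2 * X / ε ^ 2)
      ≤ 1 / 4 * (N * (k * Real.exp (2 * lam))⁻¹) := by
  have hk0 : (0 : ℝ) < k := by exact_mod_cast hk
  have h14 : Real.exp (14 * lam) = Real.exp (12 * lam) * Real.exp (2 * lam) := by
    rw [← Real.exp_add]; ring_nf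
  have h1 := mul_le_mul_of_nonneg_right hN
    (show 0 ≤ 1 / 4 * (k * Real.exp (2 * lam))⁻¹ by positivity)
  have e : 10 ^ 8 * Real.exp 12
      * (lam ^ 2 * (k : ℝ) ^ 4 * Real.exp (14 * lam) * X / ε ^ 4)
      * (1 / 4 * (k * Real.exp (2 * lam))⁻¹)
      = 10 ^ 6 * (k ^ 2 * Real.exp (6 * lam + 6) ^ 2 * X / ε ^ 2)
        * (25 * (lam ^ 2 * k) / ε ^ 2) := by
    rw [h14, exp_six_sq]
    field_simp
    ring
  -- Outside the trivial case λ²k/ε² is bounded below, which removes λ² from the lower bound;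
  -- otherwise small λ would allow regressions with too few samples for the bisections.
  have h2 : 1 ≤ 25 * (lam ^ 2 * k) / ε ^ 2 := by
    rw [le_div_iff₀ (by positivity), one_mul]; exact sq_lt_of_sqrt_lt hε hbig
  rw [e] at h1
  refine le_trans (le_mul_of_one_le_right (by positivity) h2) (h1.trans (le_of_eq (by ring)))

theorem sq_le_two_pow (m : ℕ) : m ^ 2 ≤ 2 * 2 ^ m := by
  induction m with
  | zero => norm_num
  | succ m ih =>
    rcases Nat.lt_or_ge m 3 with h | h
    · interval_cases m <;> norm_num
    · rw [pow_succ 2 m]; nlinarith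

/-- The errors of the bisections are negligible. -/
theorem bisection_error_le (hn : 3 ≤ n) (hk : 0 < k) {lam ε X : ℝ} (hlam : 0 < lam) (hε : 0 < ε)
    (hε1 : ε ≤ 1) (hX : Real.log n ≤ X) {m : ℕ}
    (hm : 10 ^ 6 * (k ^ 2 * Real.exp (6 * lam + 6) ^ 2 * X / ε ^ 2) ≤ m) :
    6 * (12 * (2 * lam * √(k : ℝ)) * Real.log n ^ 2 / 2 ^ m) ≤ accuracy k lam ε / 2 := by
  have hk1 : (1 : ℝ) ≤ k := by exact_mod_cast hk
  have hL := one_lt_log hn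
  have hE1 := one_le_exp_six hlam
  have hE : lam ≤ Real.exp (6 * lam + 6) := by linarith [Real.add_one_le_exp (6 * lam + 6)]
  set E := Real.exp (6 * lam + 6) with hEdef
  have hsq : √(k : ℝ) ≤ k := by
    rw [Real.sqrt_le_left (by linarith)]; nlinarith
  have h0 : k * E * Real.log n / ε ≤ m := by
    refine le_trans ?_ hm
    have h1 : k * E * Real.log n / ε ≤ k ^ 2 * E ^ 2 * X / ε ^ 2 := by
      have ha : (k : ℝ) ≤ k ^ 2 := by nlinarith
      have hb : E ≤ E ^ 2 := by nlinarith
      have hc : ε ^ 2 ≤ ε := by nlinarith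
      have hX0 : 0 ≤ X := by linarith
      have hnum : 0 ≤ k ^ 2 * E ^ 2 * X := by positivity
      gcongr
    have h2 : 0 ≤ k ^ 2 * E ^ 2 * X / ε ^ 2 := by
      have : 0 ≤ X := by linarith
      positivity
    linarith
  have h1 : 10 ^ 6 * (k ^ 2 * E ^ 2 * Real.log n / ε ^ 2) ≤ m := by
    refine le_trans ?_ hm
    gcongr
  have h2 : (m : ℝ) ^ 2 ≤ 2 * 2 ^ m := by exact_mod_cast sq_le_two_pow m
  -- Two lower bounds for m are multiplied, since 2^m is only needed to exceed half of m².
  have h3 : 10 ^ 6 * (k ^ 2 * E ^ 2 * Real.log n / ε ^ 2) * (k * E * Real.log n / ε)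
      ≤ 2 * 2 ^ m := by
    refine le_trans ?_ h2
    rw [sq (m : ℝ)]
    exact mul_le_mul h1 h0 (by positivity) (Nat.cast_nonneg m)
  have h4 : 10 ^ 6 * (k ^ 2 * E ^ 2 * Real.log n ^ 2 / ε ^ 2) ≤ 2 * 2 ^ m := by
    refine le_trans ?_ h3
    have h5 : 1 ≤ k * E / ε := by
      rw [le_div_iff₀ hε, one_mul]; nlinarith
    have e : 10 ^ 6 * (k ^ 2 * E ^ 2 * Real.log n / ε ^ 2) * (k * E * Real.log n / ε)
        = 10 ^ 6 * (k ^ 2 * E ^ 2 * Real.log n ^ 2 / ε ^ 2) * (k * E / ε) := by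
      field_simp
    rw [e]
    exact le_mul_of_one_le_right (by positivity) h5
  have h6 : lam * √(k : ℝ) ≤ E * k := mul_le_mul hE hsq (by positivity) (by positivity)
  have hP : (0 : ℝ) < 2 ^ m := by positivity
  rw [← mul_div_assoc, div_le_iff₀ hP, accuracy, ← hEdef]
  calc 6 * (12 * (2 * lam * √(k : ℝ)) * Real.log n ^ 2)
      = 144 * (lam * √(k : ℝ)) * Real.log n ^ 2 := by ring
    _ ≤ 144 * (E * k) * Real.log n ^ 2 := by gcongr
    _ ≤ 10 ^ 6 / 96 * (E * k) * Real.log n ^ 2 := by gcongr; norm_num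
    _ = ε ^ 2 / (24 * k * E) / 2
        * (10 ^ 6 * (k ^ 2 * E ^ 2 * Real.log n ^ 2 / ε ^ 2) / 2) := by field_simp; norm_num
    _ ≤ ε ^ 2 / (24 * k * E) / 2 * 2 ^ m := by
      refine mul_le_mul_of_nonneg_left ?_ (by positivity)
      linarith

theorem log_le_log_div (hk : 0 < k) (hn : 3 ≤ n) {ρ : ℝ} (hρ : 0 < ρ) (hρ1 : ρ < 1) :
    Real.log n ≤ Real.log (n * k / ρ) := by
  have hk1 : (1 : ℝ) ≤ k := by exact_mod_cast hk
  have hn1 : (3 : ℝ) ≤ n := by exact_mod_cast hn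
  refine Real.log_le_log (by linarith) ?_
  rw [le_div_iff₀ hρ]
  nlinarith

/-- Everything is measured in A = (nk/ρ)³. It exceeds the number of atoms and satisfies 3nk² ≤ ρA,
while e^(-t) = A^(-2κ) leaves A^(-κ) ≤ 1/A after the union bound over the atoms. -/
theorem failure_le (hn : 3 ≤ n) (hk : 0 < k) {ρ r : ℝ} (hρ : 0 < ρ) (hρ1 : ρ < 1) {κ : ℕ}
    (hκ : 0 < κ) (hr : 3 * Real.log (n * k / ρ) ≤ r) :
    ((n * k ^ 2 : ℕ) : ℝ) * (((2 * n * k ^ 2 + 1) ^ κ : ℕ)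
      * Real.exp (-(6 * κ * Real.log (n * k / ρ))) + 2 * Real.exp (-r)) ≤ ρ := by
  have hk1 : (1 : ℝ) ≤ k := by exact_mod_cast hk
  have hn1 : (3 : ℝ) ≤ n := by exact_mod_cast hn
  have hnk : 3 ≤ (n : ℝ) * k := by nlinarith
  set B : ℝ := n * k / ρ with hB
  have hBn : (n : ℝ) * k ≤ B := by
    rw [hB, le_div_iff₀ hρ]; nlinarith
  have hB0 : 0 < B := by linarith
  have hnk2 : 3 * ((n : ℝ) * k ^ 2) ≤ n * k * (n * k) := by
    have : 0 ≤ (n : ℝ) * k ^ 2 := by positivity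
    nlinarith
  have hB3 : 3 * ((n : ℝ) * k ^ 2) ≤ ρ * B ^ 3 := by
    have e : ρ * B ^ 3 = n * k * B * B := by
      rw [hB]; field_simp
    rw [e]
    refine hnk2.trans ?_
    have h1 : n * k * (n * k) ≤ n * k * B := mul_le_mul_of_nonneg_left hBn (by linarith)
    have h2 : 1 ≤ B := by linarith
    exact h1.trans (le_mul_of_one_le_right (by positivity) h2)
  set A := B ^ 3 with hA
  have hA1 : 1 ≤ A := one_le_pow₀ (by linarith)
  have hA0 : 0 < A := by linarith
  have hexp : ∀ m : ℕ, Real.exp (-(m * (3 * Real.log B))) = (A ^ m)⁻¹ := fun m => by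
    rw [Real.exp_neg, Real.exp_nat_mul, hA]
    congr 2
    rw [show 3 * Real.log B = ((3 : ℕ) : ℝ) * Real.log B by norm_num, Real.exp_nat_mul,
      Real.exp_log hB0]
  have h1 : Real.exp (-r) ≤ A⁻¹ := by
    have := hexp 1
    rw [pow_one] at this
    rw [← this]
    exact Real.exp_le_exp.2 (by push_cast; linarith)
  have h2 : (((2 * n * k ^ 2 + 1) ^ κ : ℕ) : ℝ) * Real.exp (-(6 * κ * Real.log B)) ≤ A⁻¹ := by
    have e : 6 * κ * Real.log B = ((2 * κ : ℕ) : ℝ) * (3 * Real.log B) := by push_cast; ring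
    rw [e, hexp, two_mul κ, pow_add, ← div_eq_mul_inv, div_le_iff₀ (by positivity)]
    have h3 : (((2 * n * k ^ 2 + 1) ^ κ : ℕ) : ℝ) ≤ A ^ κ := by
      push_cast
      refine pow_le_pow_left₀ (by positivity) ?_ κ
      have h4 : 1 ≤ (n : ℝ) * k ^ 2 := by nlinarith
      have h5 : ρ * A ≤ A := mul_le_of_le_one_left hA0.le hρ1.le
      nlinarith
    refine h3.trans ?_
    rw [← mul_assoc]
    refine le_mul_of_one_le_left (by positivity) ?_
    rw [← div_eq_inv_mul, le_div_iff₀ hA0, one_mul]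
    exact le_self_pow₀ hA1 hκ.ne'
  calc _ ≤ ((n * k ^ 2 : ℕ) : ℝ) * (A⁻¹ + 2 * A⁻¹) := by gcongr
    _ = 3 * ((n : ℝ) * k ^ 2) / A := by push_cast; field_simp; norm_num
    _ ≤ ρ := by rw [div_le_iff₀ hA0]; exact hB3

end Parameters

/-! ### Accuracy of the algorithm and of the program on typical samples. -/

section Main

variable {n k : ℕ} (M : Model n k)

theorem Model.samples_isTypical_ge (hn : 3 ≤ n) (hk : 0 < k) {lam ε ρ : ℝ} (hlam : M.width ≤ lam)
    (hlam0 : 0 < lam) (hε : 0 < ε) (hε1 : ε ≤ 1) (hρ : 0 < ρ) (hρ1 : ρ < 1)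
    (hbig : ε < 5 * lam * √(k : ℝ)) {N : ℕ} (hN : 10 ^ 8 * Real.exp 12
      * (lam ^ 2 * (k : ℝ) ^ 4 * Real.exp (14 * lam) * Real.log (n * k / ρ) / ε ^ 4) ≤ N) :
    ENNReal.ofReal (1 - ρ) ≤ M.samples N {z | M.IsTypical (2 * lam * √(k : ℝ)) (atomCount k lam ε)
      (6 * atomCount k lam ε * Real.log (n * k / ρ)) z} := by
  have := M.isProbabilityMeasure_samples hk N
  have hX := (one_lt_log hn).trans_le (log_le_log_div hk hn hρ hρ1)
  have h1 := sample_count_ge hk hε hbig (by linarith) hN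
  have hk1 : (1 : ℝ) ≤ k := by exact_mod_cast hk
  have h2 : 3 * Real.log (n * k / ρ) ≤ 1 / 4 * (N * (k * Real.exp (2 * lam))⁻¹) := by
    refine le_trans ?_ h1
    have h3 : 1 ≤ k ^ 2 * Real.exp (6 * lam + 6) ^ 2 / ε ^ 2 := by
      rw [le_div_iff₀ (by positivity), one_mul]
      have ha : 1 ≤ (k : ℝ) ^ 2 := one_le_pow₀ hk1
      have hb := one_le_pow₀ (one_le_exp_six hlam0) (n := 2)
      have hc : ε ^ 2 ≤ 1 := pow_le_one₀ hε.le hε1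
      nlinarith
    have h4 := mul_le_mul_of_nonneg_right h3 (show 0 ≤ Real.log (n * k / ρ) by linarith)
    rw [div_mul_eq_mul_div] at h4
    linarith
  have h3 := (M.samples_not_isTypical_le hk hlam N (2 * lam * √(k : ℝ)) (atomCount k lam ε)
    (6 * atomCount k lam ε * Real.log (n * k / ρ))).trans (ENNReal.ofReal_le_ofReal
      (failure_le hn hk hρ hρ1 (atomCount_pos hk hlam0 hε) h2))
  rw [ENNReal.ofReal_sub _ hρ.le, ENNReal.ofReal_one, tsub_le_iff_right]
  calc (1 : ENNReal) = M.samples N Set.univ := measure_univ.symm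
    _ ≤ M.samples N ({z | M.IsTypical (2 * lam * √(k : ℝ)) (atomCount k lam ε)
      (6 * atomCount k lam ε * Real.log (n * k / ρ)) z} ∪
        {z | ¬ M.IsTypical (2 * lam * √(k : ℝ)) (atomCount k lam ε)
      (6 * atomCount k lam ε * Real.log (n * k / ρ)) z}) :=
        measure_mono fun z _ => em _
    _ ≤ _ := (measure_union_le _ _).trans (add_le_add le_rfl h3)

variable {M}

/-- In a typical sample, sufficiently accurate solutions of a regression are close to the truth. -/
theorem Model.IsTypical.abs_center_sub_le (hn : 3 ≤ n) (hk : 0 < k) {lam ε ρ opt : ℝ}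
    (hlam : M.width ≤ lam) (hlam0 : 0 < lam) (hε : 0 < ε) (hε1 : ε ≤ 1) (hρ : 0 < ρ) (hρ1 : ρ < 1)
    (hbig : ε < 5 * lam * √(k : ℝ)) {N : ℕ} (hN1 : 1 ≤ N) (hN : 10 ^ 8 * Real.exp 12
      * (lam ^ 2 * (k : ℝ) ^ 4 * Real.exp (14 * lam) * Real.log (n * k / ρ) / ε ^ 4) ≤ N)
    {z : Fin N → Fin n → Fin k}
    (hz : M.IsTypical (2 * lam * √(k : ℝ)) (atomCount k lam ε)
      (6 * atomCount k lam ε * Real.log (n * k / ρ)) z)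
    (hopt : 0 ≤ opt) (hopt1 : 6 * opt ≤ accuracy k lam ε) {i j : Fin n} (hj : j ≠ i)
    {α β : Fin k} (hαβ : α ≠ β) {w : Mat n k} (hw : groupNorm 1 w ≤ 2 * lam * √(k : ℝ))
    (hloss : totalLoss (restricted z i α β) (fun m => feature i (z m)) (fun m => label i α (z m)) w
      ≤ totalLoss (restricted z i α β) (fun m => feature i (z m)) (fun m => label i α (z m))
          (M.trueWeight i α β) + (restricted z i α β).card * opt) (b : Fin k) :
    |center i w j b - M.trueWeight i α β j b| ≤ ε / 2 := by
  have hk0 : (0 : ℝ) < k := by exact_mod_cast hk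
  have hN0 : (0 : ℝ) < N := by exact_mod_cast hN1
  have hX := (one_lt_log hn).trans_le (log_le_log_div hk hn hρ hρ1)
  refine M.abs_center_sub_le hk hlam hε hε1 hj α β b ?_
  refine (hz.predictionGap_le hk hN1 (atomCount_pos hk hlam0 hε) (by positivity) hopt hαβ hw
    hloss).trans ?_
  have h1 := atomCount_ge hk hlam0 hε
  have h2 := threshold_le hk hlam0 hε hbig (by linarith) hN
  have h3 := M.pairMean_one_ge hk hlam i α β
  have hq0 : 0 ≤ M.pairMean i α β fun _ => 1 := M.pairMean_nonneg hk fun _ => zero_le_one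
  -- The admissible gap is split into three equal parts: optimization, sparse approximation and
  -- fluctuation of the samples.
  have e : ε ^ 2 / (8 * k * Real.exp (6 * lam + 6)) = 3 * accuracy k lam ε := by
    rw [accuracy]; field_simp; norm_num
  rw [e]
  set q := M.pairMean i α β fun _ => 1
  set t := 6 * atomCount k lam ε * Real.log (n * k / ρ) with ht
  have ht0 : 0 ≤ t := mul_nonneg (by positivity) (by linarith)
  have h4 : 4 * t / N ≤ q * accuracy k lam ε := by
    rw [div_le_iff₀ hN0]
    have h5 := mul_le_mul_of_nonneg_left h3 (show 0 ≤ 4 * t by positivity)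
    have h6 := mul_le_mul_of_nonneg_right h2 hq0
    linarith
  have h5 := mul_le_mul_of_nonneg_left (add_le_add hopt1 h1) hq0
  linarith

theorem close_of_isOutput (hn : 3 ≤ n) (hk : 0 < k) {lam ε ρ η : ℝ}
    (hlam : M.width ≤ lam) (hlam0 : 0 < lam) (hε : 0 < ε) (hε1 : ε ≤ 1) (hρ : 0 < ρ) (hρ1 : ρ < 1)
    (hbig : ε < 5 * lam * √(k : ℝ)) {T N : ℕ} (hT1 : 1 ≤ T) (hN1 : 1 ≤ N)
    (hT : 10 ^ 8 * Real.exp 12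
      * (lam ^ 2 * (k : ℝ) ^ 3 * Real.exp (12 * lam) * Real.log n / ε ^ 4) ≤ T)
    (hN : 10 ^ 8 * Real.exp 12
      * (lam ^ 2 * (k : ℝ) ^ 4 * Real.exp (14 * lam) * Real.log (n * k / ρ) / ε ^ 4) ≤ N)
    {z : Fin N → Fin n → Fin k}
    (hz : M.IsTypical (2 * lam * √(k : ℝ)) (atomCount k lam ε)
      (6 * atomCount k lam ε * Real.log (n * k / ρ)) z)
    {What : Fin n → Fin n → Fin k → Fin k → ℝ} {G : Fin n → Fin n → Bool}
    (h : IsOutput lam η T (fun _ => 0) z What G) : M.Close ε What := by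
  have hk0 : (0 : ℝ) < k := by exact_mod_cast hk
  have hR : 0 < 2 * lam * √(k : ℝ) := by positivity
  obtain ⟨⟨w, hw, hW⟩, -⟩ := h
  have hτ := accuracy_pos hk hε (lam := lam)
  have hs := sqrt_iterations_le hn hk hlam0 hε hT1 hT
  exact M.close_of_center hk hε hW fun i j hj α β hαβ b =>
    hz.abs_center_sub_le hn hk hlam hlam0 hε hε1 hρ hρ1 hbig hN1 hN (by positivity) (by linarith)
      hj hαβ ((hw i α β hαβ).groupNorm_le hn hk hR.le)
      ((hw i α β hαβ).totalLoss_le hn hk hR hT1 (fun m j => rowNorm_feature_le i (z m) j)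
        (fun m => abs_label_le i α (z m)) (M.groupNorm_trueWeight_le hlam i α β)) b

theorem descentProg_groupNorm_le (hn : 3 ≤ n) (hk : 0 < k) {N : ℕ} {S : List (Fin N)}
    (hS : S.Nodup) (z : Fin N → Fin n → Fin k) (i : Fin n) (α : Fin k) {R : ℝ} (hR : 0 ≤ R)
    {T : ℕ} (hT : 1 ≤ T) : groupNorm 1 (descentProg S z i α R T).val ≤ R := by
  obtain ⟨w, δ, hw0, hw, -, -, he⟩ := descentProg_spec hn hk hS z i α hR hT
  rw [he]
  refine groupNorm_average_le hR fun t ht => ?_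
  rcases t with _ | t
  · rw [hw0]
    exact (groupNorm_uniformStart hn hk).le
  · exact (hw t (by omega)).1

/-- The bound on the sum of all update errors, divided by γT, leaves a contribution independent of T
and exponentially small in the number of samples. -/
theorem descentProg_totalLoss_le (hn : 3 ≤ n) (hk : 0 < k) {N : ℕ} {S : List (Fin N)}
    (hS : S.Nodup) (z : Fin N → Fin n → Fin k) (i : Fin n) (α : Fin k) {R : ℝ} (hR : 0 < R)
    {T : ℕ} (hT : 1 ≤ T) {v : Mat n k} (hv : groupNorm 1 v ≤ R) :
    totalLoss S.toFinset (fun m => feature i (z m)) (fun m => label i α (z m))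
        (descentProg S z i α R T).val
      ≤ totalLoss S.toFinset (fun m => feature i (z m)) (fun m => label i α (z m)) v
        + S.toFinset.card * (5 * R * √(mirrorScale n / T)
          + 12 * R * Real.log n ^ 2 / 2 ^ S.length) := by
  have hT1 : (1 : ℝ) ≤ T := by exact_mod_cast hT
  have hL := one_lt_log hn
  obtain ⟨w, δ, hw0, hw, -, hδ, he⟩ := descentProg_spec hn hk hS z i α hR.le hT
  rw [he]
  refine (totalLoss_descent_le hn hk S.toFinset hR hT (fun m j => rowNorm_feature_le i (z m) j)
    (fun m => abs_label_le i α (z m)) hw0 hw hv).trans ?_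
  refine add_le_add_right (mul_le_mul_of_nonneg_left (add_le_add_right ?_ _)
    (Nat.cast_nonneg _)) _
  have hγ := stepSize_pos hn hR hT
  set γ := stepSize n R T with hγdef
  -- Here 2RγT = √(T e ln n), so the initial potential ln n is also absorbed by a multiple of γT.
  have hγT : 1 ≤ 2 * R * (γ * T) := by
    have hc : 1 ≤ mirrorScale n := by
      rw [mirrorScale]
      have := Real.one_le_exp (zero_le_one (α := ℝ))
      nlinarith
    have e : 2 * R * (γ * T) = √(mirrorScale n / T) * T := by
      rw [hγdef, stepSize, ← mirrorScale]; field_simp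
    rw [e]
    have h1 : 1 / (T : ℝ) ≤ √(mirrorScale n / T) := by
      refine Real.le_sqrt_of_sq_le ?_
      rw [div_pow, one_pow, sq, ← div_div]
      refine div_le_div_of_nonneg_right ?_ (by linarith)
      exact (div_le_one_of_le₀ hT1 (by linarith)).trans hc
    calc (1 : ℝ) = 1 / T * T := by field_simp
      _ ≤ _ := mul_le_mul_of_nonneg_right h1 (by linarith)
  have hγ0 : 0 < γ * T := by positivity
  rw [div_le_iff₀ hγ0]
  refine hδ.trans ?_
  have hP : (0 : ℝ) < 2 ^ S.length := by positivity
  have h1 : Real.log n + T * (γ * R) ≤ 3 * R * Real.log n * (γ * T) := by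
    have h2 := mul_le_mul_of_nonneg_right hγT (show 0 ≤ Real.log n by linarith)
    have h3 := mul_le_mul_of_nonneg_left hL.le (show 0 ≤ R * (γ * T) by positivity)
    linarith
  calc 4 * Real.log n / 2 ^ S.length * (Real.log n + T * (γ * R))
      ≤ 4 * Real.log n / 2 ^ S.length * (3 * R * Real.log n * (γ * T)) :=
        mul_le_mul_of_nonneg_left h1 (by positivity)
    _ = _ := by ring

theorem close_learnProg (hn : 3 ≤ n) (hk : 0 < k) {lam ε ρ η : ℝ}
    (hlam : M.width ≤ lam) (hlam0 : 0 < lam) (hε : 0 < ε) (hε1 : ε ≤ 1) (hρ : 0 < ρ) (hρ1 : ρ < 1)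
    (hbig : ε < 5 * lam * √(k : ℝ)) {T N : ℕ} (hT1 : 1 ≤ T) (hN1 : 1 ≤ N)
    (hT : 10 ^ 8 * Real.exp 12
      * (lam ^ 2 * (k : ℝ) ^ 3 * Real.exp (12 * lam) * Real.log n / ε ^ 4) ≤ T)
    (hN : 10 ^ 8 * Real.exp 12
      * (lam ^ 2 * (k : ℝ) ^ 4 * Real.exp (14 * lam) * Real.log (n * k / ρ) / ε ^ 4) ≤ N)
    {z : Fin N → Fin n → Fin k}
    (hz : M.IsTypical (2 * lam * √(k : ℝ)) (atomCount k lam ε)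
      (6 * atomCount k lam ε * Real.log (n * k / ρ)) z) :
    M.Close ε (learnProg lam η T z).val.1 := by
  have hk0 : (0 : ℝ) < k := by exact_mod_cast hk
  have hR : 0 < 2 * lam * √(k : ℝ) := by positivity
  have hτ := accuracy_pos hk hε (lam := lam)
  have hs := sqrt_iterations_le hn hk hlam0 hε hT1 hT
  have hXn := log_le_log_div hk hn hρ hρ1
  have hL := one_lt_log hn
  refine M.close_of_center hk hε (U := fun i α β => if (sampleList z i α β).isEmpty then 0
    else center i (descentProg (sampleList z i α β) z i α (2 * lam * √(k : ℝ)) T).val)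
    (fun i j _ α b => ?_) fun i j hj α β hαβ b => ?_
  · rw [learnProg_val_fst]
    congr 1
    exact Finset.sum_congr rfl fun β _ => by split_ifs <;> rfl
  · have hm : 10 ^ 6 * (k ^ 2 * Real.exp (6 * lam + 6) ^ 2 * Real.log (n * k / ρ) / ε ^ 2)
        ≤ ((sampleList z i α β).length : ℝ) := by
      refine (sample_count_ge hk hε hbig (by linarith) hN).trans ?_
      rw [length_sampleList]
      refine le_trans ?_ (hz i α β hαβ).2.1
      have h1 := M.pairMean_one_ge hk hlam i α β
      have h2 : (k * Real.exp (2 * lam))⁻¹ ≤ M.pairMean i α β fun _ => 1 := by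
        rw [inv_le_iff_one_le_mul₀ (by positivity)]
        linarith
      have h3 := mul_le_mul_of_nonneg_left h2 (Nat.cast_nonneg (α := ℝ) N)
      linarith
    have hpos : (0 : ℝ) < (sampleList z i α β).length := by
      refine lt_of_lt_of_le ?_ hm
      have : 0 < Real.log (n * k / ρ) := by linarith
      positivity
    have hne : ¬ ((sampleList z i α β).isEmpty = true) := by
      rw [List.isEmpty_iff_length_eq_zero]
      intro h0
      rw [h0] at hpos
      simp at hpos
    simp only [if_neg hne]
    have hb := bisection_error_le hn hk hlam0 hε hε1 hXn hm
    have hloss := descentProg_totalLoss_le hn hk (nodup_sampleList z i α β) z i α hR hT1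
      (M.groupNorm_trueWeight_le hlam i α β)
    rw [toFinset_sampleList] at hloss
    exact hz.abs_center_sub_le hn hk hlam hlam0 hε hε1 hρ hρ1 hbig hN1 hN (by positivity)
      (by linarith) hj hαβ
      (descentProg_groupNorm_le hn hk (nodup_sampleList z i α β) z i α hR.le hT1) hloss b

theorem close_of_isOutput_of_small (hn : 3 ≤ n) (hk : 0 < k) {lam ε η : ℝ} (hlam : M.width ≤ lam)
    (hsmall : 5 * lam * √(k : ℝ) ≤ ε) {T N : ℕ} {τ : ℕ → ℝ} {z : Fin N → Fin n → Fin k}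
    {What : Fin n → Fin n → Fin k → Fin k → ℝ} {G : Fin n → Fin n → Bool}
    (h : IsOutput lam η T τ z What G) : M.Close ε What := by
  have hlam0 : 0 ≤ lam := (M.width_nonneg (by omega) hk).trans hlam
  obtain ⟨⟨w, hw, hW⟩, -⟩ := h
  refine M.close_of_small hk hlam hlam0 hsmall hW fun i j hj α β hαβ b => ?_
  refine (abs_center_le hk ((hw i α β hαβ).groupNorm_le hn hk (by positivity)) hj b).trans
    (le_of_eq (by ring))

end Main

end PairwiseMRF

theorem mainTheorem6 :
    ∃ C : ℝ, 0 < C ∧ ∃ K : ℕ,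
      ∀ (n k : ℕ), 3 ≤ n → 0 < k →
      ∀ (M : PairwiseMRF.Model n k) (lam ρ ε η : ℝ),
        M.width ≤ lam → 0 < ρ → ρ < 1 → 0 < ε → ε ≤ 1 →
      ∀ (T N : ℕ), 1 ≤ T → 1 ≤ N →
        (C * (lam ^ 2 * (k : ℝ) ^ 3 * Real.exp (12 * lam) * Real.log n / ε ^ 4) ≤ T →
         C * (lam ^ 2 * (k : ℝ) ^ 4 * Real.exp (14 * lam) * Real.log (n * k / ρ) / ε ^ 4) ≤ N →
          ENNReal.ofReal (1 - ρ) ≤ M.samples N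
            {z | (∃ What G, PairwiseMRF.IsOutput lam η T (fun _ => 0) z What G) ∧
              ∀ What G, PairwiseMRF.IsOutput lam η T (fun _ => 0) z What G → M.Close ε What} ∧
          ENNReal.ofReal (1 - ρ) ≤ M.samples N
            {z | M.Close ε (PairwiseMRF.learnProg lam η T z).val.1}) ∧
        ∀ z : Fin N → Fin n → Fin k,
          PairwiseMRF.IsOutput lam η T (fun m => 16 * Real.log n ^ 2 / 2 ^ m) z
            (PairwiseMRF.learnProg lam η T z).val.1 (PairwiseMRF.learnProg lam η T z).val.2 ∧
          (PairwiseMRF.learnProg lam η T z).steps ≤ K * (T * N * n ^ 2 * k ^ 2) := by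
  refine ⟨10 ^ 8 * Real.exp 12, by positivity, 600, ?_⟩
  intro n k hn hk M lam ρ ε η hlam hρ hρ1 hε hε1 T N hT1 hN1
  have hlam0 : 0 ≤ lam := (M.width_nonneg (by omega) hk).trans hlam
  refine ⟨fun hT hN => ?_, fun z => ⟨PairwiseMRF.learnProg_isOutput hn hk hlam0 hT1 z,
    PairwiseMRF.learnProg_steps_le (by omega) hk lam η hT1 hN1 z⟩⟩
  -- For small λ the lower bounds on T and N may be void, and every output is accurate by its size
  -- alone. The other case forces λ > 0, so the radius is positive.
  rcases le_or_gt (5 * lam * √(k : ℝ)) ε with hsmall | hbig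
  · have := M.isProbabilityMeasure_samples hk N
    have huniv : ENNReal.ofReal (1 - ρ) ≤ M.samples N Set.univ := by
      rw [measure_univ, ← ENNReal.ofReal_one]
      exact ENNReal.ofReal_le_ofReal (by linarith)
    exact ⟨huniv.trans (measure_mono fun z _ => ⟨PairwiseMRF.exists_isOutput hn lam η T z,
        fun What G h => PairwiseMRF.close_of_isOutput_of_small hn hk hlam hsmall h⟩),
      huniv.trans (measure_mono fun z _ => PairwiseMRF.close_of_isOutput_of_small hn hk hlam hsmall
        (PairwiseMRF.learnProg_isOutput (η := η) hn hk hlam0 hT1 z))⟩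
  · have hlam1 : 0 < lam := by
      refine lt_of_le_of_ne hlam0 fun h => ?_
      rw [← h] at hbig
      simp only [mul_zero, zero_mul] at hbig
      linarith
    have htyp := M.samples_isTypical_ge hn hk hlam hlam1 hε hε1 hρ hρ1 hbig hN
    exact ⟨htyp.trans (measure_mono fun z hz => ⟨PairwiseMRF.exists_isOutput hn lam η T z, fun What G h =>
        PairwiseMRF.close_of_isOutput hn hk hlam hlam1 hε hε1 hρ hρ1 hbig hT1 hN1 hT hN hz h⟩),
      htyp.trans (measure_mono fun z hz =>
        PairwiseMRF.close_learnProg hn hk hlam hlam1 hε hε1 hρ hρ1 hbig hT1 hN1 hT hN hz)⟩
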